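/- Let $s\in\{0,\tfrac12\}$, $e\in\mathbb R$, $\Lambda>0$, and let $\mathcal F$ be the symmetric Fock space over $L^2(\{1,2\}\times\mathbb R^3)$, with $n$-photon spaces $L^2_{\mathrm{sym}}((\{1,2\}\times\mathbb R^3)^n)$. Let $a^*(f)$ be the creation operator, $(a^*(f)\psi)_{(n)}=\sqrt n\,\mathcal P_n(f\otimes\psi_{(n-1)})$, with $\mathcal P_n$ the projection onto totally symmetric functions, let $a(f)=a^*(f)^*$, let $\phi(f)$ be the closure of $2^{-1/2}(a(f)+a^*(f))$, and let $\mathsf d\Gamma(w)$ denote the second quantization of multiplication by $w$. Let $\varepsilon_1(k),\varepsilon_2(k)\in\mathbb R^3$ be polarization vectors, i.e. measurable functions of $k/|k|$ such that $(k/|k|,\varepsilon_1(k),\varepsilon_2(k))$ is an orthonormal basis of $\mathbb R^3$ for almost every $k$. Put $$\rho(k)=(2\pi)^{-3/2}\mathbf 1_{[0,\Lambda]}(|k|),\quad f_A(\lambda,k)=\frac{\rho(k)}{\sqrt{|k|}}\,\varepsilon_\lambda(k),\quad f_B(\lambda,k)=-\mathrm i\,k\wedge f_A(\lambda,k),$$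 $A_j=\phi(f_{A,j})$, $B_j=\phi(f_{B,j})$, $(P_{\mathrm f})_j=\mathsf d\Gamma(k_j)$, and $H_{\mathrm f,m}=\mathsf d\Gamma(\sqrt{m^2+k^2})$ for $m\ge 0$. Let $S$ be the vector of Pauli matrices if $s=\tfrac12$ and $S=0$ if $s=0$. For $\xi\in\mathbb R^3$ let $$H_m(\xi)=\tfrac12(\xi-P_{\mathrm f}+eA)^2+e\,S\cdot B+H_{\mathrm f,m}$$ on $\mathbb C^{2s+1}\otimes\mathcal F$, with domain the natural domain of $P_{\mathrm f}^2+H_{\mathrm f,m}$, and let $E_m(\xi)=\inf\sigma(H_m(\xi))$ and $E=E_0$. Let $(m_j)_{j\in\mathbb N}$ be a sequence of nonnegative numbers converging to zero. Then there exists a set $D\subset\mathbb R^3$ such that $\mathbb R^3\setminus D$ has Lebesgue measure zero, the functions $E$ and $E_{m_j}$, $j\in\mathbb N$, are differentiable at all points of $D$, and for all $\xi\in D$: (a) $\nabla E_{m_j}(\xi)\to\nabla E(\xi)$ as $j\to\infty$; (b) for every $l\in\{1,2,3\}$ the second partial derivatives $\partial_l^2E_{m_j}(\xi)$, $j\in\mathbb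 N$, exist and $\liminf_{j\to\infty}\bigl(-\partial_l^2E_{m_j}(\xi)\bigr)<\infty$. Here $\partial_l^2 f(\xi)$ is said to exist if $\partial_l f$ exists at $\xi$ and at almost every point near $\xi$ of the line through $\xi$ in the $l$-th coordinate direction, and $\partial_l f$, restricted to the points of that line where it exists, is differentiable at $\xi$; the derivative is $\partial_l^2 f(\xi)$. -/

import Mathlib

open MeasureTheory Filter Topology

namespace PauliFierz

noncomputable section

/-! ### One-photon space and Fock space -/

/-- Momentum space `ℝ³` with the Euclidean norm. -/
abbrev E3 : Type := EuclideanSpace ℝ (Fin 3)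

/-- One-photon configurations `(λ, k)`: a polarization label and a wave vector. -/
abbrev Photon : Type := Fin 2 × E3

/-- Counting measure on the polarizations times Lebesgue measure on the wave vectors;
the one-photon space `𝔥` is `L²` of this measure. -/
def photonMeasure : Measure Photon := (Measure.count : Measure (Fin 2)).prod volume

instance : SigmaFinite photonMeasure := by
  unfold photonMeasure; infer_instance

/-- The measure `dk₁ ⋯ dkₙ` (with sums over polarizations) on `n`-photon configurations. -/
abbrev confMeasure (n : ℕ) : Measure (Fin n → Photon) :=
  Measure.pi fun _ : Fin n => photonMeasure

lemma measurePreserving_perm {n : ℕ} (π : Equiv.Perm (Fin n)) :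
    MeasurePreserving (fun x : Fin n → Photon => fun i => x (π i))
      (confMeasure n) (confMeasure n) := by
  have h := measurePreserving_piCongrLeft (fun _ : Fin n => photonMeasure) π.symm
  convert h using 1
  funext x i
  have := MeasurableEquiv.piCongrLeft_apply_apply (β := fun _ : Fin n => Photon) π.symm x (π i)
  simpa using this.symm

/-- The `n`-photon space: the totally symmetric functions in `L²((ℤ₂ × ℝ³)ⁿ)`. -/
def nPhoton (n : ℕ) : Submodule ℂ (Lp ℂ 2 (confMeasure n)) where
  carrier := {ψ | ∀ π : Equiv.Perm (Fin n), (fun x => ψ fun i => x (π i)) =ᵐ[confMeasure n] ψ}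
  zero_mem' := by
    intro π
    have h := Lp.coeFn_zero ℂ 2 (confMeasure n)
    exact ((measurePreserving_perm π).quasiMeasurePreserving.ae_eq_comp h).trans h.symm
  add_mem' := by
    intro a b ha hb π
    have h := Lp.coeFn_add a b
    refine ((measurePreserving_perm π).quasiMeasurePreserving.ae_eq_comp h).trans
      (EventuallyEq.trans ?_ h.symm)
    filter_upwards [ha π, hb π] with x h1 h2
    simp only [Function.comp_apply, Pi.add_apply]
    rw [h1, h2]
  smul_mem' := by
    intro c a ha π
    have h := Lp.coeFn_smul c a
    refine ((measurePreserving_perm π).quasiMeasurePreserving.ae_eq_comp h).trans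
      (EventuallyEq.trans ?_ h.symm)
    filter_upwards [ha π] with x h1
    simp only [Function.comp_apply, Pi.smul_apply]
    rw [h1]

lemma isClosed_nPhoton (n : ℕ) : IsClosed (nPhoton n : Set (Lp ℂ 2 (confMeasure n))) := by
  have h : (nPhoton n : Set (Lp ℂ 2 (confMeasure n))) =
      ⋂ π : Equiv.Perm (Fin n),
        {ψ | Lp.compMeasurePreservingₗᵢ ℂ _ (measurePreserving_perm π) ψ = ψ} := by
    ext ψ
    simp only [Set.mem_iInter, Set.mem_ofPred_eq]
    refine forall_congr' fun π => ?_
    have h1 := Lp.coeFn_compMeasurePreserving ψ (measurePreserving_perm π)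
    constructor
    · intro h
      exact Lp.ext (h1.trans h)
    · intro h
      refine h1.symm.trans ?_
      have h' : Lp.compMeasurePreserving _ (measurePreserving_perm π) ψ = ψ := h
      rw [h']
  rw [h]
  exact isClosed_iInter fun π =>
    isClosed_eq (LinearIsometry.continuous _) continuous_id

instance (n : ℕ) : CompleteSpace (nPhoton n) :=
  (isClosed_nPhoton n).completeSpace_coe

/-- The symmetric Fock space over `L²(ℤ₂ × ℝ³)`, the Hilbert sum of the `n`-photon spaces. -/
abbrev Fock : Type := lp (fun n : ℕ => nPhoton n) 2

/-! ### Creation, annihilation and field operators, second quantization -/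

/-- On symmetric `φ` this is `√(n+1) 𝒫ₙ₊₁ (f ⊗ φ)`, the symmetrization being written out as
the average over the argument that is inserted into `f`. -/
def createFun (f : Photon → ℂ) {n : ℕ} (φ : (Fin n → Photon) → ℂ) (x : Fin (n + 1) → Photon) : ℂ :=
  ((1 / Real.sqrt (n + 1) : ℝ) : ℂ) * ∑ i, f (x i) * φ fun j => x (i.succAbove j)

lemma createFun_congr (f : Photon → ℂ) {n : ℕ} {φ φ' : (Fin n → Photon) → ℂ}
    (h : φ =ᵐ[confMeasure n] φ') :
    createFun f φ =ᵐ[confMeasure (n + 1)] createFun f φ' := by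
  have key : ∀ i : Fin (n + 1), ∀ᵐ x ∂(confMeasure (n + 1)),
      (φ fun j => x (i.succAbove j)) = φ' fun j => x (i.succAbove j) := by
    intro i
    have h1 := measurePreserving_piFinSuccAbove (fun _ : Fin (n + 1) => photonMeasure) i
    have h2 : Measure.QuasiMeasurePreserving
        (fun x : Fin (n + 1) → Photon => fun j => x (i.succAbove j))
        (confMeasure (n + 1)) (confMeasure n) :=
      Measure.quasiMeasurePreserving_snd.comp h1.quasiMeasurePreserving
    exact h2.ae_eq_comp h
  filter_upwards [ae_all_iff.2 key] with x hx
  simp only [createFun, hx]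

/-- The graph of the creation operator: the pairs `(ψ, χ)` in Fock space with
`χ₀ = 0` and `χₙ₊₁ = √(n+1) 𝒫ₙ₊₁ (f ⊗ ψₙ)`. -/
def createGraph (f : Photon → ℂ) : Submodule ℂ (Fock × Fock) where
  carrier := {p | p.2 0 = 0 ∧
    ∀ n, ((p.2 (n + 1) : Lp ℂ 2 (confMeasure (n + 1))) : (Fin (n + 1) → Photon) → ℂ)
      =ᵐ[confMeasure (n + 1)] createFun f ((p.1 n : Lp ℂ 2 (confMeasure n)) : _ → ℂ)}
  zero_mem' := by
    refine ⟨rfl, fun n => ?_⟩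
    have h0 := createFun_congr f (Lp.coeFn_zero ℂ 2 (confMeasure n))
    refine (Lp.coeFn_zero ℂ 2 (confMeasure (n + 1))).trans (EventuallyEq.trans ?_ h0.symm)
    refine Eventually.of_forall fun x => ?_
    simp [createFun]
  add_mem' := by
    rintro a b ⟨ha0, ha⟩ ⟨hb0, hb⟩
    refine ⟨by simp [ha0, hb0], fun n => ?_⟩
    have h0 := createFun_congr f (Lp.coeFn_add (a.1 n : Lp ℂ 2 (confMeasure n)) (b.1 n))
    refine (Lp.coeFn_add (a.2 (n + 1) : Lp ℂ 2 (confMeasure (n + 1))) (b.2 (n + 1))).trans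
      (EventuallyEq.trans ?_ h0.symm)
    filter_upwards [ha n, hb n] with x h1 h2
    simp only [Pi.add_apply, h1, h2, createFun, mul_add, Finset.sum_add_distrib]
  smul_mem' := by
    rintro c a ⟨ha0, ha⟩
    refine ⟨by simp [ha0], fun n => ?_⟩
    have h0 := createFun_congr f (Lp.coeFn_smul c (a.1 n : Lp ℂ 2 (confMeasure n)))
    refine (Lp.coeFn_smul c (a.2 (n + 1) : Lp ℂ 2 (confMeasure (n + 1)))).trans
      (EventuallyEq.trans ?_ h0.symm)
    filter_upwards [ha n] with x h1
    simp only [Pi.smul_apply, h1, createFun, smul_eq_mul, Finset.mul_sum]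
    exact Finset.sum_congr rfl fun i _ => by ring

/-- The creation operator `a*(f)`, on the domain of all `ψ` in Fock space for which
`a*(f) ψ` lies in Fock space. -/
def create (f : Photon → ℂ) : Fock →ₗ.[ℂ] Fock := (createGraph f).toLinearPMap

lemma create_graph (f : Photon → ℂ) : (create f).graph = createGraph f := by
  refine Submodule.toLinearPMap_graph_eq _ ?_
  rintro ⟨ψ, χ⟩ ⟨h0, h⟩ hψ
  obtain rfl : ψ = 0 := hψ
  ext1
  funext n
  cases n with
  | zero => exact h0
  | succ n =>
    refine Subtype.ext (Lp.ext ((h n).trans ?_))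
    refine (createFun_congr f (Lp.coeFn_zero ℂ 2 (confMeasure n))).trans
      (EventuallyEq.trans ?_ (Lp.coeFn_zero ℂ 2 (confMeasure (n + 1))).symm)
    refine Eventually.of_forall fun x => ?_
    simp [createFun]

/-- The annihilation operator `a(f)`, the adjoint of `a*(f)`. -/
def annihilate (f : Photon → ℂ) : Fock →ₗ.[ℂ] Fock := (create f).adjoint

/-- The field operator `φ(f)`, the closure of `(a(f) + a*(f)) / √2`. -/
def field (f : Photon → ℂ) : Fock →ₗ.[ℂ] Fock :=
  (((1 / Real.sqrt 2 : ℝ) : ℂ) • (annihilate f + create f)).closure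

/-- The graph of multiplication by `w(x₁) + ⋯ + w(xₙ)` on the `n`-photon spaces. -/
def dGammaGraph (w : Photon → ℝ) : Submodule ℂ (Fock × Fock) where
  carrier := {p | ∀ n, ((p.2 n : Lp ℂ 2 (confMeasure n)) : (Fin n → Photon) → ℂ)
      =ᵐ[confMeasure n]
        fun x => ((∑ i, w (x i) : ℝ) : ℂ) * (p.1 n : Lp ℂ 2 (confMeasure n)) x}
  zero_mem' := by
    intro n
    have h0 := Lp.coeFn_zero ℂ 2 (confMeasure n)
    refine h0.trans ?_
    filter_upwards [h0] with x hx
    refine (mul_eq_zero_of_right _ ?_).symm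
    exact hx
  add_mem' := by
    intro a b ha hb n
    refine (Lp.coeFn_add (a.2 n : Lp ℂ 2 (confMeasure n)) (b.2 n)).trans ?_
    filter_upwards [ha n, hb n, Lp.coeFn_add (a.1 n : Lp ℂ 2 (confMeasure n)) (b.1 n)]
      with x h1 h2 h3
    rw [Pi.add_apply, h1, h2, ← mul_add]
    exact congrArg _ h3.symm
  smul_mem' := by
    intro c a ha n
    refine (Lp.coeFn_smul c (a.2 n : Lp ℂ 2 (confMeasure n))).trans ?_
    filter_upwards [ha n, Lp.coeFn_smul c (a.1 n : Lp ℂ 2 (confMeasure n))] with x h1 h3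
    rw [Pi.smul_apply, h1, smul_eq_mul, mul_left_comm]
    exact congrArg _ h3.symm

/-- The second quantization `dΓ(w)` of the self-adjoint operator of multiplication by the real
function `w`: on `n`-photon functions it multiplies by `w(x₁) + ⋯ + w(xₙ)`, and its domain
consists of all `ψ` in Fock space for which the result lies in Fock space. -/
def dGamma (w : Photon → ℝ) : Fock →ₗ.[ℂ] Fock := (dGammaGraph w).toLinearPMap

lemma dGamma_graph (w : Photon → ℝ) : (dGamma w).graph = dGammaGraph w := by
  refine Submodule.toLinearPMap_graph_eq _ ?_
  rintro ⟨ψ, χ⟩ h hψ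
  obtain rfl : ψ = 0 := hψ
  ext1
  funext n
  refine Subtype.ext (Lp.ext ((h n).trans ?_))
  have h0 := Lp.coeFn_zero ℂ 2 (confMeasure n)
  refine EventuallyEq.trans ?_ h0.symm
  filter_upwards [h0] with x hx
  exact mul_eq_zero_of_right _ hx

/-! ### Operations on partially defined operators -/

section Operators

variable {V : Type*} [NormedAddCommGroup V] [InnerProductSpace ℂ V]

/-- Multiplication by a scalar, as an everywhere defined operator. -/
def scalar (c : ℂ) : V →ₗ.[ℂ] V := (c • (LinearMap.id : V →ₗ[ℂ] V)).toPMap ⊤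

/-- The composition `S T` on its natural domain `{x ∈ D(T) | T x ∈ D(S)}`. -/
def comp (S T : V →ₗ.[ℂ] V) : V →ₗ.[ℂ] V :=
  S.comp (T.domRestrict ((S.domain.comap T.toFun).map T.domain.subtype)) <| by
    rintro ⟨x, ⟨y, hy, rfl⟩, hx⟩
    exact hy

/-- The operator `M ⊗ T` on `ℂᵈ ⊗ V`, with domain `ℂᵈ ⊗ D(T)`. -/
def tensor {d : ℕ} (M : Matrix (Fin d) (Fin d) ℂ) (T : V →ₗ.[ℂ] V) :
    PiLp 2 (fun _ : Fin d => V) →ₗ.[ℂ] PiLp 2 (fun _ : Fin d => V) where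
  domain :=
    { carrier := {ψ | ∀ i, ψ i ∈ T.domain}
      zero_mem' := fun _ => T.domain.zero_mem
      add_mem' := fun ha hb i => T.domain.add_mem (ha i) (hb i)
      smul_mem' := fun c _ ha i => T.domain.smul_mem c (ha i) }
  toFun :=
    { toFun := fun ψ => WithLp.toLp 2 fun i => ∑ j, M i j • T ⟨ψ.1 j, ψ.2 j⟩
      map_add' := by
        intro a b
        ext1 i
        simp only [PiLp.add_apply, ← Finset.sum_add_distrib, ← smul_add, ← LinearPMap.map_add]
        rfl
      map_smul' := by
        intro c a
        ext1 i
        simp only [PiLp.smul_apply, RingHom.id_apply, Finset.smul_sum, smul_comm c,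
          ← LinearPMap.map_smul]
        rfl }

/-- The resolvent set: `T - z` is a bijection from `D(T)` onto the space with bounded inverse. -/
def resolventSet (T : V →ₗ.[ℂ] V) : Set ℂ :=
  {z | ∃ R : V →L[ℂ] V,
    (∀ x, ∃ h : R x ∈ T.domain, T ⟨R x, h⟩ - z • R x = x) ∧
    ∀ x : T.domain, R (T x - z • (x : V)) = x}

/-- The spectrum of a partially defined operator. -/
def spectrum (T : V →ₗ.[ℂ] V) : Set ℂ := (resolventSet T)ᶜ

end Operators

/-! ### The fiber Hamiltonians -/

/-- The two admissible values of the spin. -/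
inductive Spin : Type
  | zero
  | half

/-- The number `2 s + 1` of spin components. -/
def Spin.dim : Spin → ℕ
  | .zero => 1
  | .half => 2

/-- The vector `S`: zero for spin `0`, the Pauli matrices for spin `1/2`. -/
def Spin.matrices : (s : Spin) → Fin 3 → Matrix (Fin s.dim) (Fin s.dim) ℂ
  | .zero => fun _ => 0
  | .half => ![!![0, 1; 1, 0], !![0, -Complex.I; Complex.I, 0], !![1, 0; 0, -1]]

/-- The reduced Hilbert space `ℂ^(2s+1) ⊗ ℱ`. -/
abbrev Reduced (s : Spin) : Type := PiLp 2 fun _ : Fin s.dim => Fock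

/-- Polarization vectors: measurable, depending only on `k / |k|`, and such that
`(k / |k|, ε₁(k), ε₂(k))` is an orthonormal basis for almost every `k`. -/
structure IsPolarization (ε : Fin 2 → E3 → E3) : Prop where
  measurable : ∀ l, Measurable (ε l)
  direction : ∀ l k, k ≠ 0 → ε l k = ε l (‖k‖⁻¹ • k)
  orthonormal : ∀ᵐ k : E3, Orthonormal ℝ ![‖k‖⁻¹ • k, ε 0 k, ε 1 k]

/-- The form factor `(2π)^(-3/2) 1_{[0,Λ]}(|k|)`. -/
def rho (Λ : ℝ) (k : E3) : ℝ :=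
  (2 * Real.pi) ^ (-(3 / 2) : ℝ) * (Set.Icc 0 Λ).indicator (fun _ => (1 : ℝ)) ‖k‖

/-- The vector `ρ(k) |k|^(-1/2) ε_λ(k)`. -/
def fAVec (ε : Fin 2 → E3 → E3) (Λ : ℝ) (x : Photon) : Fin 3 → ℝ :=
  fun j => rho Λ x.2 / Real.sqrt ‖x.2‖ * ε x.1 x.2 j

/-- The coupling function `f_{A,j}` of the vector potential. -/
def fA (ε : Fin 2 → E3 → E3) (Λ : ℝ) (j : Fin 3) (x : Photon) : ℂ :=
  (fAVec ε Λ x j : ℂ)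

/-- The coupling function `f_{B,j} = -i [k ∧ f_A]_j` of the magnetic field. -/
def fB (ε : Fin 2 → E3 → E3) (Λ : ℝ) (j : Fin 3) (x : Photon) : ℂ :=
  -Complex.I * ((crossProduct (fun i => x.2 i) (fAVec ε Λ x) j : ℝ) : ℂ)

/-- The dispersion relation `ω_m(k) = √(m² + k²)`. -/
def omega (m : ℝ) (x : Photon) : ℝ := Real.sqrt (m ^ 2 + ‖x.2‖ ^ 2)

/-- The field energy `H_{f,m} = dΓ(ω_m)`. -/
def fieldEnergy (m : ℝ) : Fock →ₗ.[ℂ] Fock := dGamma (omega m)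

/-- The component `j` of the field momentum, `dΓ(k_j)`. -/
def fieldMomentum (j : Fin 3) : Fock →ₗ.[ℂ] Fock := dGamma fun x => x.2 j

/-- The operator `(ξ - P_f + e A)_j` on Fock space. -/
def velocity (ε : Fin 2 → E3 → E3) (Λ e : ℝ) (ξ : E3) (j : Fin 3) : Fock →ₗ.[ℂ] Fock :=
  scalar (ξ j : ℂ) - fieldMomentum j + (e : ℂ) • field (fA ε Λ j)

/-- The operator `½ (ξ - P_f + e A)² + e S · B + H_{f,m}`, on its natural domain. -/
def hamiltonianMax (s : Spin) (ε : Fin 2 → E3 → E3) (Λ e m : ℝ) (ξ : E3) :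
    Reduced s →ₗ.[ℂ] Reduced s :=
  tensor 1 (((1 / 2 : ℝ) : ℂ) • ∑ j, comp (velocity ε Λ e ξ j) (velocity ε Λ e ξ j)) +
    (e : ℂ) • ∑ j, tensor (s.matrices j) (field (fB ε Λ j)) +
    tensor 1 (fieldEnergy m)

/-- The operator `P_f² + H_{f,m}` on its natural domain. -/
def freeOperator (s : Spin) (m : ℝ) : Reduced s →ₗ.[ℂ] Reduced s :=
  tensor 1 (∑ j, comp (fieldMomentum j) (fieldMomentum j) + fieldEnergy m)

/-- The fiber Hamiltonian `H_m(ξ) = ½ (ξ - P_f + e A)² + e S · B + H_{f,m}` on the natural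
domain of `P_f² + H_{f,m}`. -/
def hamiltonian (s : Spin) (ε : Fin 2 → E3 → E3) (Λ e m : ℝ) (ξ : E3) :
    Reduced s →ₗ.[ℂ] Reduced s :=
  (hamiltonianMax s ε Λ e m ξ).domRestrict (freeOperator s m).domain

/-- The ground state energy `E_m(ξ) = inf σ(H_m(ξ))`. -/
def groundEnergy (s : Spin) (ε : Fin 2 → E3 → E3) (Λ e m : ℝ) (ξ : E3) : ℝ :=
  sInf {r : ℝ | (r : ℂ) ∈ spectrum (hamiltonian s ε Λ e m ξ)}

/-! ### Second partial derivatives -/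

/-- The second partial derivative `∂_l² f` exists at `ξ` and equals `c`.
The first partial derivative `∂_l f` has to exist at `ξ` and at almost every point near `ξ` of the
line through `ξ` in direction `l`; as a function on the points of the line where it exists it has
to have derivative `c` at `ξ`. -/
def HasSecondPartialAt (f : E3 → ℝ) (l : Fin 3) (ξ : E3) (c : ℝ) : Prop :=
  let u : E3 := EuclideanSpace.single l 1
  let S : Set ℝ := {t | LineDifferentiableAt ℝ f (ξ + t • u) u}
  (0 : ℝ) ∈ S ∧ (∀ᶠ t in 𝓝 (0 : ℝ) ⊓ ae volume, t ∈ S) ∧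
    HasDerivWithinAt (fun t => lineDeriv ℝ f (ξ + t • u) u) c S 0

end

end PauliFierz

/-! On a unit vector of a suitable core, the quadratic form of the fiber Hamiltonian is ‖ξ‖²/2 plus
an affine function of ξ, and the photon mass enters only the constant term (`form_pauliSystem`).
Hence, once the ground state energy is known to be the infimum of these forms, E_m(ξ) = ‖ξ‖²/2 -
g_m(ξ) with g_m convex. The constant terms lie above their massless values and converge to them, so
g_{m_j} → g_0 pointwise (`exists_groundEnergy_eq_iInf`, `tendsto_iInf_of_le`).

The rest is convex analysis. A finite convex function is differentiable almost everywhere, and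
derivatives of pointwise convergent convex functions converge wherever all of them exist
(`tendsto_of_convexOn_of_hasDerivAt`). On a line the right derivative is monotone, hence
differentiable almost everywhere, and the integral of its derivative is at most its increment, which
the values of the function control. Fatou's lemma then makes the lower limit of the second
derivatives finite almost everywhere on the line (`ae_liminf_deriv_rightD_lt_top`), and Fubini
carries this over to space (`ae_exists_hasDerivAt_rightD`).

The operator-theoretic half is the identity between the bottom of the spectrum and the infimum of
the form on the core, for couplings e of any size and including mass zero
(`groundEnergy_eq_sInf_formRange`). Creation and annihilation operators, and their commutators with
the momenta and the field energy, are bounded by the square root of 1 plus the field energy, because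
∫ |f|² (1 + 1/|k|) is finite (`norm_createOp_sq_le`, `norm_annihOp_sq_le`). `FieldSystem` isolates
these facts. They give an a priori bound of the free operator by the interacting one
(`FieldSystem.apriori`), uniform when the interaction is scaled by t in [0,1], and the method of
continuity then makes the interacting operator plus a large constant invertible on the free domain
(`FieldSystem.isUnit_relExt_H`). That domain is the range of the extended inverse of the free
operator on the core (`ext_id_mem_freeOperator`, `exists_ext_id_eq`), so the core determines the
whole operator. -/

namespace PauliFierz

noncomputable section

/-! ### Graphs of partially defined operators -/

section Graphs

variable {V : Type*} [NormedAddCommGroup V] [InnerProductSpace ℂ V]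

/-- Graph membership carries the domain statement and the value together, and it passes to limits
when the graph is closed. Sums and products of unbounded operators are therefore assembled from
graphs. -/
lemma mem_graph_of_eq {T : V →ₗ.[ℂ] V} {x : V} (h : x ∈ T.domain) {y : V} (hy : T ⟨x, h⟩ = y) :
    (x, y) ∈ T.graph :=
  (LinearPMap.mem_graph_iff T).2 ⟨⟨x, h⟩, rfl, hy⟩

lemma exists_of_mem_graph {T : V →ₗ.[ℂ] V} {x y : V} (h : (x, y) ∈ T.graph) :
    ∃ hx : x ∈ T.domain, T ⟨x, hx⟩ = y := by
  obtain ⟨⟨x', hx'⟩, h1, h2⟩ := (LinearPMap.mem_graph_iff T).1 h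
  obtain rfl : x' = x := h1
  exact ⟨hx', h2⟩

lemma mem_graph_add {S T : V →ₗ.[ℂ] V} {x y z : V} (hS : (x, y) ∈ S.graph) (hT : (x, z) ∈ T.graph) :
    (x, y + z) ∈ (S + T).graph := by
  obtain ⟨hx, rfl⟩ := exists_of_mem_graph hS
  obtain ⟨hx', rfl⟩ := exists_of_mem_graph hT
  exact mem_graph_of_eq (T := S + T) ⟨hx, hx'⟩ rfl

lemma mem_graph_sub {S T : V →ₗ.[ℂ] V} {x y z : V} (hS : (x, y) ∈ S.graph) (hT : (x, z) ∈ T.graph) :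
    (x, y - z) ∈ (S - T).graph := by
  obtain ⟨hx, rfl⟩ := exists_of_mem_graph hS
  obtain ⟨hx', rfl⟩ := exists_of_mem_graph hT
  exact mem_graph_of_eq (T := S - T) ⟨hx, hx'⟩ rfl

lemma mem_graph_smul {S : V →ₗ.[ℂ] V} {x y : V} (c : ℂ) (hS : (x, y) ∈ S.graph) :
    (x, c • y) ∈ (c • S).graph := by
  obtain ⟨hx, rfl⟩ := exists_of_mem_graph hS
  exact mem_graph_of_eq (T := c • S) hx rfl

lemma mem_graph_scalar (c : ℂ) (x : V) : (x, c • x) ∈ (scalar c : V →ₗ.[ℂ] V).graph :=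
  mem_graph_of_eq (T := scalar c) trivial rfl

lemma mem_graph_sum {ι : Type*} (s : Finset ι) {T : ι → V →ₗ.[ℂ] V} {x : V} {y : ι → V}
    (h : ∀ i, (x, y i) ∈ (T i).graph) : (x, ∑ i ∈ s, y i) ∈ (∑ i ∈ s, T i).graph := by
  classical
  induction s using Finset.induction_on with
  | empty => simp only [Finset.sum_empty]; exact mem_graph_of_eq (T := 0) trivial rfl
  | insert i s hi ih =>
    rw [Finset.sum_insert hi, Finset.sum_insert hi]
    exact mem_graph_add (h i) ih

lemma mem_graph_comp {S T : V →ₗ.[ℂ] V} {x y z : V} (hT : (x, y) ∈ T.graph)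
    (hS : (y, z) ∈ S.graph) : (x, z) ∈ (comp S T).graph := by
  obtain ⟨hx, rfl⟩ := exists_of_mem_graph hT
  obtain ⟨hy, rfl⟩ := exists_of_mem_graph hS
  have hd : x ∈ (comp S T).domain := ⟨⟨⟨x, hx⟩, hy, rfl⟩, hx⟩
  exact mem_graph_of_eq (T := comp S T) hd rfl

lemma mem_graph_domRestrict {T : V →ₗ.[ℂ] V} {D : Submodule ℂ V} {x y : V} (hx : x ∈ D)
    (h : (x, y) ∈ T.graph) : (x, y) ∈ (T.domRestrict D).graph := by
  obtain ⟨hx', rfl⟩ := exists_of_mem_graph h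
  exact mem_graph_of_eq (T := T.domRestrict D) ⟨hx, hx'⟩ rfl

lemma mem_graph_tensor {d : ℕ} (M : Matrix (Fin d) (Fin d) ℂ) {T : V →ₗ.[ℂ] V}
    {x : PiLp 2 fun _ : Fin d => V} {y : Fin d → V} (h : ∀ i, (x i, y i) ∈ T.graph) :
    (x, WithLp.toLp 2 fun i => ∑ j, M i j • y j) ∈ (tensor M T).graph := by
  have hx : ∀ i, x i ∈ T.domain := fun i => LinearPMap.mem_domain_of_mem_graph (h i)
  refine mem_graph_of_eq (T := tensor M T) hx ?_
  change WithLp.toLp 2 (fun i => ∑ j, M i j • T ⟨x j, hx j⟩) = _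
  congr 1
  funext i
  refine Finset.sum_congr rfl fun j _ => ?_
  obtain ⟨hx', h2⟩ := exists_of_mem_graph (h j)
  rw [← h2]

lemma mem_graph_tensor_one {d : ℕ} {T : V →ₗ.[ℂ] V}
    {x : PiLp 2 fun _ : Fin d => V} {y : PiLp 2 fun _ : Fin d => V}
    (h : ∀ i, (x i, y i) ∈ T.graph) : (x, y) ∈ (tensor 1 T).graph := by
  have h1 := mem_graph_tensor 1 h
  have h2 : WithLp.toLp 2 (fun i => ∑ j, (1 : Matrix (Fin d) (Fin d) ℂ) i j • y j) = y := by
    ext1 i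
    simp [Matrix.one_apply]
  rwa [h2] at h1

lemma exists_of_mem_domain_comp {S T : V →ₗ.[ℂ] V} {x : V} (h : x ∈ (comp S T).domain) :
    ∃ y z, (x, y) ∈ T.graph ∧ (y, z) ∈ S.graph := by
  obtain ⟨⟨⟨x', hx'⟩, hy, h1⟩, h2⟩ := h
  obtain rfl : x' = x := h1
  exact ⟨_, _, LinearPMap.mem_graph T ⟨x', hx'⟩, LinearPMap.mem_graph S ⟨_, hy⟩⟩

end Graphs

/-! ### A priori estimates on an abstract core -/

section AbstractCore

variable {V : Type*} [AddCommGroup V] [Module ℂ V]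
  {𝓗 : Type*} [NormedAddCommGroup 𝓗] [InnerProductSpace ℂ 𝓗]

/-- The real part of the inner product, pulled back along `J`. -/
def reInner (J : V →ₗ[ℂ] 𝓗) (x y : V) : ℝ := (inner ℂ (J x) (J y)).re

lemma le_of_sq_le {a b : ℝ} (h : a ^ 2 ≤ b ^ 2) (hb : 0 ≤ b) : a ≤ b :=
  (le_abs_self a).trans (abs_le_of_sq_le_sq h hb)

section reInner

variable (J : V →ₗ[ℂ] 𝓗) (x y z : V)

lemma reInner_add_left : reInner J (x + y) z = reInner J x z + reInner J y z := by
  simp [reInner, inner_add_left]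

lemma reInner_add_right : reInner J x (y + z) = reInner J x y + reInner J x z := by
  simp [reInner, inner_add_right]

lemma reInner_sub_right : reInner J x (y - z) = reInner J x y - reInner J x z := by
  simp [reInner, inner_sub_right]

lemma reInner_smul_left (r : ℝ) : reInner J ((r : ℂ) • x) y = r * reInner J x y := by
  simp [reInner, inner_smul_left]

lemma reInner_smul_right (r : ℝ) : reInner J x ((r : ℂ) • y) = r * reInner J x y := by
  simp [reInner, inner_smul_right]

lemma reInner_sum_left {ι : Type*} (s : Finset ι) (f : ι → V) :
    reInner J (∑ i ∈ s, f i) y = ∑ i ∈ s, reInner J (f i) y := by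
  simp [reInner, sum_inner, map_sum]

lemma reInner_sum_right {ι : Type*} (s : Finset ι) (f : ι → V) :
    reInner J x (∑ i ∈ s, f i) = ∑ i ∈ s, reInner J x (f i) := by
  simp [reInner, inner_sum, map_sum]

lemma reInner_comm : reInner J x y = reInner J y x := by
  unfold reInner; rw [← inner_conj_symm, Complex.conj_re]

lemma reInner_self : reInner J x x = ‖J x‖ ^ 2 := by
  simpa [reInner] using inner_self_eq_norm_sq (𝕜 := ℂ) (J x)

lemma abs_reInner_le : |reInner J x y| ≤ ‖J x‖ * ‖J y‖ :=
  (Complex.abs_re_le_norm _).trans (norm_inner_le_norm _ _)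

lemma reInner_le : reInner J x y ≤ ‖J x‖ * ‖J y‖ :=
  (le_abs_self _).trans (abs_reInner_le J x y)

lemma reInner_le_half : reInner J x y ≤ (‖J x‖ ^ 2 + ‖J y‖ ^ 2) / 2 := by
  nlinarith [reInner_le J x y, sq_nonneg (‖J x‖ - ‖J y‖)]

lemma norm_sq_combination (r c : ℝ) :
    ‖J ((r : ℂ) • x + y + (c : ℂ) • z)‖ ^ 2 = r ^ 2 * ‖J x‖ ^ 2 + ‖J y‖ ^ 2 + c ^ 2 * ‖J z‖ ^ 2 +
      2 * r * reInner J y x + 2 * r * c * reInner J z x + 2 * c * reInner J z y := by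
  rw [← reInner_self J ((r : ℂ) • x + y + (c : ℂ) • z), ← reInner_self J x, ← reInner_self J y,
    ← reInner_self J z]
  simp only [reInner_add_left, reInner_add_right, reInner_smul_left, reInner_smul_right]
  rw [reInner_comm J x y, reInner_comm J x z, reInner_comm J y z]
  ring

end reInner

/-- A positive operator `Om` (field energy), commuting operators `p`, and interaction operators
`A`, `W` on a common core, the interactions and their commutators with `Om` and `p` being bounded
by the square root of `1 + Om`. -/
structure FieldSystem (J : V →ₗ[ℂ] 𝓗) where
  Om : V →ₗ[ℂ] V
  p : Fin 3 → V →ₗ[ℂ] V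
  A : Fin 3 → V →ₗ[ℂ] V
  W : V →ₗ[ℂ] V
  C : ℝ
  one_le : 1 ≤ C
  symm_Om : ∀ x y, inner ℂ (J (Om x)) (J y) = inner ℂ (J x) (J (Om y))
  symm_p : ∀ j x y, inner ℂ (J (p j x)) (J y) = inner ℂ (J x) (J (p j y))
  symm_A : ∀ j x y, inner ℂ (J (A j x)) (J y) = inner ℂ (J x) (J (A j y))
  symm_W : ∀ x y, inner ℂ (J (W x)) (J y) = inner ℂ (J x) (J (W y))
  Om_nonneg : ∀ x, 0 ≤ reInner J x (Om x)
  p_p : ∀ i j x, p i (p j x) = p j (p i x)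
  p_Om : ∀ j x, p j (Om x) = Om (p j x)
  A_le : ∀ j x, ‖J (A j x)‖ ^ 2 ≤ C * (‖J x‖ ^ 2 + reInner J x (Om x))
  W_le : ∀ x, ‖J (W x)‖ ^ 2 ≤ C * (‖J x‖ ^ 2 + reInner J x (Om x))
  Om_A_le : ∀ j x, ‖J (Om (A j x) - A j (Om x))‖ ^ 2 ≤ C * (‖J x‖ ^ 2 + reInner J x (Om x))
  p_A_le : ∀ j x, ‖J (p j (A j x) - A j (p j x))‖ ^ 2 ≤ C * (‖J x‖ ^ 2 + reInner J x (Om x))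

namespace FieldSystem

variable {J : V →ₗ[ℂ] 𝓗} (S : FieldSystem J)

/-- `p² = ∑ⱼ pⱼ²`. -/
def psq : V →ₗ[ℂ] V := ∑ j, S.p j ∘ₗ S.p j

/-- The velocity `p + A`. -/
def v (j : Fin 3) : V →ₗ[ℂ] V := S.p j + S.A j

/-- `v² = ∑ⱼ vⱼ²`. -/
def vsq : V →ₗ[ℂ] V := ∑ j, S.v j ∘ₗ S.v j

/-- The free operator `p² / 2 + Om + c`. -/
def G (c : ℝ) : V →ₗ[ℂ] V := ((1 / 2 : ℝ) : ℂ) • S.psq + S.Om + (c : ℂ) • LinearMap.id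

/-- The interacting operator `v² / 2 + W + Om`. -/
def H : V →ₗ[ℂ] V := ((1 / 2 : ℝ) : ℂ) • S.vsq + S.W + S.Om

/-- The system with the interaction multiplied by `t`. -/
def scale (t : ℝ) (h0 : 0 ≤ t) (h1 : t ≤ 1) : FieldSystem J :=
  have key : ∀ x z, ‖J z‖ ^ 2 ≤ S.C * (‖J x‖ ^ 2 + reInner J x (S.Om x)) →
      ‖J ((t : ℂ) • z)‖ ^ 2 ≤ S.C * (‖J x‖ ^ 2 + reInner J x (S.Om x)) := by
    intro x z h
    rw [map_smul, norm_smul, Complex.norm_real, Real.norm_of_nonneg h0, mul_pow]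
    exact (mul_le_of_le_one_left (sq_nonneg _) (pow_le_one₀ h0 h1)).trans h
  -- The constant `C` is kept: it dominates every scaled interaction, so all later estimates are
  -- uniform in `t`.
  { S with
    A := fun j => (t : ℂ) • S.A j
    W := (t : ℂ) • S.W
    symm_A := fun j x y => by simp [inner_smul_left, inner_smul_right, S.symm_A]
    symm_W := fun x y => by simp [inner_smul_left, inner_smul_right, S.symm_W]
    A_le := fun j x => key _ _ (S.A_le j x)
    W_le := fun x => key _ _ (S.W_le x)
    Om_A_le := fun j x => by simpa [smul_sub] using key _ _ (S.Om_A_le j x)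
    p_A_le := fun j x => by simpa [smul_sub] using key _ _ (S.p_A_le j x) }

lemma re_symm_p (j : Fin 3) (x y : V) : reInner J (S.p j x) y = reInner J x (S.p j y) := by
  simp only [reInner, S.symm_p]

lemma re_symm_A (j : Fin 3) (x y : V) : reInner J (S.A j x) y = reInner J x (S.A j y) := by
  simp only [reInner, S.symm_A]

lemma symm_v (j : Fin 3) (x y : V) :
    inner ℂ (J (S.v j x)) (J y) = inner ℂ (J x) (J (S.v j y)) := by
  simp [v, inner_add_left, inner_add_right, S.symm_p, S.symm_A]

lemma re_symm_v (j : Fin 3) (x y : V) : reInner J (S.v j x) y = reInner J x (S.v j y) := by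
  simp only [reInner, S.symm_v]

lemma symm_H (x y : V) : inner ℂ (J (S.H x)) (J y) = inner ℂ (J x) (J (S.H y)) := by
  simp [H, vsq, inner_add_left, inner_add_right, inner_smul_left, inner_smul_right, sum_inner,
    inner_sum, S.symm_v, S.symm_W, S.symm_Om, mul_comm]

lemma reInner_Om_le (x : V) : reInner J x (S.Om x) ≤ ‖J x‖ * ‖J (S.Om x)‖ := reInner_le J _ _

/-- Move one `A` across: ⟨A x, Om A x⟩ = ⟨A A x, Om x⟩ + ⟨A x, [Om, A] x⟩. By `A_le`, ‖A A x‖² is at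
most `C` times the quantity being estimated, so Young's inequality lets half of that quantity be
absorbed on the left. -/
lemma energy_A_le (j : Fin 3) (x : V) :
    ‖J (S.A j x)‖ ^ 2 + reInner J (S.A j x) (S.Om (S.A j x)) ≤
      5 * S.C * (‖J x‖ + ‖J (S.Om x)‖) ^ 2 := by
  have hC := S.one_le
  have h1 := S.A_le j x
  have h2 := S.A_le j (S.A j x)
  have h3 := S.Om_A_le j x
  set D := S.Om (S.A j x) - S.A j (S.Om x) with hD
  have h4 : reInner J (S.A j x) (S.Om (S.A j x)) =
      reInner J (S.A j (S.A j x)) (S.Om x) + reInner J (S.A j x) D := by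
    rw [S.re_symm_A j (S.A j x), hD, reInner_sub_right]; ring
  have h5 := reInner_le J (S.A j (S.A j x)) (S.Om x)
  have h6 := reInner_le_half J (S.A j x) D
  have h7 := S.reInner_Om_le x
  set s := ‖J (S.A j x)‖ ^ 2 + reInner J (S.A j x) (S.Om (S.A j x)) with hs
  set a := ‖J (S.A j (S.A j x))‖
  set o := ‖J (S.Om x)‖
  set n := ‖J x‖
  have ho : 0 ≤ o := norm_nonneg _
  have hn : 0 ≤ n := norm_nonneg _
  have h8 : a * o ≤ s / 2 + S.C * o ^ 2 / 2 := by
    have : 2 * S.C * (a * o) ≤ S.C * s + S.C ^ 2 * o ^ 2 := by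
      nlinarith [sq_nonneg (a - S.C * o)]
    have hC0 : 0 < S.C := by linarith
    have h9 : S.C * (a * o) ≤ S.C * (s / 2 + S.C * o ^ 2 / 2) := by nlinarith
    exact le_of_mul_le_mul_left h9 hC0
  have h10 : s ≤ 4 * (S.C * (n ^ 2 + reInner J x (S.Om x))) + S.C * o ^ 2 := by linarith
  have h11 : S.C * (n ^ 2 + reInner J x (S.Om x)) ≤ S.C * (n ^ 2 + n * o) := by gcongr
  nlinarith [mul_nonneg hn ho, mul_nonneg (by linarith : (0:ℝ) ≤ S.C) (mul_nonneg hn ho),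
    mul_nonneg (by linarith : (0:ℝ) ≤ S.C) (sq_nonneg n),
    mul_nonneg (by linarith : (0:ℝ) ≤ S.C) (sq_nonneg o)]

/-- The `p i` are symmetric and commute, so ‖p² x‖² is exactly the sum of all ‖p_i p_j x‖². -/
lemma norm_p_p_le (i j : Fin 3) (x : V) : ‖J (S.p i (S.p j x))‖ ≤ ‖J (S.psq x)‖ := by
  refine le_of_sq_le ?_ (norm_nonneg _)
  have h : ‖J (S.psq x)‖ ^ 2 = ∑ i, ∑ j, ‖J (S.p i (S.p j x))‖ ^ 2 := by
    rw [← reInner_self]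
    simp only [psq, LinearMap.sum_apply, LinearMap.comp_apply, reInner_sum_left, reInner_sum_right]
    refine Finset.sum_congr rfl fun i _ => Finset.sum_congr rfl fun j _ => ?_
    rw [← reInner_self, S.re_symm_p j (S.p j x), S.re_symm_p i (S.p j x), S.p_p j i (S.p i x),
      S.p_p j i x]
  rw [h]
  refine le_trans ?_ (Finset.single_le_sum (f := fun i => ∑ j, ‖J (S.p i (S.p j x))‖ ^ 2)
    (fun i _ => Finset.sum_nonneg fun j _ => sq_nonneg _) (Finset.mem_univ i))
  exact Finset.single_le_sum (f := fun j => ‖J (S.p i (S.p j x))‖ ^ 2)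
    (fun j _ => sq_nonneg _) (Finset.mem_univ j)

lemma G_apply (c : ℝ) (x : V) :
    S.G c x = ((1 / 2 : ℝ) : ℂ) • S.psq x + S.Om x + (c : ℂ) • x := rfl

lemma H_apply (x : V) : S.H x = ((1 / 2 : ℝ) : ℂ) • S.vsq x + S.W x + S.Om x := rfl

lemma v_apply (j : Fin 3) (x : V) : S.v j x = S.p j x + S.A j x := rfl

lemma psq_apply (x : V) : S.psq x = ∑ j, S.p j (S.p j x) := by simp [psq]

lemma vsq_apply (x : V) : S.vsq x = ∑ j, S.v j (S.v j x) := by simp [vsq]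

/-- Lower bound for the free operator. -/
lemma norm_sq_le_G {c : ℝ} (hc : 0 ≤ c) (x : V) :
    ‖J (S.psq x)‖ ^ 2 / 4 + ‖J (S.Om x)‖ ^ 2 + c ^ 2 * ‖J x‖ ^ 2 ≤ ‖J (S.G c x)‖ ^ 2 := by
  have h1 : 0 ≤ reInner J x (S.psq x) := by
    rw [psq_apply, reInner_sum_right]
    refine Finset.sum_nonneg fun j _ => ?_
    rw [← S.re_symm_p, reInner_self]; positivity
  -- The mixed term is nonnegative because `p j` commutes with `Om`: it equals ∑ ⟨p_j x, Om p_j x⟩.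
  -- All cross terms in the expanded square can thus be dropped.
  have h2 : 0 ≤ reInner J (S.Om x) (S.psq x) := by
    rw [psq_apply, reInner_sum_right]
    refine Finset.sum_nonneg fun j _ => ?_
    rw [← S.re_symm_p, S.p_Om, reInner_comm]
    exact S.Om_nonneg _
  have h3 := S.Om_nonneg x
  rw [G_apply, norm_sq_combination]
  nlinarith [mul_nonneg hc h1, mul_nonneg hc h3]

/-- The a priori estimate without `W`. -/
lemma apriori_aux {c : ℝ} (hc : 8 * S.C ≤ c) (x : V) :
    ‖J (S.vsq x)‖ ^ 2 / 4 + ‖J (S.Om x)‖ ^ 2 + ∑ j, reInner J (S.v j x) (S.Om (S.v j x)) +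
      c / 2 * ∑ j, ‖J (S.v j x)‖ ^ 2 + c ^ 2 / 2 * ‖J x‖ ^ 2 + c * reInner J x (S.Om x) ≤
    ‖J (((1 / 2 : ℝ) : ℂ) • S.vsq x + S.Om x + (c : ℂ) • x)‖ ^ 2 := by
  have hC := S.one_le
  have hu := S.Om_nonneg x
  have h1 : reInner J x (S.vsq x) = ∑ j, ‖J (S.v j x)‖ ^ 2 := by
    rw [vsq_apply, reInner_sum_right]
    refine Finset.sum_congr rfl fun j _ => ?_
    rw [← S.re_symm_v, reInner_self]
  -- As `p j` commutes with `Om`, only [Om, A_j] obstructs moving one velocity across. The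
  -- nonnegative terms ⟨v x, Om v x⟩ are kept, since they control A v x later.
  have h2 : ∑ j, reInner J (S.v j x) (S.Om (S.v j x)) - (∑ j, ‖J (S.v j x)‖ ^ 2) / 2
      - 3 / 2 * (S.C * (‖J x‖ ^ 2 + reInner J x (S.Om x))) ≤ reInner J (S.Om x) (S.vsq x) := by
    rw [vsq_apply, reInner_sum_right]
    have key : ∀ j, reInner J (S.v j x) (S.Om (S.v j x)) - ‖J (S.v j x)‖ ^ 2 / 2
        - 1 / 2 * (S.C * (‖J x‖ ^ 2 + reInner J x (S.Om x)))
        ≤ reInner J (S.Om x) (S.v j (S.v j x)) := by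
      intro j
      have h3 : reInner J (S.Om x) (S.v j (S.v j x)) = reInner J (S.v j x) (S.Om (S.v j x)) -
          reInner J (S.v j x) (S.Om (S.A j x) - S.A j (S.Om x)) := by
        rw [← reInner_sub_right, ← S.re_symm_v, reInner_comm]
        congr 1
        rw [v_apply, v_apply, map_add, S.p_Om]; abel
      have h4 := reInner_le_half J (S.v j x) (S.Om (S.A j x) - S.A j (S.Om x))
      have h5 := S.Om_A_le j x
      linarith
    have := key 0; have := key 1; have := key 2
    simp only [Fin.sum_univ_three] at *
    linarith
  rw [norm_sq_combination, h1]
  set V2 := ∑ j, ‖J (S.v j x)‖ ^ 2 with hV2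
  have hV : 0 ≤ V2 := Finset.sum_nonneg fun j _ => sq_nonneg _
  have hc1 : 1 ≤ c := by linarith
  -- In the expanded square, half of each term carrying a factor `c` pays for the commutator errors;
  -- the other half stays in the estimate.
  have e1 : V2 / 2 ≤ c / 2 * V2 := by nlinarith
  have e2 : 3 / 2 * (S.C * ‖J x‖ ^ 2) ≤ c ^ 2 / 2 * ‖J x‖ ^ 2 := by
    rw [← mul_assoc]; gcongr; nlinarith
  have e3 : 3 / 2 * (S.C * reInner J x (S.Om x)) ≤ c * reInner J x (S.Om x) := by
    rw [← mul_assoc]; gcongr; linarith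
  nlinarith

/-- With v = p + A one has p² = (v - A)², rearranged so that `A` always stands to the left of `v`.
Then A v x is bounded by the energy of v x, which `apriori_aux` controls. -/
lemma psq_eq (x : V) : S.psq x = S.vsq x - ∑ j, ((2 : ℝ) : ℂ) • S.A j (S.v j x)
    - ∑ j, (S.p j (S.A j x) - S.A j (S.p j x)) + ∑ j, S.A j (S.A j x) := by
  rw [psq_apply, vsq_apply, ← Finset.sum_sub_distrib, ← Finset.sum_sub_distrib,
    ← Finset.sum_add_distrib]
  refine Finset.sum_congr rfl fun j _ => ?_
  simp only [v_apply, map_add]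
  push_cast
  module

/-- The a priori estimate: the free operator is bounded by the interacting one. -/
lemma apriori {c : ℝ} (hc : 8 * S.C ≤ c) (x : V) :
    ‖J (S.G c x)‖ ≤ 32 * S.C * ‖J (S.H x + (c : ℂ) • x)‖ := by
  have hC := S.one_le
  have hu := S.Om_nonneg x
  have hmain := S.apriori_aux hc x
  set Y := ((1 / 2 : ℝ) : ℂ) • S.vsq x + S.Om x + (c : ℂ) • x with hY
  set y := ‖J Y‖ with hy
  have hy0 : 0 ≤ y := norm_nonneg _
  have hv : ∀ j, ‖J (S.v j x)‖ ^ 2 + reInner J (S.v j x) (S.Om (S.v j x)) ≤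
      c / 2 * ∑ j, ‖J (S.v j x)‖ ^ 2 + ∑ j, reInner J (S.v j x) (S.Om (S.v j x)) := by
    intro j
    have h1 := Finset.single_le_sum (f := fun j => ‖J (S.v j x)‖ ^ 2)
      (fun j _ => sq_nonneg _) (Finset.mem_univ j)
    have h2 := Finset.single_le_sum (f := fun j => reInner J (S.v j x) (S.Om (S.v j x)))
      (fun j _ => S.Om_nonneg _) (Finset.mem_univ j)
    have h3 : 0 ≤ ‖J (S.v j x)‖ ^ 2 := sq_nonneg _
    nlinarith
  have hv0 : 0 ≤ c / 2 * ∑ j, ‖J (S.v j x)‖ ^ 2 + ∑ j, reInner J (S.v j x) (S.Om (S.v j x)) :=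
    (add_nonneg (sq_nonneg _) (S.Om_nonneg _)).trans (hv 0)
  -- The factor 1/4 gives ‖W x‖ ≤ y/2, so restoring `W` in the operator costs only the factor 2 of
  -- `hY2`.
  have hN : S.C * (‖J x‖ ^ 2 + reInner J x (S.Om x)) ≤
      (c ^ 2 / 2 * ‖J x‖ ^ 2 + c * reInner J x (S.Om x)) / 4 := by
    have e2 : S.C * ‖J x‖ ^ 2 ≤ c ^ 2 / 8 * ‖J x‖ ^ 2 := by gcongr; nlinarith
    have e3 : S.C * reInner J x (S.Om x) ≤ c / 4 * reInner J x (S.Om x) := by gcongr; linarith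
    linarith
  have p1 := sq_nonneg ‖J (S.vsq x)‖
  have p2 := sq_nonneg ‖J (S.Om x)‖
  have p3 : 0 ≤ c ^ 2 / 2 * ‖J x‖ ^ 2 := by positivity
  have p4 : 0 ≤ c * reInner J x (S.Om x) := mul_nonneg (by linarith) hu
  have bW : ‖J (S.W x)‖ ≤ y / 2 := le_of_sq_le (by linarith [S.W_le x]) (by positivity)
  have bT : ‖J (S.vsq x)‖ ≤ 2 * y := le_of_sq_le (by linarith) (by positivity)
  have bO : ‖J (S.Om x)‖ ≤ y := le_of_sq_le (by linarith) (by positivity)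
  have bx : c * ‖J x‖ ≤ 2 * y := le_of_sq_le (by nlinarith) (by positivity)
  have bx1 : ‖J x‖ ≤ y := le_of_sq_le (by nlinarith [sq_nonneg ‖J x‖]) (by positivity)
  have bAv : ∀ j, ‖J (S.A j (S.v j x))‖ ≤ S.C * y := by
    intro j
    refine le_of_sq_le ?_ (by positivity)
    have h1 : S.C * (‖J (S.v j x)‖ ^ 2 + reInner J (S.v j x) (S.Om (S.v j x))) ≤ S.C * y ^ 2 := by
      gcongr; linarith [hv j]
    nlinarith [S.A_le j (S.v j x), mul_nonneg (by linarith : (0:ℝ) ≤ S.C) (sq_nonneg y)]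
  have bD : ∀ j, ‖J (S.p j (S.A j x) - S.A j (S.p j x))‖ ≤ y := fun j =>
    le_of_sq_le (by linarith [S.p_A_le j x]) hy0
  have bAA : ∀ j, ‖J (S.A j (S.A j x))‖ ≤ 5 * S.C * y := by
    intro j
    refine le_of_sq_le ?_ (by positivity)
    have h1 : S.C * (‖J (S.A j x)‖ ^ 2 + reInner J (S.A j x) (S.Om (S.A j x))) ≤
        S.C * (5 * S.C * (y + y) ^ 2) := by
      gcongr
      exact (S.energy_A_le j x).trans (by gcongr)
    nlinarith [S.A_le j (S.A j x), sq_nonneg (S.C * y)]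
  -- The constant comes from 2 + 3·2C + 3 + 3·5C ≤ 26C.
  have bp : ‖J (S.psq x)‖ ≤ 26 * S.C * y := by
    rw [psq_eq, map_add, map_sub, map_sub, map_sum, map_sum, map_sum]
    have t1 : ‖∑ j, J (((2 : ℝ) : ℂ) • S.A j (S.v j x))‖ ≤ 3 * (2 * (S.C * y)) := by
      refine (norm_sum_le_of_le _ (n := fun _ => 2 * (S.C * y)) fun j _ => ?_).trans (by simp)
      rw [map_smul, norm_smul, Complex.norm_real, Real.norm_of_nonneg (by norm_num)]
      gcongr
      exact bAv j
    have t2 : ‖∑ j, J (S.p j (S.A j x) - S.A j (S.p j x))‖ ≤ 3 * y :=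
      (norm_sum_le_of_le _ (n := fun _ => y) fun j _ => bD j).trans (by simp)
    have t3 : ‖∑ j, J (S.A j (S.A j x))‖ ≤ 3 * (5 * S.C * y) :=
      (norm_sum_le_of_le _ (n := fun _ => 5 * S.C * y) fun j _ => bAA j).trans (by simp)
    refine (norm_add_le _ _).trans ?_
    have := norm_sub_le (J (S.vsq x) - ∑ j, J (((2 : ℝ) : ℂ) • S.A j (S.v j x)))
      (∑ j, J (S.p j (S.A j x) - S.A j (S.p j x)))
    have := norm_sub_le (J (S.vsq x)) (∑ j, J (((2 : ℝ) : ℂ) • S.A j (S.v j x)))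
    nlinarith
  have hY2 : y ≤ 2 * ‖J (S.H x + (c : ℂ) • x)‖ := by
    have : Y = (S.H x + (c : ℂ) • x) - S.W x := by rw [hY, H_apply]; abel
    have h2 : y ≤ ‖J (S.H x + (c : ℂ) • x)‖ + ‖J (S.W x)‖ := by
      rw [hy, this, map_sub]; exact norm_sub_le _ _
    linarith
  have hG : ‖J (S.G c x)‖ ≤ 1 / 2 * ‖J (S.psq x)‖ + ‖J (S.Om x)‖ + c * ‖J x‖ := by
    have hc0 : 0 ≤ c := by linarith
    rw [G_apply, map_add, map_add, map_smul, map_smul]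
    refine (norm_add_le _ _).trans (add_le_add ((norm_add_le _ _).trans (add_le_add ?_ le_rfl)) ?_)
    · rw [norm_smul, Complex.norm_real, Real.norm_of_nonneg (by norm_num)]
    · rw [norm_smul, Complex.norm_real, Real.norm_of_nonneg hc0]
  -- Here ½·26C + 1 + 2 ≤ 16C, and `hY2` doubles it.
  nlinarith

/-- The energy of `p x` is controlled by the free operator. -/
lemma energy_p_le (j : Fin 3) (x : V) :
    ‖J (S.p j x)‖ ^ 2 + reInner J (S.p j x) (S.Om (S.p j x)) ≤
      ‖J (S.psq x)‖ * (‖J x‖ + ‖J (S.Om x)‖) := by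
  have h1 : ‖J (S.p j x)‖ ^ 2 = reInner J (S.p j (S.p j x)) x := by
    rw [S.re_symm_p, reInner_self]
  have h2 : reInner J (S.p j x) (S.Om (S.p j x)) = reInner J (S.p j (S.p j x)) (S.Om x) := by
    rw [← S.p_Om, S.re_symm_p j (S.p j x)]
  have h3 := S.norm_p_p_le j j x
  rw [h1, h2, mul_add]
  exact add_le_add ((reInner_le J _ _).trans (by gcongr)) ((reInner_le J _ _).trans (by gcongr))

section words

variable {c : ℝ} (hc : 1 ≤ c) (x : V)
include hc

lemma norm_le_G : ‖J x‖ ≤ ‖J (S.G c x)‖ := by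
  refine le_of_sq_le ?_ (norm_nonneg _)
  have h : 1 * ‖J x‖ ^ 2 ≤ c ^ 2 * ‖J x‖ ^ 2 := by gcongr; nlinarith
  linarith [S.norm_sq_le_G (by linarith : 0 ≤ c) x, sq_nonneg ‖J (S.psq x)‖,
    sq_nonneg ‖J (S.Om x)‖]

lemma norm_Om_le_G : ‖J (S.Om x)‖ ≤ ‖J (S.G c x)‖ := by
  refine le_of_sq_le ?_ (norm_nonneg _)
  nlinarith [S.norm_sq_le_G (by linarith : 0 ≤ c) x, sq_nonneg ‖J x‖, sq_nonneg ‖J (S.psq x)‖,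
    sq_nonneg ‖J (S.Om x)‖]

lemma norm_psq_le_G : ‖J (S.psq x)‖ ≤ 2 * ‖J (S.G c x)‖ := by
  refine le_of_sq_le ?_ (by positivity)
  nlinarith [S.norm_sq_le_G (by linarith : 0 ≤ c) x, sq_nonneg ‖J x‖, sq_nonneg ‖J (S.psq x)‖,
    sq_nonneg ‖J (S.Om x)‖]

lemma norm_pp_le_G (j : Fin 3) : ‖J (S.p j (S.p j x))‖ ≤ 2 * ‖J (S.G c x)‖ :=
  (S.norm_p_p_le j j x).trans (S.norm_psq_le_G hc x)

lemma energy_p_le_G (j : Fin 3) :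
    ‖J (S.p j x)‖ ^ 2 + reInner J (S.p j x) (S.Om (S.p j x)) ≤ 4 * ‖J (S.G c x)‖ ^ 2 := by
  refine (S.energy_p_le j x).trans ?_
  have h1 := S.norm_le_G hc x
  have h2 := S.norm_Om_le_G hc x
  have h3 := S.norm_psq_le_G hc x
  calc _ ≤ 2 * ‖J (S.G c x)‖ * (‖J (S.G c x)‖ + ‖J (S.G c x)‖) := by gcongr
    _ = _ := by ring

lemma norm_p_le_G (j : Fin 3) : ‖J (S.p j x)‖ ≤ 2 * ‖J (S.G c x)‖ := by
  refine le_of_sq_le ?_ (by positivity)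
  linarith [S.energy_p_le_G hc x j, S.Om_nonneg (S.p j x)]

lemma energy_le_G : ‖J x‖ ^ 2 + reInner J x (S.Om x) ≤ 2 * ‖J (S.G c x)‖ ^ 2 := by
  have h1 := S.norm_le_G hc x
  have h2 := S.norm_Om_le_G hc x
  have h3 := S.reInner_Om_le x
  have h4 : ‖J x‖ * ‖J (S.Om x)‖ ≤ ‖J (S.G c x)‖ * ‖J (S.G c x)‖ := by gcongr
  have h5 : ‖J x‖ ^ 2 ≤ ‖J (S.G c x)‖ ^ 2 := by gcongr
  linarith

/-- An operator dominated by the square root of the energy is dominated by the free operator. -/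
lemma le_G_of_sq_le {z : V} (h : ‖J z‖ ^ 2 ≤ S.C * (‖J x‖ ^ 2 + reInner J x (S.Om x))) :
    ‖J z‖ ≤ 2 * S.C * ‖J (S.G c x)‖ := by
  have hC := S.one_le
  refine le_of_sq_le ?_ (by positivity)
  have : S.C * (‖J x‖ ^ 2 + reInner J x (S.Om x)) ≤ S.C * (2 * ‖J (S.G c x)‖ ^ 2) := by
    gcongr; exact S.energy_le_G hc x
  nlinarith [mul_nonneg (by linarith : (0:ℝ) ≤ S.C) (sq_nonneg ‖J (S.G c x)‖)]

lemma norm_A_le_G (j : Fin 3) : ‖J (S.A j x)‖ ≤ 2 * S.C * ‖J (S.G c x)‖ :=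
  S.le_G_of_sq_le hc x (S.A_le j x)

lemma norm_W_le_G : ‖J (S.W x)‖ ≤ 2 * S.C * ‖J (S.G c x)‖ :=
  S.le_G_of_sq_le hc x (S.W_le x)

/-- `A_le` is applied to p x. The energy of p x remains bounded by the free operator because `Om`
and `p` commute, see `energy_p_le`. -/
lemma norm_A_p_le_G (j : Fin 3) : ‖J (S.A j (S.p j x))‖ ≤ 2 * S.C * ‖J (S.G c x)‖ := by
  have hC := S.one_le
  refine le_of_sq_le ?_ (by positivity)
  have : S.C * (‖J (S.p j x)‖ ^ 2 + reInner J (S.p j x) (S.Om (S.p j x))) ≤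
      S.C * (4 * ‖J (S.G c x)‖ ^ 2) := by
    gcongr; exact S.energy_p_le_G hc x j
  nlinarith [mul_nonneg (by linarith : (0:ℝ) ≤ S.C) (sq_nonneg ‖J (S.G c x)‖),
    S.A_le j (S.p j x)]

lemma norm_p_A_le_G (j : Fin 3) : ‖J (S.p j (S.A j x))‖ ≤ 4 * S.C * ‖J (S.G c x)‖ := by
  have h1 := S.norm_A_p_le_G hc x j
  have h2 := S.le_G_of_sq_le hc x (S.p_A_le j x)
  have h3 : J (S.p j (S.A j x)) = J (S.A j (S.p j x)) + J (S.p j (S.A j x) - S.A j (S.p j x)) := by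
    rw [map_sub]; abel
  rw [h3]
  exact (norm_add_le _ _).trans (by linarith)

lemma norm_A_A_le_G (j : Fin 3) : ‖J (S.A j (S.A j x))‖ ≤ 5 * S.C * ‖J (S.G c x)‖ := by
  have hC := S.one_le
  have h1 := S.norm_le_G hc x
  have h2 := S.norm_Om_le_G hc x
  refine le_of_sq_le ?_ (by positivity)
  have h1 : S.C * (‖J (S.A j x)‖ ^ 2 + reInner J (S.A j x) (S.Om (S.A j x))) ≤
      S.C * (5 * S.C * (‖J (S.G c x)‖ + ‖J (S.G c x)‖) ^ 2) := by
    gcongr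
    exact (S.energy_A_le j x).trans (by gcongr)
  nlinarith [S.A_le j (S.A j x), sq_nonneg (S.C * ‖J (S.G c x)‖)]

end words

/-- The form of the interacting operator is bounded below. -/
lemma form_H_ge {c : ℝ} (hc : S.C ≤ c) (x : V) : -(c * ‖J x‖ ^ 2) ≤ reInner J x (S.H x) := by
  have hC := S.one_le
  have h1 : 0 ≤ reInner J x (S.vsq x) := by
    rw [vsq_apply, reInner_sum_right]
    refine Finset.sum_nonneg fun j _ => ?_
    rw [← S.re_symm_v, reInner_self]; positivity
  have h2 : -(S.C * ‖J x‖ ^ 2 / 2 + ‖J (S.W x)‖ ^ 2 / (2 * S.C)) ≤ reInner J x (S.W x) := by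
    have := neg_le_of_abs_le (abs_reInner_le J x (S.W x))
    -- Young's inequality is weighted by `C` so that, after `W_le`, the interaction uses up only
    -- half of the form of `Om`.
    have e : ‖J x‖ * ‖J (S.W x)‖ ≤ S.C * ‖J x‖ ^ 2 / 2 + ‖J (S.W x)‖ ^ 2 / (2 * S.C) := by
      have e1 : S.C * ‖J x‖ ^ 2 / 2 + ‖J (S.W x)‖ ^ 2 / (2 * S.C) - ‖J x‖ * ‖J (S.W x)‖ =
        (S.C * ‖J x‖ - ‖J (S.W x)‖) ^ 2 / (2 * S.C) := by field_simp; ring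
      have : 0 ≤ (S.C * ‖J x‖ - ‖J (S.W x)‖) ^ 2 / (2 * S.C) := by positivity
      linarith
    linarith
  have h3 : ‖J (S.W x)‖ ^ 2 / (2 * S.C) ≤ (‖J x‖ ^ 2 + reInner J x (S.Om x)) / 2 := by
    rw [div_le_div_iff₀ (by positivity) (by positivity)]
    linarith [S.W_le x]
  have h4 := S.Om_nonneg x
  rw [H_apply, reInner_add_right, reInner_add_right, reInner_smul_right]
  have h5 : S.C * ‖J x‖ ^ 2 ≤ c * ‖J x‖ ^ 2 := by gcongr
  nlinarith [sq_nonneg ‖J x‖]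

end FieldSystem

end AbstractCore

/-! ### The method of continuity and the infimum of the spectrum -/

section Continuity

variable {𝓗 : Type*} [NormedAddCommGroup 𝓗] [InnerProductSpace ℂ 𝓗] [CompleteSpace 𝓗]

/-- The lower bound gives ‖A⁻¹‖ ≤ 1/δ, so the Neumann series converges on the whole ball of radius δ
around `A`. -/
lemma isUnit_of_near [Nontrivial 𝓗] {A B : 𝓗 →L[ℂ] 𝓗} {δ : ℝ} (hδ : 0 < δ)
    (hA : IsUnit A) (hlow : ∀ x, δ * ‖x‖ ≤ ‖A x‖) (hAB : ‖B - A‖ < δ) : IsUnit B := by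
  obtain ⟨u, rfl⟩ := hA
  have h1 : ‖((u⁻¹ : (𝓗 →L[ℂ] 𝓗)ˣ) : 𝓗 →L[ℂ] 𝓗)‖ ≤ δ⁻¹ := by
    refine ContinuousLinearMap.opNorm_le_bound _ (by positivity) fun x => ?_
    have h2 := hlow (((u⁻¹ : (𝓗 →L[ℂ] 𝓗)ˣ) : 𝓗 →L[ℂ] 𝓗) x)
    have h3 : (u : 𝓗 →L[ℂ] 𝓗) (((u⁻¹ : (𝓗 →L[ℂ] 𝓗)ˣ) : 𝓗 →L[ℂ] 𝓗) x) = x := by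
      rw [← mul_apply_eq_comp, Units.mul_inv]; rfl
    rw [h3] at h2
    rw [inv_mul_eq_div, le_div_iff₀ hδ]
    linarith
  have h4 : 0 < ‖((u⁻¹ : (𝓗 →L[ℂ] 𝓗)ˣ) : 𝓗 →L[ℂ] 𝓗)‖ := Units.norm_pos _
  have h5 : δ ≤ ‖((u⁻¹ : (𝓗 →L[ℂ] 𝓗)ˣ) : 𝓗 →L[ℂ] 𝓗)‖⁻¹ := by
    rwa [le_inv_comm₀ hδ h4]
  exact ⟨Units.ofNearby u B (hAB.trans_le h5), rfl⟩

/-- Method of continuity: invertibility propagates along a path of operators that are uniformly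
bounded below. -/
lemma isUnit_of_path [Nontrivial 𝓗] {F : ℝ → 𝓗 →L[ℂ] 𝓗} (hF : Continuous F) {δ : ℝ} (hδ : 0 < δ)
    (h0 : IsUnit (F 0)) (hlow : ∀ t ∈ Set.Icc (0 : ℝ) 1, ∀ x, δ * ‖x‖ ≤ ‖F t x‖) :
    IsUnit (F 1) := by
  have huc := isCompact_Icc.uniformContinuousOn_of_continuous (s := Set.Icc (0 : ℝ) 1)
    hF.continuousOn
  -- Since δ is the same along the path, one step size works everywhere and finitely many
  -- perturbations lead from 0 to 1.
  obtain ⟨η, hη, h⟩ := Metric.uniformContinuousOn_iff.1 huc δ hδ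
  obtain ⟨N, hN⟩ := exists_nat_gt (1 / η)
  have hN0 : (0 : ℝ) < N := lt_trans (by positivity) hN
  have key : ∀ k : ℕ, k ≤ N → IsUnit (F (k / N)) := by
    intro k
    induction k with
    | zero => intro _; simpa using h0
    | succ k ih =>
      intro hk
      have hm1 : (k / N : ℝ) ∈ Set.Icc (0 : ℝ) 1 :=
        ⟨by positivity, by rw [div_le_one hN0]; exact_mod_cast (Nat.le_succ k).trans hk⟩
      have hm2 : ((k + 1 : ℕ) / N : ℝ) ∈ Set.Icc (0 : ℝ) 1 :=
        ⟨by positivity, by rw [div_le_one hN0]; exact_mod_cast hk⟩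
      refine isUnit_of_near hδ (ih ((Nat.le_succ k).trans hk)) (hlow _ hm1) ?_
      rw [← dist_eq_norm]
      refine h _ hm2 _ hm1 ?_
      rw [Real.dist_eq]
      have : ((k + 1 : ℕ) / N : ℝ) - k / N = 1 / N := by push_cast; ring
      rw [this, abs_of_pos (by positivity), div_lt_comm₀ hN0 hη]
      exact hN
  have := key N le_rfl
  rwa [div_self hN0.ne'] at this

end Continuity

section Spectrum

variable {V : Type*} [AddCommGroup V] [Module ℂ V]
  {𝓗 : Type*} [NormedAddCommGroup 𝓗] [InnerProductSpace ℂ 𝓗]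

/-- The values of the quadratic form of `H` on unit vectors of the core. -/
def formRange (J : V →ₗ[ℂ] 𝓗) (H : V →ₗ[ℂ] V) : Set ℝ :=
  {r | ∃ x, ‖J x‖ = 1 ∧ r = reInner J x (H x)}

lemma formRange_nonempty [Nontrivial 𝓗] {J : V →ₗ[ℂ] 𝓗} (hJ : DenseRange J) (H : V →ₗ[ℂ] V) :
    (formRange J H).Nonempty := by
  obtain ⟨x, hx⟩ : ∃ x, J x ≠ 0 := by
    by_contra! h
    obtain ⟨y, hy⟩ := exists_ne (0 : 𝓗)
    refine hy (hJ.induction_on (p := fun z => z = 0) y (isClosed_singleton) h)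
  refine ⟨_, ((‖J x‖⁻¹ : ℝ) : ℂ) • x, ?_, rfl⟩
  rw [map_smul, norm_smul, Complex.norm_real, norm_inv, norm_norm,
    inv_mul_cancel₀ (norm_ne_zero_iff.2 hx)]

lemma mul_le_form_of_le {J : V →ₗ[ℂ] 𝓗} {H : V →ₗ[ℂ] V} {q : ℝ}
    (h : ∀ r ∈ formRange J H, q ≤ r) (x : V) : q * ‖J x‖ ^ 2 ≤ reInner J x (H x) := by
  by_cases hx : J x = 0
  · simp [reInner, hx]
  have hn : 0 < ‖J x‖ := norm_pos_iff.2 hx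
  have h1 := h _ ⟨((‖J x‖⁻¹ : ℝ) : ℂ) • x, by
    rw [map_smul, norm_smul, Complex.norm_real, norm_inv, norm_norm,
      inv_mul_cancel₀ hn.ne'], rfl⟩
  rw [map_smul, reInner_smul_left, reInner_smul_right, ← mul_assoc, ← mul_inv, ← sq,
    inv_mul_eq_div, le_div_iff₀ (by positivity)] at h1
  exact h1

variable {J : V →ₗ[ℂ] 𝓗} (hJ : DenseRange J) {H K : V →ₗ[ℂ] V} {c : ℝ}
  (hK : Function.Surjective K) {𝓚 𝓛 : 𝓗 →L[ℂ] 𝓗} (h𝓚 : ∀ x, 𝓚 (J x) = J (K x))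
  (h𝓛 : ∀ x, 𝓛 (J x) = J (H (K x) + (c : ℂ) • K x)) (hunit : IsUnit 𝓛)
  (hsymm : ∀ x y, inner ℂ (J (H x)) (J y) = inner ℂ (J x) (J (H y)))
  {T : 𝓗 →ₗ.[ℂ] 𝓗} (hT : ∀ y, (𝓚 y, 𝓛 y - (c : ℂ) • 𝓚 y) ∈ T.graph)
  (hdom : ∀ x ∈ T.domain, ∃ y, 𝓚 y = x)

include hJ hK h𝓚 h𝓛 hsymm hT hdom in
-- A nonnegative symmetric operator with bounded inverse is bounded below by a positive constant;
-- here this is applied to `T - q`. In the application `K` inverts the free operator on the core,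
-- while 𝓚 and 𝓛 are the bounded extensions of `K` and (H + c) K, so `T - q` acts as 𝓚 y ↦ B y.
-- Positivity and symmetry pass from the core to all `y` by density.
lemma exists_form_ge_of_mem_resolventSet {q : ℝ}
    (hq : ∀ x, q * ‖J x‖ ^ 2 ≤ reInner J x (H x)) (hres : (q : ℂ) ∈ resolventSet T) :
    ∃ δ > 0, ∀ x, (q + δ) * ‖J x‖ ^ 2 ≤ reInner J x (H x) := by
  obtain ⟨R, hR1, -⟩ := hres
  let B : 𝓗 →L[ℂ] 𝓗 := 𝓛 - ((c + q : ℝ) : ℂ) • 𝓚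
  have hBJ : ∀ x, B (J x) = J (H (K x) - (q : ℂ) • K x) := by
    intro x
    simp only [B, sub_apply, smul_apply, h𝓚, h𝓛, map_sub,
      map_add, map_smul]
    push_cast
    module
  have hpos : ∀ y, 0 ≤ (inner ℂ (𝓚 y) (B y)).re := by
    intro y
    refine hJ.induction_on (p := fun y => 0 ≤ (inner ℂ (𝓚 y) (B y)).re) y
      (isClosed_le (by fun_prop) (by fun_prop)) fun x => ?_
    rw [hBJ, h𝓚]
    have := hq (K x)
    have h2 : (inner ℂ (J (K x)) (J (H (K x) - (q : ℂ) • K x))).re =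
      reInner J (K x) (H (K x) - (q : ℂ) • K x) := rfl
    rw [h2, reInner_sub_right, reInner_smul_right, reInner_self]
    linarith
  have hsy : ∀ y z, (inner ℂ (𝓚 y) (B z)) = (inner ℂ (B y) (𝓚 z)) := by
    intro y z
    refine hJ.induction_on₂ (p := fun y z => inner ℂ (𝓚 y) (B z) = inner ℂ (B y) (𝓚 z))
      (isClosed_eq (by fun_prop) (by fun_prop)) (fun x x' => ?_) y z
    rw [hBJ, hBJ, h𝓚, h𝓚, map_sub, map_sub, inner_sub_left, inner_sub_right, hsymm, map_smul,
      map_smul, inner_smul_left, inner_smul_right, Complex.conj_ofReal]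
  set m := ‖R‖ + 1 with hm
  have hm0 : 0 < m := by positivity
  refine ⟨1 / m, by positivity, fun x => ?_⟩
  obtain ⟨x, rfl⟩ := hK x
  set y := J x with hy
  obtain ⟨hmem, hRT⟩ := hR1 (𝓚 y)
  obtain ⟨z, hz⟩ := hdom _ hmem
  have hBz : B z = 𝓚 y := by
    rw [← hRT]
    have h1 : T ⟨R (𝓚 y), hmem⟩ = 𝓛 z - (c : ℂ) • 𝓚 z :=
      LinearPMap.mem_graph_snd_inj T (LinearPMap.mem_graph T ⟨R (𝓚 y), hmem⟩) (hT z) hz.symm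
    rw [h1, ← hz]
    simp only [B, sub_apply, smul_apply]
    push_cast
    module
  -- Because B z = 𝓚 y, the form at this vector is the form at y, minus (2/m)‖𝓚 y‖², plus ⟨𝓚 z, 𝓚
  -- y⟩/m². The last term is at most ‖𝓚 y‖²/m since `m` exceeds ‖R‖, so a gap of 1/m remains.
  have hs := hpos (y - ((1 / m : ℝ) : ℂ) • z)
  have e1 : (inner ℂ (𝓚 y) (𝓚 y)).re = ‖𝓚 y‖ ^ 2 := by
    simpa using inner_self_eq_norm_sq (𝕜 := ℂ) (𝓚 y)
  have e2 : (inner ℂ (𝓚 z) (𝓚 y)).re ≤ ‖R‖ * ‖𝓚 y‖ ^ 2 := by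
    refine ((Complex.re_le_norm _).trans (norm_inner_le_norm _ _)).trans ?_
    rw [hz, sq, ← mul_assoc]
    gcongr
    exact R.le_opNorm _
  have e3 : (inner ℂ (𝓚 z) (B y)).re = ‖𝓚 y‖ ^ 2 := by rw [hsy, hBz, e1]
  rw [map_sub, map_sub, map_smul, map_smul, inner_sub_left, inner_sub_right, inner_sub_right,
    inner_smul_left, inner_smul_left, inner_smul_right, inner_smul_right, hBz, Complex.conj_ofReal]
    at hs
  simp only [Complex.sub_re, Complex.re_ofReal_mul] at hs
  rw [e1, e3] at hs
  have e4 : (inner ℂ (𝓚 y) (B y)).re = reInner J (K x) (H (K x)) - q * ‖J (K x)‖ ^ 2 := by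
    rw [hy, hBJ, h𝓚]
    change reInner J (K x) (H (K x) - (q : ℂ) • K x) = _
    rw [reInner_sub_right, reInner_smul_right, reInner_self]
  have e5 : ‖𝓚 y‖ = ‖J (K x)‖ := by rw [hy, h𝓚]
  rw [e4] at hs
  rw [e5] at hs e2
  have e6 : 1 / m * (1 / m * (inner ℂ (𝓚 z) (𝓚 y)).re) ≤ 1 / m * ‖J (K x)‖ ^ 2 := by
    gcongr
    rw [div_mul_eq_mul_div, one_mul, div_le_iff₀ hm0]
    nlinarith [sq_nonneg ‖J (K x)‖]
  linarith

variable [CompleteSpace 𝓗] [Nontrivial 𝓗]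

include hJ h𝓚 h𝓛 hunit hT hdom in
-- The shift t(l + c) - c runs from -c, where invertibility is given, to l. Along the way the form
-- stays above the shift by δ, which gives the lower bound that the method of continuity requires.
lemma mem_resolventSet_of_lt {l δ : ℝ} (hδ : 0 < δ)
    (hc : ∀ x, (-c + δ) * ‖J x‖ ^ 2 ≤ reInner J x (H x))
    (hl : ∀ x, (l + δ) * ‖J x‖ ^ 2 ≤ reInner J x (H x)) : (l : ℂ) ∈ resolventSet T := by
  let F : ℝ → 𝓗 →L[ℂ] 𝓗 := fun t => 𝓛 - ((t * (l + c) : ℝ) : ℂ) • 𝓚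
  have hF : Continuous F := by fun_prop
  obtain ⟨u, hu⟩ := hunit
  set m := ‖((u⁻¹ : (𝓗 →L[ℂ] 𝓗)ˣ) : 𝓗 →L[ℂ] 𝓗)‖ with hm
  have hm0 : 0 < m := Units.norm_pos _
  have hu1 : ∀ y, ‖y‖ ≤ m * ‖𝓛 y‖ := by
    intro y
    have : ((u⁻¹ : (𝓗 →L[ℂ] 𝓗)ˣ) : 𝓗 →L[ℂ] 𝓗) (𝓛 y) = y := by
      rw [← hu, ← mul_apply_eq_comp, Units.inv_mul]; rfl
    conv_lhs => rw [← this]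
    exact ContinuousLinearMap.le_opNorm _ _
  have hFJ : ∀ t x, F t (J x) = J (H (K x) - ((t * (l + c) - c : ℝ) : ℂ) • K x) := by
    intro t x
    simp only [F, sub_apply, smul_apply, h𝓚, h𝓛, map_sub,
      map_add, map_smul]
    push_cast
    module
  have hform : ∀ t ∈ Set.Icc (0 : ℝ) 1, ∀ x, δ * ‖J (K x)‖ ≤ ‖F t (J x)‖ := by
    rintro t ⟨ht0, ht1⟩ x
    rw [hFJ]
    set z := K x
    set μ := t * (l + c) - c with hμ
    have h1 : (μ + δ) * ‖J z‖ ^ 2 ≤ reInner J z (H z) := by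
      have := mul_le_mul_of_nonneg_left (hc z) (by linarith : 0 ≤ 1 - t)
      have := mul_le_mul_of_nonneg_left (hl z) ht0
      rw [hμ]; nlinarith
    have h2 := reInner_le J z (H z - ((μ : ℝ) : ℂ) • z)
    rw [reInner_sub_right, reInner_smul_right, reInner_self] at h2
    rcases eq_or_lt_of_le (norm_nonneg (J z)) with h0 | h0
    · rw [← h0, mul_zero]; exact norm_nonneg _
    · refine le_of_mul_le_mul_left ?_ h0
      nlinarith
  -- The form controls only ‖𝓚 y‖. The full norm of y is recovered from the invertibility of 𝓛,
  -- which differs from `F t` by a multiple of 𝓚.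
  have hlow : ∀ t ∈ Set.Icc (0 : ℝ) 1, ∀ y,
      (m * (1 + |l + c| / δ))⁻¹ * ‖y‖ ≤ ‖F t y‖ := by
    rintro t ht y
    refine hJ.induction_on (p := fun y => (m * (1 + |l + c| / δ))⁻¹ * ‖y‖ ≤ ‖F t y‖) y
      (isClosed_le (by fun_prop) (by fun_prop)) fun x => ?_
    rw [inv_mul_eq_div, div_le_iff₀ (by positivity)]
    have h1 := hu1 (J x)
    have h2 := hform t ht x
    have h3 : ‖𝓛 (J x)‖ ≤ ‖F t (J x)‖ + |l + c| * ‖J (K x)‖ := by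
      have : 𝓛 (J x) = F t (J x) + ((t * (l + c) : ℝ) : ℂ) • J (K x) := by
        simp [F, h𝓚]
      rw [this]
      refine (norm_add_le _ _).trans (add_le_add le_rfl ?_)
      rw [norm_smul, Complex.norm_real, Real.norm_eq_abs, abs_mul, abs_of_nonneg ht.1]
      gcongr
      exact mul_le_of_le_one_left (abs_nonneg _) ht.2
    have h4 : ‖J (K x)‖ ≤ ‖F t (J x)‖ / δ := by rw [le_div_iff₀ hδ]; linarith
    have h5 : |l + c| * ‖J (K x)‖ ≤ |l + c| * (‖F t (J x)‖ / δ) := by gcongr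
    calc ‖J x‖ ≤ m * (‖F t (J x)‖ + |l + c| * (‖F t (J x)‖ / δ)) := by
          refine h1.trans ?_; gcongr; linarith
      _ = _ := by ring
  have hF1 : IsUnit (F 1) := isUnit_of_path hF (by positivity)
    (by simpa [F] using ⟨u, hu⟩) hlow
  obtain ⟨w, hw⟩ := hF1
  have hwr : ∀ x, F 1 (((w⁻¹ : (𝓗 →L[ℂ] 𝓗)ˣ) : 𝓗 →L[ℂ] 𝓗) x) = x := by
    intro x; rw [← hw, ← mul_apply_eq_comp, Units.mul_inv]; rfl
  have hwl : ∀ x, ((w⁻¹ : (𝓗 →L[ℂ] 𝓗)ˣ) : 𝓗 →L[ℂ] 𝓗) (F 1 x) = x := by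
    intro x; rw [← hw, ← mul_apply_eq_comp, Units.inv_mul]; rfl
  have hval : ∀ y (h : 𝓚 y ∈ T.domain), T ⟨𝓚 y, h⟩ - (l : ℂ) • 𝓚 y = F 1 y := by
    intro y h
    have h1 : T ⟨𝓚 y, h⟩ = 𝓛 y - (c : ℂ) • 𝓚 y :=
      LinearPMap.mem_graph_snd_inj T (LinearPMap.mem_graph T ⟨𝓚 y, h⟩) (hT y) rfl
    rw [h1]
    simp only [F, sub_apply, smul_apply]
    push_cast
    module
  refine ⟨𝓚 ∘L ((w⁻¹ : (𝓗 →L[ℂ] 𝓗)ˣ) : 𝓗 →L[ℂ] 𝓗), fun x => ?_, ?_⟩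
  · have h : 𝓚 (((w⁻¹ : (𝓗 →L[ℂ] 𝓗)ˣ) : 𝓗 →L[ℂ] 𝓗) x) ∈ T.domain :=
      LinearPMap.mem_domain_of_mem_graph (hT _)
    exact ⟨h, (hval _ h).trans (hwr x)⟩
  · rintro ⟨x, hx⟩
    obtain ⟨y, rfl⟩ := hdom x hx
    simp only
    rw [hval y hx, ContinuousLinearMap.comp_apply, hwl]

include hJ hK h𝓚 h𝓛 hunit hsymm hT hdom in
/-- The infimum of the spectrum is the infimum of the quadratic form on the core. -/
theorem sInf_spectrum_eq {δ : ℝ} (hδ : 0 < δ)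
    (hc : ∀ x, (-c + δ) * ‖J x‖ ^ 2 ≤ reInner J x (H x)) :
    sInf {r : ℝ | (r : ℂ) ∈ spectrum T} = sInf (formRange J H) := by
  have hne := formRange_nonempty hJ H
  have hbdd : BddBelow (formRange J H) := ⟨-c + δ, by
    rintro r ⟨x, hx, rfl⟩; simpa [hx] using hc x⟩
  have hq : ∀ x, sInf (formRange J H) * ‖J x‖ ^ 2 ≤ reInner J x (H x) :=
    mul_le_form_of_le fun r hr => csInf_le hbdd hr
  -- The infimum of the form belongs to the spectrum, because otherwise the form would have a gap
  -- above it; every real number below it lies in the resolvent set.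
  refine IsLeast.csInf_eq ⟨fun hres => ?_, fun r hr => ?_⟩
  · obtain ⟨η, hη, h⟩ :=
      exists_form_ge_of_mem_resolventSet hJ hK h𝓚 h𝓛 hsymm hT hdom hq hres
    have : sInf (formRange J H) + η ≤ sInf (formRange J H) := by
      refine le_csInf hne ?_
      rintro r ⟨x, hx, rfl⟩
      simpa [hx] using h x
    linarith
  · by_contra! hlt
    set q := sInf (formRange J H)
    refine hr (mem_resolventSet_of_lt hJ h𝓚 h𝓛 hunit hT hdom (lt_min hδ (sub_pos.2 hlt))
      (fun x => le_trans ?_ (hc x)) fun x => le_trans ?_ (hq x))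
    · gcongr; exact min_le_left _ _
    · gcongr; linarith [min_le_right δ (q - r)]

end Spectrum

/-! ### Invertibility of the interacting operator relative to the free one -/

section RelativeExtension

variable {V : Type*} [AddCommGroup V] [Module ℂ V]
  {𝓗 : Type*} [NormedAddCommGroup 𝓗] [InnerProductSpace ℂ 𝓗] [CompleteSpace 𝓗]

/-- The continuous extension of `X K` from the core to the Hilbert space. -/
def relExt (J : V →ₗ[ℂ] 𝓗) (K X : V →ₗ[ℂ] V) : 𝓗 →L[ℂ] 𝓗 :=
  (J ∘ₗ X ∘ₗ K).extendOfNorm J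

lemma relExt_apply {J : V →ₗ[ℂ] 𝓗} (hJ : DenseRange J) {K X : V →ₗ[ℂ] V}
    (h : ∃ M, ∀ x, ‖J (X (K x))‖ ≤ M * ‖J x‖) (x : V) : relExt J K X (J x) = J (X (K x)) :=
  LinearMap.extendOfNorm_eq hJ h x

namespace FieldSystem

variable {J : V →ₗ[ℂ] 𝓗} (S : FieldSystem J)

/-- The part of the interacting operator that is linear in the interaction. -/
def H₁ : V →ₗ[ℂ] V :=
  ((1 / 2 : ℝ) : ℂ) • ∑ j, (S.p j ∘ₗ S.A j + S.A j ∘ₗ S.p j) + S.W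

/-- The part of the interacting operator that is quadratic in the interaction. -/
def H₂ : V →ₗ[ℂ] V := ((1 / 2 : ℝ) : ℂ) • ∑ j, S.A j ∘ₗ S.A j

omit [CompleteSpace 𝓗] in
-- The scaled operator is a quadratic polynomial in `t` with coefficients bounded relative to the
-- free operator, so it gives a norm-continuous path after composition with the inverse of `G`.
lemma scale_H_apply (c t : ℝ) (h0 : 0 ≤ t) (h1 : t ≤ 1) (x : V) :
    (S.scale t h0 h1).H x + (c : ℂ) • x =
      S.G c x + (t : ℂ) • S.H₁ x + (t : ℂ) ^ 2 • S.H₂ x := by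
  have hA : ∀ j y, (S.scale t h0 h1).A j y = (t : ℂ) • S.A j y := fun _ _ => rfl
  have hp : ∀ j y, (S.scale t h0 h1).p j y = S.p j y := fun _ _ => rfl
  have hW : ∀ y, (S.scale t h0 h1).W y = (t : ℂ) • S.W y := fun _ => rfl
  have hO : ∀ y, (S.scale t h0 h1).Om y = S.Om y := fun _ => rfl
  rw [H_apply, G_apply, psq_apply, vsq_apply, hW, hO]
  simp only [v_apply, hA, hp, H₁, H₂, map_add, map_smul, LinearMap.add_apply, LinearMap.smul_apply,
    LinearMap.sum_apply, LinearMap.comp_apply, Fin.sum_univ_three]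
  module

omit [CompleteSpace 𝓗] in
lemma scale_one_H (x : V) : (S.scale 1 zero_le_one le_rfl).H x = S.H x := by
  have hA : ∀ j y, (S.scale 1 zero_le_one le_rfl).A j y = S.A j y := fun j y => by
    change ((1 : ℝ) : ℂ) • S.A j y = _; simp
  have hp : ∀ j y, (S.scale 1 zero_le_one le_rfl).p j y = S.p j y := fun _ _ => rfl
  have hW : ∀ y, (S.scale 1 zero_le_one le_rfl).W y = S.W y := fun y => by
    change ((1 : ℝ) : ℂ) • S.W y = _; simp
  have hO : ∀ y, (S.scale 1 zero_le_one le_rfl).Om y = S.Om y := fun _ => rfl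
  rw [H_apply, H_apply, vsq_apply, vsq_apply, hW, hO]
  simp only [v_apply, hA, hp]

omit [CompleteSpace 𝓗] in
-- The constant is ½·3·(4C + 2C) + 2C, from p A, A p and W.
lemma norm_H₁_le {c : ℝ} (hc : 1 ≤ c) (x : V) : ‖J (S.H₁ x)‖ ≤ 11 * S.C * ‖J (S.G c x)‖ := by
  have hsum : ‖∑ j, J (S.p j (S.A j x) + S.A j (S.p j x))‖ ≤ 3 * (6 * S.C * ‖J (S.G c x)‖) := by
    refine (norm_sum_le_of_le _ (n := fun _ => 6 * S.C * ‖J (S.G c x)‖) fun j _ => ?_).trans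
      (by simp)
    rw [map_add]
    refine (norm_add_le _ _).trans ?_
    linarith [S.norm_p_A_le_G hc x j, S.norm_A_p_le_G hc x j]
  simp only [H₁, LinearMap.add_apply, LinearMap.smul_apply, LinearMap.sum_apply,
    LinearMap.comp_apply, map_add J (_ • _), map_smul, map_sum]
  refine (norm_add_le _ _).trans ?_
  rw [norm_smul, Complex.norm_real, Real.norm_of_nonneg (by norm_num)]
  linarith [S.norm_W_le_G hc x]

omit [CompleteSpace 𝓗] in
lemma norm_H₂_le {c : ℝ} (hc : 1 ≤ c) (x : V) : ‖J (S.H₂ x)‖ ≤ 8 * S.C * ‖J (S.G c x)‖ := by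
  have hsum : ‖∑ j, J (S.A j (S.A j x))‖ ≤ 3 * (5 * S.C * ‖J (S.G c x)‖) :=
    (norm_sum_le_of_le _ (n := fun _ => 5 * S.C * ‖J (S.G c x)‖)
      fun j _ => S.norm_A_A_le_G hc x j).trans (by simp)
  simp only [H₂, LinearMap.smul_apply, LinearMap.sum_apply,
    LinearMap.comp_apply, map_smul, map_sum]
  rw [norm_smul, Complex.norm_real, Real.norm_of_nonneg (by norm_num)]
  have : 0 ≤ S.C * ‖J (S.G c x)‖ := mul_nonneg (by linarith [S.one_le]) (norm_nonneg _)
  linarith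

omit [CompleteSpace 𝓗] in
lemma norm_H_le {c : ℝ} (hc : 1 ≤ c) (x : V) :
    ‖J (S.H x)‖ ≤ (19 * S.C + 1 + c) * ‖J (S.G c x)‖ := by
  have h := S.scale_H_apply c 1 zero_le_one le_rfl x
  rw [scale_one_H] at h
  have h2 : S.H x = S.G c x + S.H₁ x + S.H₂ x - (c : ℂ) • x := by
    rw [eq_sub_iff_add_eq, h]; simp
  rw [h2, map_sub, map_add, map_add, map_smul]
  have h3 := norm_sub_le (J (S.G c x) + J (S.H₁ x) + J (S.H₂ x)) ((c : ℂ) • J x)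
  rw [norm_smul, Complex.norm_real, Real.norm_of_nonneg (by linarith : 0 ≤ c)] at h3
  have h4 := norm_add₃_le (a := J (S.G c x)) (b := J (S.H₁ x)) (c := J (S.H₂ x))
  have h5 : c * ‖J x‖ ≤ c * ‖J (S.G c x)‖ := by
    have := S.norm_le_G hc x
    gcongr
  linarith [S.norm_H₁_le hc x, S.norm_H₂_le hc x]

variable (hJ : DenseRange J) {c : ℝ} {K : V →ₗ[ℂ] V} (hGK : ∀ x, S.G c (K x) = x)

include hJ hGK in
lemma relExt_apply_of_le_G {X : V →ₗ[ℂ] V} (h : ∃ M, ∀ x, ‖J (X x)‖ ≤ M * ‖J (S.G c x)‖) (x : V) :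
    relExt J K X (J x) = J (X (K x)) := by
  obtain ⟨M, hM⟩ := h
  exact relExt_apply hJ ⟨M, fun x => by simpa [hGK] using hM (K x)⟩ x

include hJ hGK in
-- At t = 0 the path is the identity, being the free operator times its own inverse. The a priori
-- bound holds for every scaled system with the same constant, so invertibility reaches t = 1
-- without any smallness of the coupling.
lemma isUnit_relExt_H [Nontrivial 𝓗] (hc : 8 * S.C ≤ c) :
    IsUnit (relExt J K S.H + (c : ℂ) • relExt J K LinearMap.id) := by
  have hC := S.one_le
  have hc1 : 1 ≤ c := by linarith
  have e0 := S.relExt_apply_of_le_G hJ hGK (X := LinearMap.id) ⟨1, fun x => by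
    simpa using S.norm_le_G hc1 x⟩
  have eH := S.relExt_apply_of_le_G hJ hGK ⟨_, S.norm_H_le hc1⟩
  have e1 := S.relExt_apply_of_le_G hJ hGK ⟨_, S.norm_H₁_le hc1⟩
  have e2 := S.relExt_apply_of_le_G hJ hGK ⟨_, S.norm_H₂_le hc1⟩
  let F : ℝ → 𝓗 →L[ℂ] 𝓗 := fun t =>
    1 + (t : ℂ) • relExt J K S.H₁ + (t : ℂ) ^ 2 • relExt J K S.H₂
  have hF : Continuous F := by fun_prop
  have hFJ : ∀ t (h0 : 0 ≤ t) (h1 : t ≤ 1) x,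
      F t (J x) = J ((S.scale t h0 h1).H (K x) + (c : ℂ) • K x) := by
    intro t h0 h1 x
    rw [scale_H_apply, hGK]
    simp [F, e1, e2]
  have h1 : F 1 = relExt J K S.H + (c : ℂ) • relExt J K LinearMap.id := by
    refine ContinuousLinearMap.ext fun y => ?_
    refine hJ.induction_on (p := fun y => F 1 y = _) y
      (isClosed_eq (by fun_prop) (by fun_prop)) fun x => ?_
    rw [hFJ 1 zero_le_one le_rfl, scale_one_H]
    simp [e0, eH]
  rw [← h1]
  refine isUnit_of_path hF (δ := (32 * S.C)⁻¹) (by positivity) (by simp [F]) fun t ht y => ?_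
  refine hJ.induction_on (p := fun y => (32 * S.C)⁻¹ * ‖y‖ ≤ ‖F t y‖) y
    (isClosed_le (by fun_prop) (by fun_prop)) fun x => ?_
  rw [hFJ t ht.1 ht.2, inv_mul_eq_div, div_le_iff₀ (by positivity)]
  have := (S.scale t ht.1 ht.2).apriori (c := c) hc (K x)
  have e : (S.scale t ht.1 ht.2).G c (K x) = x := hGK x
  rw [e] at this
  rw [mul_comm]
  exact this

include hJ hGK in
/-- If the graph of `T` is the closure of the graph of the interacting operator on the core, then
the infimum of the spectrum of `T` is the infimum of the quadratic form on the core. -/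
theorem sInf_spectrum_eq [Nontrivial 𝓗] (hc : 8 * S.C ≤ c) (hKG : ∀ x, K (S.G c x) = x)
    {T : 𝓗 →ₗ.[ℂ] 𝓗} (hT : ∀ y, (relExt J K LinearMap.id y, relExt J K S.H y) ∈ T.graph)
    (hdom : ∀ x ∈ T.domain, ∃ y, relExt J K LinearMap.id y = x) :
    sInf {r : ℝ | (r : ℂ) ∈ spectrum T} = sInf (formRange J S.H) := by
  have hC := S.one_le
  have hc1 : 1 ≤ c := by linarith
  have e0 := S.relExt_apply_of_le_G hJ hGK (X := LinearMap.id) ⟨1, fun x => by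
    simpa using S.norm_le_G hc1 x⟩
  have eH := S.relExt_apply_of_le_G hJ hGK ⟨_, S.norm_H_le hc1⟩
  refine PauliFierz.sInf_spectrum_eq hJ (c := c) (fun x => ⟨_, hKG x⟩) e0
    (𝓛 := relExt J K S.H + (c : ℂ) • relExt J K LinearMap.id) (fun x => ?_)
    (S.isUnit_relExt_H hJ hGK hc) S.symm_H (fun y => ?_) hdom one_pos fun x => ?_
  · simp [e0, eH]
  · simpa using hT y
  · have := S.form_H_ge (c := c - 1) (by linarith) x
    linarith

end FieldSystem

end RelativeExtension

/-! ### A core of well-behaved vectors in Fock space -/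

/-- The dominating function `1 + |k|^(-1/2)`, cut off at `|k| ≤ R`. -/
def envelope (R : ℝ) (k : Photon) : ℝ :=
  (Metric.closedBall (0 : E3) R).indicator (fun k => 1 + (Real.sqrt ‖k‖)⁻¹) k.2

lemma envelope_nonneg (R : ℝ) (k : Photon) : 0 ≤ envelope R k :=
  Set.indicator_nonneg (fun _ _ => by positivity) _

lemma envelope_mono {R R' : ℝ} (h : R ≤ R') (k : Photon) : envelope R k ≤ envelope R' k :=
  Set.indicator_le_indicator_of_subset (Metric.closedBall_subset_closedBall h)
    (fun _ => by positivity) _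

lemma one_le_envelope {R : ℝ} {k : Photon} (h : ‖k.2‖ ≤ R) : 1 ≤ envelope R k := by
  rw [envelope, Set.indicator_of_mem (by simpa using h)]
  have : 0 ≤ (Real.sqrt ‖k.2‖)⁻¹ := by positivity
  linarith

lemma envelope_eq_zero {R : ℝ} {k : Photon} (h : ¬ ‖k.2‖ ≤ R) : envelope R k = 0 :=
  Set.indicator_of_notMem (by simpa using h) _

lemma measurable_envelope (R : ℝ) : Measurable (envelope R) := by
  unfold envelope
  refine Measurable.comp (g := (Metric.closedBall (0 : E3) R).indicator
    fun k => 1 + (Real.sqrt ‖k‖)⁻¹) ?_ measurable_snd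
  refine Measurable.indicator ?_ Metric.isClosed_closedBall.measurableSet
  fun_prop

/-- The integrand is at most 4(1 + |k|⁻²) on a ball, and in three dimensions the factor r² of polar
coordinates cancels the singularity. This is the infrared condition behind all field bounds at mass
zero. -/
lemma integrable_envelope_sq_mul (R : ℝ) :
    Integrable (fun k => envelope R k ^ 2 * (1 + ‖k.2‖⁻¹)) photonMeasure := by
  let g : ℝ → ℝ := fun r => (Set.Iic R).indicator (fun r => 4 * (1 + (r ^ 2)⁻¹)) r
  have hg : Integrable (fun k : E3 => g ‖k‖) := by
    rw [integrable_fun_norm_addHaar (volume : Measure E3) (f := g)]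
    have hd : Module.finrank ℝ E3 - 1 = 2 := by simp
    rw [hd]
    have h1 : IntegrableOn (fun y : ℝ => 4 * (y ^ 2 + 1)) (Set.Ioc 0 R) :=
      (Continuous.integrableOn_Icc (by fun_prop)).mono_set Set.Ioc_subset_Icc_self
    have h2 : Integrable ((Set.Ioc 0 R).indicator fun y : ℝ => 4 * (y ^ 2 + 1)) :=
      h1.integrable_indicator measurableSet_Ioc
    refine (h2.integrableOn (s := Set.Ioi 0)).congr_fun (fun y (hy : 0 < y) => ?_) measurableSet_Ioi
    by_cases hR : y ≤ R
    · rw [Set.indicator_of_mem (show y ∈ Set.Ioc 0 R from ⟨hy, hR⟩)]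
      simp only [g]
      rw [Set.indicator_of_mem (show y ∈ Set.Iic R from hR), smul_eq_mul]
      field_simp
    · rw [Set.indicator_of_notMem fun h : y ∈ Set.Ioc 0 R => hR h.2]
      simp only [g]
      rw [Set.indicator_of_notMem (show y ∉ Set.Iic R from hR), smul_zero]
  refine (Integrable.comp_snd hg (Measure.count : Measure (Fin 2))).mono'
    (((measurable_envelope R).pow_const 2).mul (by fun_prop)).aestronglyMeasurable
    (Eventually.of_forall fun k => ?_)
  rw [Real.norm_of_nonneg (mul_nonneg (sq_nonneg _) (by positivity))]
  by_cases hR : ‖k.2‖ ≤ R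
  · simp only [g, envelope]
    rw [Set.indicator_of_mem (show ‖k.2‖ ∈ Set.Iic R from hR), Set.indicator_of_mem (by simpa using hR)]
    set a := ‖k.2‖⁻¹ with ha
    have ha0 : 0 ≤ a := by positivity
    have h1 : (Real.sqrt ‖k.2‖)⁻¹ ^ 2 = a := by rw [inv_pow, Real.sq_sqrt (norm_nonneg _)]
    set b := (Real.sqrt ‖k.2‖)⁻¹
    have h2 : (1 + b) ^ 2 ≤ 2 * (1 + a) := by nlinarith [sq_nonneg (b - 1)]
    have h3 : (‖k.2‖ ^ 2)⁻¹ = a ^ 2 := by rw [ha, inv_pow]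
    rw [h3]
    calc (1 + b) ^ 2 * (1 + a) ≤ 2 * (1 + a) * (1 + a) := by gcongr
      _ ≤ 4 * (1 + a ^ 2) := by nlinarith [sq_nonneg (a - 1)]
  · simp only [g]
    rw [envelope_eq_zero hR, Set.indicator_of_notMem (show ‖k.2‖ ∉ Set.Iic R from hR)]
    simp

lemma integrable_envelope_sq (R : ℝ) : Integrable (fun k => envelope R k ^ 2) photonMeasure := by
  refine (integrable_envelope_sq_mul R).mono' ((measurable_envelope R).pow_const 2).aestronglyMeasurable
    (Eventually.of_forall fun k => ?_)
  rw [Real.norm_of_nonneg (sq_nonneg _)]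
  exact le_mul_of_one_le_right (sq_nonneg _) (by simp)

/-- Square integrable symmetric functions with finitely many photons that are dominated by products
of envelopes; they form a common core of all operators considered here. -/
def coreSpace : Submodule ℂ (∀ n, (Fin n → Photon) → ℂ) where
  carrier := {ψ | (∀ n, Measurable (ψ n)) ∧
    (∀ n (π : Equiv.Perm (Fin n)) x, ψ n (fun i => x (π i)) = ψ n x) ∧
    (∃ N, ∀ n, N ≤ n → ψ n = 0) ∧
    ∃ R, ∀ n, ∃ C, 0 ≤ C ∧ ∀ x, ‖ψ n x‖ ≤ C * ∏ i, envelope R (x i)}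
  zero_mem' := ⟨fun n => measurable_const, fun n π x => rfl, ⟨0, fun n _ => rfl⟩,
    0, fun n => ⟨0, le_rfl, fun x => by simp⟩⟩
  add_mem' := by
    rintro ψ φ ⟨h1, h2, ⟨N, hN⟩, R, hR⟩ ⟨h1', h2', ⟨N', hN'⟩, R', hR'⟩
    refine ⟨fun n => (h1 n).add (h1' n), fun n π x => ?_, ⟨max N N', fun n hn => ?_⟩,
      max R R', fun n => ?_⟩
    · simp only [Pi.add_apply, h2 n π x, h2' n π x]
    · simp only [Pi.add_apply, hN n (le_of_max_le_left hn), hN' n (le_of_max_le_right hn), add_zero]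
    · obtain ⟨C, hC, h⟩ := hR n
      obtain ⟨C', hC', h'⟩ := hR' n
      refine ⟨C + C', by positivity, fun x => (norm_add_le _ _).trans ?_⟩
      have e1 : ∏ i, envelope R (x i) ≤ ∏ i, envelope (max R R') (x i) :=
        Finset.prod_le_prod (fun i _ => envelope_nonneg _ _)
          fun i _ => envelope_mono (le_max_left _ _) _
      have e2 : ∏ i, envelope R' (x i) ≤ ∏ i, envelope (max R R') (x i) :=
        Finset.prod_le_prod (fun i _ => envelope_nonneg _ _)
          fun i _ => envelope_mono (le_max_right _ _) _
      rw [add_mul]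
      exact add_le_add ((h x).trans (by gcongr)) ((h' x).trans (by gcongr))
  smul_mem' := by
    rintro c ψ ⟨h1, h2, ⟨N, hN⟩, R, hR⟩
    refine ⟨fun n => (h1 n).const_smul c, fun n π x => ?_, ⟨N, fun n hn => ?_⟩, R, fun n => ?_⟩
    · simp only [Pi.smul_apply, h2 n π x]
    · simp only [Pi.smul_apply, hN n hn, smul_zero]
    · obtain ⟨C, hC, h⟩ := hR n
      refine ⟨‖c‖ * C, by positivity, fun x => ?_⟩
      rw [Pi.smul_apply, Pi.smul_apply, norm_smul, mul_assoc]
      exact mul_le_mul_of_nonneg_left (h x) (norm_nonneg _)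

lemma measurable_core (ψ : coreSpace) (n : ℕ) : Measurable (ψ.1 n) := ψ.2.1 n

lemma symmetric_core (ψ : coreSpace) (n : ℕ) (π : Equiv.Perm (Fin n)) (x) :
    ψ.1 n (fun i => x (π i)) = ψ.1 n x :=
  ψ.2.2.1 n π x

lemma integrable_of_le_prod_envelope {n : ℕ} {u : (Fin n → Photon) → ℝ} (hu : Measurable u)
    {R C : ℝ} (h : ∀ x, |u x| ≤ C * ∏ i, envelope R (x i) ^ 2) : Integrable u (confMeasure n) :=
  ((Integrable.fintype_prod (f := fun _ : Fin n => fun k => envelope R k ^ 2)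
    fun _ => integrable_envelope_sq R).const_mul C).mono' hu.aestronglyMeasurable
    (Eventually.of_forall h)

lemma memLp_of_le_prod_envelope {n : ℕ} {u : (Fin n → Photon) → ℂ} (hu : Measurable u)
    {R C : ℝ} (h : ∀ x, ‖u x‖ ≤ C * ∏ i, envelope R (x i)) : MemLp u 2 (confMeasure n) := by
  rw [memLp_two_iff_integrable_sq_norm hu.aestronglyMeasurable]
  refine integrable_of_le_prod_envelope (hu.norm.pow_const 2) (R := R) (C := C ^ 2) fun x => ?_
  rw [abs_of_nonneg (sq_nonneg _), Finset.prod_pow, ← mul_pow]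
  exact pow_le_pow_left₀ (norm_nonneg _) (h x) 2

lemma memLp_core (ψ : coreSpace) (n : ℕ) : MemLp (ψ.1 n) 2 (confMeasure n) := by
  obtain ⟨R, hR⟩ := ψ.2.2.2.2
  obtain ⟨C, -, h⟩ := hR n
  exact memLp_of_le_prod_envelope (measurable_core ψ n) h

/-- The `n`-photon component of a core vector. -/
def coreComponent (n : ℕ) : coreSpace →ₗ[ℂ] nPhoton n where
  toFun ψ := ⟨(memLp_core ψ n).toLp _, fun π => by
    have h := (memLp_core ψ n).coeFn_toLp
    refine ((measurePreserving_perm π).quasiMeasurePreserving.ae_eq_comp h).trans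
      (EventuallyEq.trans ?_ h.symm)
    exact Eventually.of_forall fun x => symmetric_core ψ n π x⟩
  map_add' ψ φ := Subtype.ext (MemLp.toLp_add (memLp_core ψ n) (memLp_core φ n))
  map_smul' c ψ := Subtype.ext (MemLp.toLp_const_smul c (memLp_core ψ n))

lemma coreComponent_ae (ψ : coreSpace) (n : ℕ) :
    ((coreComponent n ψ : Lp ℂ 2 (confMeasure n)) : (Fin n → Photon) → ℂ) =ᵐ[confMeasure n] ψ.1 n :=
  (memLp_core ψ n).coeFn_toLp

/-- The embedding of the core into Fock space. -/
def coreEmb : coreSpace →ₗ[ℂ] Fock where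
  toFun ψ := ⟨fun n => coreComponent n ψ, by
    obtain ⟨N, hN⟩ := ψ.2.2.2.1
    refine memℓp_gen (summable_of_ne_finset_zero (s := Finset.range N) fun n hn => ?_)
    have : coreComponent n ψ = 0 := by
      refine Subtype.ext (Lp.ext ((coreComponent_ae ψ n).trans ?_))
      rw [hN n (by simpa using hn)]
      exact (Lp.coeFn_zero ℂ 2 (confMeasure n)).symm
    rw [this]; simp⟩
  map_add' ψ φ := by ext1; funext n; exact map_add (coreComponent n) ψ φ
  map_smul' c ψ := by ext1; funext n; exact map_smul (coreComponent n) c ψ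

lemma coreEmb_ae (ψ : coreSpace) (n : ℕ) :
    ((coreEmb ψ n : Lp ℂ 2 (confMeasure n)) : (Fin n → Photon) → ℂ) =ᵐ[confMeasure n] ψ.1 n :=
  coreComponent_ae ψ n

lemma inner_Fock_eq_tsum (x y : Fock) : inner ℂ x y = ∑' n, ∫ z,
    starRingEnd ℂ ((x n : Lp ℂ 2 (confMeasure n)) z) * (y n : Lp ℂ 2 (confMeasure n)) z
      ∂confMeasure n := by
  rw [lp.inner_eq_tsum]
  refine tsum_congr fun n => ?_
  rw [Submodule.coe_inner, L2.inner_def]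
  refine integral_congr_ae (Eventually.of_forall fun z => ?_)
  simp [mul_comm]

lemma inner_coreEmb_left (ψ : coreSpace) (y : Fock) : inner ℂ (coreEmb ψ) y = ∑' n, ∫ z,
    starRingEnd ℂ (ψ.1 n z) * (y n : Lp ℂ 2 (confMeasure n)) z ∂confMeasure n := by
  rw [inner_Fock_eq_tsum]
  refine tsum_congr fun n => integral_congr_ae ?_
  filter_upwards [coreEmb_ae ψ n] with z hz
  rw [hz]

lemma norm_coreEmb_apply (ψ : coreSpace) (n : ℕ) :
    ENNReal.ofReal (‖coreEmb ψ n‖ ^ 2) = ∫⁻ z, ‖ψ.1 n z‖ₑ ^ 2 ∂confMeasure n := by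
  have h1 : ‖coreEmb ψ n‖ = (eLpNorm (ψ.1 n) 2 (confMeasure n)).toReal :=
    Lp.norm_toLp _ (memLp_core ψ n)
  rw [h1, ENNReal.ofReal_pow ENNReal.toReal_nonneg, ENNReal.ofReal_toReal (memLp_core ψ n).2.ne,
    eLpNorm_eq_lintegral_rpow_enorm_toReal (by norm_num) (by norm_num), ← ENNReal.rpow_natCast,
    ← ENNReal.rpow_mul]
  simp

lemma ofReal_norm_sq_coreEmb (ψ : coreSpace) :
    ENNReal.ofReal (‖coreEmb ψ‖ ^ 2) = ∑' n, ∫⁻ z, ‖ψ.1 n z‖ₑ ^ 2 ∂confMeasure n := by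
  have hs : HasSum (fun n => ‖coreEmb ψ n‖ ^ 2) (‖coreEmb ψ‖ ^ 2) := by
    have := lp.hasSum_norm (p := 2) (by norm_num) (coreEmb ψ)
    simpa using this
  rw [← hs.tsum_eq, ENNReal.ofReal_tsum_of_nonneg (fun n => sq_nonneg _) hs.summable]
  exact tsum_congr fun n => norm_coreEmb_apply ψ n

/-- Families of symmetric measurable real functions that are bounded on bounded momenta. -/
structure IsMultiplier (F : ∀ n, (Fin n → Photon) → ℝ) : Prop where
  measurable : ∀ n, Measurable (F n)
  symmetric : ∀ n (π : Equiv.Perm (Fin n)) x, F n (fun i => x (π i)) = F n x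
  bounded : ∀ R n, ∃ C, 0 ≤ C ∧ ∀ x : Fin n → Photon, (∀ i, ‖(x i).2‖ ≤ R) → |F n x| ≤ C

/-- Multiplication by `F` on the core. -/
def multOp (F : ∀ n, (Fin n → Photon) → ℝ) (hF : IsMultiplier F) : coreSpace →ₗ[ℂ] coreSpace where
  toFun ψ := ⟨fun n x => (F n x : ℂ) * ψ.1 n x, by
    refine ⟨fun n => (Complex.measurable_ofReal.comp (hF.measurable n)).mul (measurable_core ψ n),
      fun n π x => ?_, ?_, ?_⟩
    · simp only [hF.symmetric n π x, symmetric_core ψ n π x]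
    · obtain ⟨N, hN⟩ := ψ.2.2.2.1
      exact ⟨N, fun n hn => by funext x; simp [hN n hn]⟩
    · obtain ⟨R, hR⟩ := ψ.2.2.2.2
      refine ⟨R, fun n => ?_⟩
      obtain ⟨C, hC, h⟩ := hR n
      obtain ⟨M, hM, hb⟩ := hF.bounded R n
      refine ⟨M * C, by positivity, fun x => ?_⟩
      by_cases hx : ∀ i, ‖(x i).2‖ ≤ R
      · rw [norm_mul, Complex.norm_real, Real.norm_eq_abs, mul_assoc]
        exact mul_le_mul (hb x hx) (h x) (norm_nonneg _) hM
      · push Not at hx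
        obtain ⟨i, hi⟩ := hx
        have h0 : ∏ i, envelope R (x i) = 0 :=
          Finset.prod_eq_zero (Finset.mem_univ i) (envelope_eq_zero (not_le.2 hi))
        have h1 := h x
        rw [h0, mul_zero, norm_le_zero_iff] at h1
        simp [h0, h1]⟩
  map_add' ψ φ := by
    refine Subtype.ext ?_; funext n x; exact mul_add _ _ _
  map_smul' c ψ := by
    refine Subtype.ext ?_; funext n x; exact mul_left_comm _ _ _

@[simp] lemma multOp_apply (F : ∀ n, (Fin n → Photon) → ℝ) (hF : IsMultiplier F) (ψ : coreSpace)
    (n : ℕ) (x) : (multOp F hF ψ).1 n x = (F n x : ℂ) * ψ.1 n x := rfl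

lemma coreSpace_ext {ψ φ : coreSpace} (h : ∀ n x, ψ.1 n x = φ.1 n x) : ψ = φ :=
  Subtype.ext (funext fun n => funext fun x => h n x)

lemma inner_coreEmb_multOp (F : ∀ n, (Fin n → Photon) → ℝ) (hF : IsMultiplier F)
    (ψ φ : coreSpace) : inner ℂ (coreEmb (multOp F hF ψ)) (coreEmb φ) =
      inner ℂ (coreEmb ψ) (coreEmb (multOp F hF φ)) := by
  rw [inner_coreEmb_left, inner_coreEmb_left]
  refine tsum_congr fun n => integral_congr_ae ?_
  filter_upwards [coreEmb_ae φ n, coreEmb_ae (multOp F hF φ) n] with z h1 h2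
  rw [h1, h2, multOp_apply, multOp_apply, map_mul, Complex.conj_ofReal]
  ring

/-- A core vector with a single nonzero component. -/
def singleCore (n : ℕ) (w : (Fin n → Photon) → ℂ) (hw : Measurable w)
    (hsym : ∀ (π : Equiv.Perm (Fin n)) x, w (fun i => x (π i)) = w x)
    (hb : ∃ R C, 0 ≤ C ∧ ∀ x, ‖w x‖ ≤ C * ∏ i, envelope R (x i)) : coreSpace :=
  ⟨Pi.single n w, by
    refine ⟨fun k => ?_, fun k π x => ?_, ⟨n + 1, fun k hk => ?_⟩, ?_⟩
    · by_cases h : k = n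
      · subst h; rwa [Pi.single_eq_same]
      · rw [Pi.single_eq_of_ne h]; exact measurable_const
    · by_cases h : k = n
      · subst h; rw [Pi.single_eq_same, hsym]
      · rw [Pi.single_eq_of_ne h]; rfl
    · rw [Pi.single_eq_of_ne (by omega)]
    · obtain ⟨R, C, hC, h⟩ := hb
      refine ⟨R, fun k => ?_⟩
      by_cases hk : k = n
      · subst hk; exact ⟨C, hC, by rwa [Pi.single_eq_same]⟩
      · exact ⟨0, le_rfl, fun x => by rw [Pi.single_eq_of_ne hk]; simp⟩⟩

/-- An almost everywhere symmetric function orthogonal to the core vanishes. -/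
lemma ae_eq_zero_of_orthogonal_core {n : ℕ} {u : (Fin n → Photon) → ℂ}
    (hu : AEStronglyMeasurable u (confMeasure n))
    (hsym : ∀ π : Equiv.Perm (Fin n), (fun x => u fun i => x (π i)) =ᵐ[confMeasure n] u)
    (h : ∀ φ : coreSpace, (∀ k, k ≠ n → φ.1 k = 0) →
      ∫ x, starRingEnd ℂ (φ.1 n x) * u x ∂confMeasure n = 0) : u =ᵐ[confMeasure n] 0 := by
  set v := hu.mk u
  -- Core vectors are symmetric at every point, while `u` is so only almost everywhere; averaging a
  -- measurable version over permutations repairs this.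
  let w : (Fin n → Photon) → ℂ := fun x =>
    (Fintype.card (Equiv.Perm (Fin n)) : ℂ)⁻¹ * ∑ π : Equiv.Perm (Fin n), v fun i => x (π i)
  have hv : Measurable v := hu.stronglyMeasurable_mk.measurable
  have hw : Measurable w := by
    refine measurable_const.mul (Finset.measurable_sum _ fun π _ => hv.comp ?_)
    exact measurable_pi_lambda _ fun i => measurable_pi_apply _
  have hwsym : ∀ (π : Equiv.Perm (Fin n)) x, w (fun i => x (π i)) = w x := by
    intro π x
    simp only [w]
    congr 1
    exact Fintype.sum_equiv (Equiv.mulLeft π) _ _ fun σ => rfl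
  have hwu : w =ᵐ[confMeasure n] u := by
    have h1 : ∀ π : Equiv.Perm (Fin n),
        (fun x => v fun i => x (π i)) =ᵐ[confMeasure n] u := fun π =>
      ((measurePreserving_perm π).quasiMeasurePreserving.ae_eq_comp hu.ae_eq_mk.symm).trans (hsym π)
    filter_upwards [ae_all_iff.2 h1] with x hx
    have hc : (Fintype.card (Equiv.Perm (Fin n)) : ℂ) ≠ 0 := by
      exact_mod_cast Fintype.card_ne_zero
    simp only [w, hx, Finset.sum_const, Finset.card_univ, nsmul_eq_mul]
    rw [inv_mul_cancel_left₀ hc]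
  -- Truncation to `Q R` makes `w` a core vector, and testing `u` against it yields the integral of
  -- |w|² over `Q R`. These symmetric sets exhaust the configuration space.
  let Q : ℕ → Set (Fin n → Photon) := fun R => {x | ‖w x‖ ≤ R ∧ ∀ i, ‖(x i).2‖ ≤ R}
  have hQ : ∀ R, MeasurableSet (Q R) := by
    intro R
    have : Q R = {x | ‖w x‖ ≤ R} ∩ ⋂ i, {x | ‖(x i).2‖ ≤ R} := by ext x; simp [Q]
    rw [this]
    refine (measurableSet_le hw.norm measurable_const).inter (MeasurableSet.iInter fun i => ?_)
    exact measurableSet_le (by fun_prop) measurable_const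
  have hQsym : ∀ R (π : Equiv.Perm (Fin n)) x, (fun i => x (π i)) ∈ Q R ↔ x ∈ Q R := by
    intro R π x
    simp only [Q, Set.mem_ofPred_eq, hwsym π x]
    exact and_congr_right fun _ => π.forall_congr_left.trans (by simp)
  have hbound : ∀ R : ℕ, ∀ x, ‖(Q R).indicator w x‖ ≤ R * ∏ i, envelope R (x i) := by
    intro R x
    by_cases hx : x ∈ Q R
    · rw [Set.indicator_of_mem hx]
      have : (1 : ℝ) ≤ ∏ i, envelope R (x i) :=
        Finset.prod_induction _ (1 ≤ ·) (fun _ _ => one_le_mul_of_one_le_of_one_le) le_rfl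
          fun i _ => one_le_envelope (hx.2 i)
      nlinarith [hx.1, norm_nonneg (w x)]
    · rw [Set.indicator_of_notMem hx, norm_zero]
      exact mul_nonneg (Nat.cast_nonneg _) (Finset.prod_nonneg fun i _ => envelope_nonneg _ _)
  have key : ∀ R : ℕ, ∀ᵐ x ∂confMeasure n, x ∈ Q R → w x = 0 := by
    intro R
    let φ := singleCore n ((Q R).indicator w) (hw.indicator (hQ R))
      (fun π x => by
        by_cases hx : x ∈ Q R
        · rw [Set.indicator_of_mem hx, Set.indicator_of_mem ((hQsym R π x).2 hx), hwsym]
        · rw [Set.indicator_of_notMem hx, Set.indicator_of_notMem (mt (hQsym R π x).1 hx)])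
      ⟨R, R, Nat.cast_nonneg _, hbound R⟩
    have hφ : φ.1 n = (Q R).indicator w := Pi.single_eq_same _ _
    have h1 := h φ fun k hk => Pi.single_eq_of_ne hk _
    rw [hφ] at h1
    have h2 : ∫ x, starRingEnd ℂ ((Q R).indicator w x) * u x ∂confMeasure n =
        ((∫ x, ‖(Q R).indicator w x‖ ^ 2 ∂confMeasure n : ℝ) : ℂ) := by
      rw [← integral_complex_ofReal]
      refine integral_congr_ae ?_
      filter_upwards [hwu] with x hx
      rw [← hx]
      by_cases hxQ : x ∈ Q R
      · rw [Set.indicator_of_mem hxQ, ← Complex.normSq_eq_conj_mul_self, Complex.normSq_eq_norm_sq]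
      · simp [Set.indicator_of_notMem hxQ]
    rw [h2] at h1
    have h3 := Complex.ofReal_eq_zero.1 h1
    have hi : Integrable (fun x => ‖(Q R).indicator w x‖ ^ 2) (confMeasure n) :=
      (memLp_two_iff_integrable_sq_norm (hw.indicator (hQ R)).aestronglyMeasurable).1
        (memLp_of_le_prod_envelope (hw.indicator (hQ R)) (hbound R))
    rw [integral_eq_zero_iff_of_nonneg (fun x => sq_nonneg _) hi] at h3
    filter_upwards [h3] with x hx hxQ
    simpa [Set.indicator_of_mem hxQ] using hx
  refine hwu.symm.trans ?_
  filter_upwards [ae_all_iff.2 key] with x hx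
  obtain ⟨R, hR⟩ := exists_nat_ge (‖w x‖ + ∑ i, ‖(x i).2‖)
  have hs : 0 ≤ ∑ i, ‖(x i).2‖ := Finset.sum_nonneg fun i _ => norm_nonneg _
  refine hx R ⟨by linarith, fun i => ?_⟩
  have := Finset.single_le_sum (f := fun i => ‖(x i).2‖) (fun i _ => norm_nonneg _)
    (Finset.mem_univ i)
  linarith [norm_nonneg (w x)]

lemma inner_coreEmb_of_single {n : ℕ} {φ : coreSpace} (hφ : ∀ k, k ≠ n → φ.1 k = 0) (y : Fock) :
    inner ℂ (coreEmb φ) y =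
      ∫ z, starRingEnd ℂ (φ.1 n z) * (y n : Lp ℂ 2 (confMeasure n)) z ∂confMeasure n := by
  rw [inner_coreEmb_left, tsum_eq_single n]
  intro k hk
  simp [hφ k hk]

/-- Testing with core vectors supported in one photon sector shows that a vector orthogonal to the
core vanishes in each sector. -/
lemma denseRange_coreEmb : DenseRange coreEmb := by
  have h : (LinearMap.range coreEmb).topologicalClosure = ⊤ := by
    rw [Submodule.topologicalClosure_eq_top_iff, Submodule.eq_bot_iff]
    intro y hy
    rw [Submodule.mem_orthogonal] at hy
    ext1
    funext n
    refine Subtype.ext (Lp.ext ?_)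
    refine EventuallyEq.trans ?_ (Lp.coeFn_zero ℂ 2 (confMeasure n)).symm
    refine ae_eq_zero_of_orthogonal_core (Lp.aestronglyMeasurable _) (y n).2 fun φ hφ => ?_
    rw [← inner_coreEmb_of_single hφ]
    exact hy _ ⟨φ, rfl⟩
  exact Submodule.dense_iff_topologicalClosure_eq_top.2 h

/-- Measurable one-photon functions that are bounded on bounded momenta. -/
structure IsSymbol (w : Photon → ℝ) : Prop where
  measurable : Measurable w
  bounded : ∀ R, ∃ C, 0 ≤ C ∧ ∀ k : Photon, ‖k.2‖ ≤ R → |w k| ≤ C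

lemma IsSymbol.isMultiplier {w : Photon → ℝ} (hw : IsSymbol w) :
    IsMultiplier fun _ x => ∑ i, w (x i) where
  measurable n := Finset.measurable_sum _ fun i _ => hw.measurable.comp (measurable_pi_apply i)
  symmetric n π x := Equiv.sum_comp π fun i => w (x i)
  bounded R n := by
    obtain ⟨C, hC, h⟩ := hw.bounded R
    refine ⟨n * C, by positivity, fun x hx => (Finset.abs_sum_le_sum_abs _ _).trans ?_⟩
    refine (Finset.sum_le_sum fun i _ => h (x i) (hx i)).trans ?_
    simp

/-- The second quantization of `w` on the core. -/
def dG {w : Photon → ℝ} (hw : IsSymbol w) : coreSpace →ₗ[ℂ] coreSpace := multOp _ hw.isMultiplier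

lemma dG_apply {w : Photon → ℝ} (hw : IsSymbol w) (ψ : coreSpace) (n : ℕ) (x) :
    (dG hw ψ).1 n x = ((∑ i, w (x i) : ℝ) : ℂ) * ψ.1 n x := rfl

lemma coreEmb_mem_dGammaGraph {w : Photon → ℝ} (hw : IsSymbol w) (ψ : coreSpace) :
    (coreEmb ψ, coreEmb (dG hw ψ)) ∈ dGammaGraph w := by
  intro n
  filter_upwards [coreEmb_ae ψ n, coreEmb_ae (dG hw ψ) n] with x h1 h2
  rw [h2, dG_apply]
  exact congrArg _ h1.symm

/-- Weak characterization of the graph of `dΓ(w)`. -/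
lemma mem_dGammaGraph_iff {w : Photon → ℝ} (hw : IsSymbol w) (x a : Fock) :
    (x, a) ∈ dGammaGraph w ↔
      ∀ φ : coreSpace, inner ℂ (coreEmb φ) a = inner ℂ (coreEmb (dG hw φ)) x := by
  constructor
  · intro h φ
    rw [inner_coreEmb_left, inner_coreEmb_left]
    refine tsum_congr fun n => integral_congr_ae ?_
    filter_upwards [h n] with z hz
    rw [hz, dG_apply, map_mul, Complex.conj_ofReal]
    ring
  · intro h n
    let W : (Fin n → Photon) → ℂ := fun z => ((∑ i, w (z i) : ℝ) : ℂ)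
    have hW : Measurable W := Complex.measurable_ofReal.comp (hw.isMultiplier.measurable n)
    have hWsym : ∀ (π : Equiv.Perm (Fin n)) z, W (fun i => z (π i)) = W z := fun π z =>
      congrArg Complex.ofReal (hw.isMultiplier.symmetric n π z)
    have key := ae_eq_zero_of_orthogonal_core (n := n)
      (u := fun z => (a n : Lp ℂ 2 (confMeasure n)) z - W z * (x n : Lp ℂ 2 (confMeasure n)) z)
      ((Lp.aestronglyMeasurable _).sub
        (hW.aestronglyMeasurable.mul (Lp.aestronglyMeasurable _))) (fun π => ?_) fun φ hφ => ?_
    · filter_upwards [key] with z hz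
      exact sub_eq_zero.1 hz
    · filter_upwards [(a n).2 π, (x n).2 π] with z h1 h2
      rw [h1, h2, hWsym]
    · have hφ' : ∀ k, k ≠ n → (dG hw φ).1 k = 0 := fun k hk => by
        funext z; rw [dG_apply, hφ k hk]; simp
      have h1 := h φ
      rw [inner_coreEmb_of_single hφ, inner_coreEmb_of_single hφ'] at h1
      have i1 : Integrable (fun z => starRingEnd ℂ (φ.1 n z) * (a n : Lp ℂ 2 (confMeasure n)) z)
          (confMeasure n) := (memLp_core φ n).star.integrable_mul (Lp.memLp _)
      have i2 : Integrable (fun z => starRingEnd ℂ ((dG hw φ).1 n z) *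
          (x n : Lp ℂ 2 (confMeasure n)) z) (confMeasure n) :=
        (memLp_core (dG hw φ) n).star.integrable_mul (Lp.memLp _)
      rw [← sub_eq_zero, ← integral_sub i1 i2] at h1
      rw [← h1]
      refine integral_congr_ae (Eventually.of_forall fun z => ?_)
      simp only [dG_apply, map_mul, Complex.conj_ofReal, W]
      ring

/-- The weak characterization presents the graph as an intersection of closed conditions, one for
each core vector. Closedness lets graph relations extend from the core by density. -/
lemma isClosed_dGammaGraph {w : Photon → ℝ} (hw : IsSymbol w) :
    IsClosed (dGammaGraph w : Set (Fock × Fock)) := by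
  have : (dGammaGraph w : Set (Fock × Fock)) = ⋂ φ : coreSpace,
      {p | inner ℂ (coreEmb φ) p.2 = inner ℂ (coreEmb (dG hw φ)) p.1} := by
    ext ⟨x, a⟩
    simp only [SetLike.mem_coe, Set.mem_iInter, Set.mem_ofPred_eq]
    exact mem_dGammaGraph_iff hw x a
  rw [this]
  exact isClosed_iInter fun φ => isClosed_eq (by fun_prop) (by fun_prop)

/-! ### Creation and annihilation operators on the core -/

/-- Insert the photon `y` at position `i`. -/
def ins {n : ℕ} (i : Fin (n + 1)) (y : Photon) (x : Fin n → Photon) : Fin (n + 1) → Photon :=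
  (MeasurableEquiv.piFinSuccAbove (fun _ : Fin (n + 1) => Photon) i).symm (y, x)

@[simp] lemma ins_same {n : ℕ} (i : Fin (n + 1)) (y : Photon) (x : Fin n → Photon) :
    ins i y x i = y :=
  Fin.insertNth_apply_same (α := fun _ => Photon) i y x

@[simp] lemma ins_succAbove {n : ℕ} (i : Fin (n + 1)) (y : Photon) (x : Fin n → Photon)
    (j : Fin n) : ins i y x (i.succAbove j) = x j :=
  Fin.insertNth_apply_succAbove (α := fun _ => Photon) i y x j

lemma eq_ins {n : ℕ} (i : Fin (n + 1)) {y : Photon} {x : Fin n → Photon}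
    {z : Fin (n + 1) → Photon} (h0 : z i = y) (h1 : ∀ j, z (i.succAbove j) = x j) :
    z = ins i y x := by
  funext k
  rcases Fin.eq_self_or_eq_succAbove i k with rfl | ⟨j, rfl⟩
  · rw [h0, ins_same]
  · rw [h1, ins_succAbove]

lemma measurable_ins {n : ℕ} (i : Fin (n + 1)) :
    Measurable fun p : Photon × (Fin n → Photon) => ins i p.1 p.2 :=
  (MeasurableEquiv.piFinSuccAbove (fun _ : Fin (n + 1) => Photon) i).symm.measurable

lemma measurePreserving_ins {n : ℕ} (i : Fin (n + 1)) :
    MeasurePreserving (fun p : Photon × (Fin n → Photon) => ins i p.1 p.2)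
      (photonMeasure.prod (confMeasure n)) (confMeasure (n + 1)) :=
  (measurePreserving_piFinSuccAbove (fun _ : Fin (n + 1) => photonMeasure) i).symm

lemma measurableEmbedding_ins {n : ℕ} (i : Fin (n + 1)) :
    MeasurableEmbedding fun p : Photon × (Fin n → Photon) => ins i p.1 p.2 :=
  (MeasurableEquiv.piFinSuccAbove (fun _ : Fin (n + 1) => Photon) i).symm.measurableEmbedding

lemma ins_eq_ins_zero_perm {n : ℕ} (i : Fin (n + 1)) (y : Photon) (x : Fin n → Photon) :
    ins i y x = fun j => ins 0 y x (i.cycleRange j) := by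
  refine (eq_ins i (by simp) fun j => ?_).symm
  rw [Fin.cycleRange_succAbove, ← Fin.succAbove_zero_apply, ins_succAbove]

lemma core_ins (ψ : coreSpace) {n : ℕ} (i : Fin (n + 1)) (y : Photon) (x : Fin n → Photon) :
    ψ.1 (n + 1) (ins i y x) = ψ.1 (n + 1) (ins 0 y x) := by
  rw [ins_eq_ins_zero_perm, symmetric_core ψ (n + 1) i.cycleRange]

lemma core_ins_perm (ψ : coreSpace) {n : ℕ} (π : Equiv.Perm (Fin n)) (y : Photon)
    (x : Fin n → Photon) :
    ψ.1 (n + 1) (ins 0 y fun i => x (π i)) = ψ.1 (n + 1) (ins 0 y x) := by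
  have h : ins 0 y (fun i => x (π i)) =
      fun j => ins 0 y x (Equiv.Perm.decomposeFin.symm (0, π) j) := by
    refine (eq_ins 0 ?_ fun j => ?_).symm
    · simp
    · rw [Fin.succAbove_zero_apply, Equiv.Perm.decomposeFin_symm_apply_succ, Equiv.swap_self,
        Equiv.refl_apply, ← Fin.succAbove_zero_apply, ins_succAbove]
  rw [h, symmetric_core ψ (n + 1) (Equiv.Perm.decomposeFin.symm (0, π)) (ins 0 y x)]

lemma prod_ins {n : ℕ} (g : Photon → ℝ) (y : Photon) (x : Fin n → Photon) :
    ∏ i, g (ins 0 y x i) = g y * ∏ i, g (x i) := by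
  rw [Fin.prod_univ_succAbove _ 0]; simp only [ins_same, ins_succAbove]

lemma sum_ins {n : ℕ} (g : Photon → ℝ) (y : Photon) (x : Fin n → Photon) :
    ∑ i, g (ins 0 y x i) = g y + ∑ i, g (x i) := by
  rw [Fin.sum_univ_succAbove _ 0]; simp only [ins_same, ins_succAbove]

/-- The form factors considered here: measurable, dominated by an envelope, zero at `k = 0`. -/
structure IsFormFactor (f : Photon → ℂ) : Prop where
  measurable : Measurable f
  bounded : ∃ R C, 0 ≤ C ∧ ∀ k, ‖f k‖ ≤ C * envelope R k
  -- A dispersion w may vanish at k = 0, where its inverse has the default value 0; with f = 0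
  -- there, the pointwise estimates that insert 1/w hold at every point.
  zero : ∀ k : Photon, k.2 = 0 → f k = 0

/-- A permutation maps the complement of i onto the complement of π i. Relabelling both complements
by `Fin n` gives σ, which is what the symmetry of the created function needs. -/
lemma exists_perm_succAbove {n : ℕ} (π : Equiv.Perm (Fin (n + 1))) (i : Fin (n + 1)) :
    ∃ σ : Equiv.Perm (Fin n), ∀ j, π (i.succAbove j) = (π i).succAbove (σ j) := by
  have h : ∀ j, ∃ k, (π i).succAbove k = π (i.succAbove j) := fun j =>
    Fin.exists_succAbove_eq fun h => Fin.succAbove_ne i j (π.injective h)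
  choose σ hσ using h
  refine ⟨Equiv.ofBijective σ (Finite.injective_iff_bijective.1 fun a b hab => ?_), fun j => ?_⟩
  · have : π (i.succAbove a) = π (i.succAbove b) := by rw [← hσ, ← hσ, hab]
    exact Fin.succAbove_right_injective (π.injective this)
  · exact (hσ j).symm

lemma core_bound (ψ : coreSpace) (n : ℕ) : ∃ R₀, ∀ R, R₀ ≤ R → ∃ C, 0 ≤ C ∧
    ∀ x, ‖ψ.1 n x‖ ≤ C * ∏ i, envelope R (x i) := by
  obtain ⟨R₀, hR⟩ := ψ.2.2.2.2
  refine ⟨R₀, fun R h => ?_⟩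
  obtain ⟨C, hC, hb⟩ := hR n
  refine ⟨C, hC, fun x => (hb x).trans ?_⟩
  gcongr with i
  · exact fun i _ => envelope_nonneg _ _
  · exact envelope_mono h _

section

variable {f : Photon → ℂ} (hf : IsFormFactor f)

/-- The creation operator on the core. -/
def createOp : coreSpace →ₗ[ℂ] coreSpace where
  toFun ψ := ⟨fun n => match n with
      | 0 => 0
      | n + 1 => createFun f (ψ.1 n), by
    refine ⟨fun n => ?_, fun n π x => ?_, ?_, ?_⟩
    · cases n with
      | zero => exact measurable_const
      | succ n =>
        refine measurable_const.mul (Finset.measurable_sum _ fun i _ => ?_)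
        exact (hf.measurable.comp (measurable_pi_apply i)).mul ((measurable_core ψ n).comp
          (measurable_pi_lambda _ fun j => measurable_pi_apply _))
    · cases n with
      | zero => rfl
      | succ n =>
        simp only [createFun]
        congr 1
        refine Fintype.sum_equiv π _ _ fun i => ?_
        obtain ⟨σ, hσ⟩ := exists_perm_succAbove π i
        simp only [hσ]
        rw [symmetric_core ψ n σ fun j => x ((π i).succAbove j)]
    · obtain ⟨N, hN⟩ := ψ.2.2.2.1
      refine ⟨N + 1, fun n hn => ?_⟩
      cases n with
      | zero => omega
      | succ n => funext x; simp [createFun, hN n (by omega)]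
    · obtain ⟨R, hR⟩ := ψ.2.2.2.2
      obtain ⟨R', C', hC', hb'⟩ := hf.bounded
      refine ⟨max R R', fun n => ?_⟩
      cases n with
      | zero => exact ⟨0, le_rfl, fun x => by simp⟩
      | succ n =>
        obtain ⟨C, hC, hb⟩ := hR n
        refine ⟨(1 / Real.sqrt (n + 1)) * ((n + 1) * (C' * C)), by positivity, fun x => ?_⟩
        simp only [createFun]
        rw [norm_mul, Complex.norm_real, Real.norm_of_nonneg (by positivity), mul_assoc]
        gcongr
        refine (norm_sum_le_of_le _ (n := fun _ => C' * C *
          ∏ i, envelope (max R R') (x i)) fun i _ => ?_).trans (by simp [mul_assoc])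
        rw [norm_mul, Fin.prod_univ_succAbove _ i]
        have e1 := (hb' (x i)).trans (mul_le_mul_of_nonneg_left
          (envelope_mono (le_max_right R R') (x i)) hC')
        have e2 : ‖ψ.1 n fun j => x (i.succAbove j)‖ ≤
            C * ∏ j, envelope (max R R') (x (i.succAbove j)) := by
          refine (hb _).trans (mul_le_mul_of_nonneg_left ?_ hC)
          exact Finset.prod_le_prod (fun j _ => envelope_nonneg _ _)
            fun j _ => envelope_mono (le_max_left _ _) _
        refine (mul_le_mul e1 e2 (norm_nonneg _)
          (mul_nonneg hC' (envelope_nonneg _ _))).trans (le_of_eq ?_)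
        ring⟩
  map_add' ψ φ := by
    refine Subtype.ext (funext fun n => ?_)
    cases n with
    | zero => exact (add_zero _).symm
    | succ n =>
      funext x
      change createFun f (ψ.1 n + φ.1 n) x = createFun f (ψ.1 n) x + createFun f (φ.1 n) x
      simp only [createFun, Pi.add_apply, mul_add, Finset.sum_add_distrib]
  map_smul' c ψ := by
    refine Subtype.ext (funext fun n => ?_)
    cases n with
    | zero => exact funext fun x => (mul_zero c).symm
    | succ n =>
      funext x
      change createFun f (c • ψ.1 n) x = c * createFun f (ψ.1 n) x
      simp only [createFun, Pi.smul_apply, smul_eq_mul, Finset.mul_sum]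
      exact Finset.sum_congr rfl fun i _ => by ring

lemma createOp_zero (ψ : coreSpace) : (createOp hf ψ).1 0 = 0 := rfl

lemma createOp_succ (ψ : coreSpace) (n : ℕ) : (createOp hf ψ).1 (n + 1) = createFun f (ψ.1 n) := rfl

include hf in
lemma annih_bound (ψ : coreSpace) (n : ℕ) : ∃ R C, 0 ≤ C ∧ (∀ y x,
    ‖starRingEnd ℂ (f y) * ψ.1 (n + 1) (ins 0 y x)‖ ≤
      C * envelope R y ^ 2 * ∏ i, envelope R (x i)) := by
  obtain ⟨R', C', hC', hb'⟩ := hf.bounded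
  obtain ⟨R₀, h⟩ := core_bound ψ (n + 1)
  obtain ⟨C, hC, hb⟩ := h (max R₀ R') (le_max_left _ _)
  refine ⟨max R₀ R', C' * C, by positivity, fun y x => ?_⟩
  rw [norm_mul, RCLike.norm_conj]
  have e1 := (hb' y).trans (mul_le_mul_of_nonneg_left (envelope_mono (le_max_right R₀ R') y) hC')
  have e2 := hb (ins 0 y x)
  rw [prod_ins] at e2
  refine (mul_le_mul e1 e2 (norm_nonneg _)
    (mul_nonneg hC' (envelope_nonneg _ _))).trans (le_of_eq ?_)
  ring

include hf in
lemma measurable_annih_integrand (ψ : coreSpace) (n : ℕ) :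
    Measurable fun p : Photon × (Fin n → Photon) =>
      starRingEnd ℂ (f p.1) * ψ.1 (n + 1) (ins 0 p.1 p.2) :=
  (Complex.continuous_conj.measurable.comp (hf.measurable.comp measurable_fst)).mul
    ((measurable_core ψ (n + 1)).comp (measurable_ins 0))

include hf in
lemma integrable_annih (ψ : coreSpace) (n : ℕ) (x : Fin n → Photon) :
    Integrable (fun y => starRingEnd ℂ (f y) * ψ.1 (n + 1) (ins 0 y x)) photonMeasure := by
  obtain ⟨R, C, -, h⟩ := annih_bound hf ψ n
  refine (((integrable_envelope_sq R).const_mul C).mul_const (∏ i, envelope R (x i))).mono'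
    ?_ (Eventually.of_forall fun y => h y x)
  exact ((measurable_annih_integrand hf ψ n).comp measurable_prodMk_right).aestronglyMeasurable

/-- The annihilation operator on the core. -/
def annihOp : coreSpace →ₗ[ℂ] coreSpace where
  toFun ψ := ⟨fun n x => ((Real.sqrt (n + 1) : ℝ) : ℂ) *
      ∫ y, starRingEnd ℂ (f y) * ψ.1 (n + 1) (ins 0 y x) ∂photonMeasure, by
    refine ⟨fun n => ?_, fun n π x => ?_, ?_, ?_⟩
    · refine measurable_const.mul ?_
      exact (StronglyMeasurable.integral_prod_right' (ν := photonMeasure)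
        ((measurable_annih_integrand hf ψ n).comp measurable_swap).stronglyMeasurable).measurable
    · simp only [core_ins_perm]
    · obtain ⟨N, hN⟩ := ψ.2.2.2.1
      refine ⟨N, fun n hn => ?_⟩
      funext x
      simp [hN (n + 1) (by omega)]
    · obtain ⟨R', C', hC', hb'⟩ := hf.bounded
      obtain ⟨R, hR⟩ := ψ.2.2.2.2
      refine ⟨max R R', fun n => ?_⟩
      obtain ⟨C, hC, hb⟩ := hR (n + 1)
      refine ⟨Real.sqrt (n + 1) * (C' * C * ∫ y, envelope (max R R') y ^ 2 ∂photonMeasure), ?_,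
        fun x => ?_⟩
      · have : 0 ≤ ∫ y, envelope (max R R') y ^ 2 ∂photonMeasure :=
          integral_nonneg fun _ => sq_nonneg _
        positivity
      · rw [norm_mul, Complex.norm_real, Real.norm_of_nonneg (Real.sqrt_nonneg _), mul_assoc]
        gcongr
        rw [← integral_const_mul, ← integral_mul_const]
        refine norm_integral_le_of_norm_le
          (((integrable_envelope_sq _).const_mul _).mul_const _) (Eventually.of_forall fun y => ?_)
        rw [norm_mul, RCLike.norm_conj]
        have e1 := (hb' y).trans (mul_le_mul_of_nonneg_left
          (envelope_mono (le_max_right R R') y) hC')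
        have e2 := hb (ins 0 y x)
        rw [prod_ins] at e2
        have e3 : envelope R y * ∏ i, envelope R (x i) ≤
            envelope (max R R') y * ∏ i, envelope (max R R') (x i) :=
          mul_le_mul (envelope_mono (le_max_left _ _) _)
            (Finset.prod_le_prod (fun j _ => envelope_nonneg _ _)
              fun j _ => envelope_mono (le_max_left _ _) _)
            (Finset.prod_nonneg fun j _ => envelope_nonneg _ _) (envelope_nonneg _ _)
        refine (mul_le_mul e1 (e2.trans (mul_le_mul_of_nonneg_left e3 hC)) (norm_nonneg _)
          (mul_nonneg hC' (envelope_nonneg _ _))).trans (le_of_eq ?_)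
        ring⟩
  map_add' ψ φ := by
    refine coreSpace_ext fun n x => ?_
    change _ * ∫ y, starRingEnd ℂ (f y) * (ψ.1 (n + 1) (ins 0 y x) + φ.1 (n + 1) (ins 0 y x))
      ∂photonMeasure = _ * _ + _ * _
    simp only [mul_add]
    rw [integral_add (integrable_annih hf ψ n x) (integrable_annih hf φ n x), mul_add]
  map_smul' c ψ := by
    refine coreSpace_ext fun n x => ?_
    change _ * ∫ y, starRingEnd ℂ (f y) * (c * ψ.1 (n + 1) (ins 0 y x)) ∂photonMeasure = c * (_ * _)
    simp only [mul_left_comm _ c]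
    rw [integral_const_mul, mul_left_comm]

lemma annihOp_apply (ψ : coreSpace) (n : ℕ) (x) : (annihOp hf ψ).1 n x =
    ((Real.sqrt (n + 1) : ℝ) : ℂ) *
      ∫ y, starRingEnd ℂ (f y) * ψ.1 (n + 1) (ins 0 y x) ∂photonMeasure := rfl

end

section

variable {f : Photon → ℂ} (hf : IsFormFactor f)

lemma coreEmb_mem_createGraph (ψ : coreSpace) :
    (coreEmb ψ, coreEmb (createOp hf ψ)) ∈ createGraph f := by
  refine ⟨Subtype.ext (Lp.ext ?_), fun n => ?_⟩
  · exact (coreEmb_ae (createOp hf ψ) 0).trans (Lp.coeFn_zero ℂ 2 (confMeasure 0)).symm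
  · exact (coreEmb_ae (createOp hf ψ) (n + 1)).trans (createFun_congr f (coreEmb_ae ψ n)).symm

include hf in
lemma integrable_annih_pairing (φ : coreSpace) (n : ℕ) (χ : Lp ℂ 2 (confMeasure n)) :
    Integrable (fun p : Photon × (Fin n → Photon) =>
      starRingEnd ℂ (φ.1 (n + 1) (ins 0 p.1 p.2)) * (f p.1 * χ p.2))
      (photonMeasure.prod (confMeasure n)) := by
  obtain ⟨R, C, hC, h⟩ := annih_bound hf φ n
  have h1 : Integrable (fun x : Fin n → Photon => (∏ i, envelope R (x i)) * ‖χ x‖)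
      (confMeasure n) := by
    refine MemLp.integrable_mul (p := 2) (q := 2) ?_ (Lp.memLp χ).norm
    have hm : Measurable fun x : Fin n → Photon => ∏ i, envelope R (x i) :=
      Finset.measurable_prod _ fun i _ => (measurable_envelope R).comp (measurable_pi_apply i)
    rw [memLp_two_iff_integrable_sq hm.aestronglyMeasurable]
    refine integrable_of_le_prod_envelope (hm.pow_const 2) (R := R) (C := 1) fun x => ?_
    rw [abs_of_nonneg (sq_nonneg _), Finset.prod_pow, one_mul]
  have h2 := ((integrable_envelope_sq R).const_mul C).mul_prod h1
  refine h2.mono' ?_ (Eventually.of_forall fun p => ?_)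
  · refine AEStronglyMeasurable.mul ?_ (AEStronglyMeasurable.mul ?_ ?_)
    · exact (Complex.continuous_conj.measurable.comp
        ((measurable_core φ (n + 1)).comp (measurable_ins 0))).aestronglyMeasurable
    · exact (hf.measurable.comp measurable_fst).aestronglyMeasurable
    · exact (Lp.aestronglyMeasurable χ).comp_snd
  · have := h p.1 p.2
    rw [norm_mul, RCLike.norm_conj] at this ⊢
    rw [norm_mul]
    calc _ = ‖f p.1‖ * ‖φ.1 (n + 1) (ins 0 p.1 p.2)‖ * ‖χ p.2‖ := by ring
      _ ≤ C * envelope R p.1 ^ 2 * (∏ i, envelope R (p.2 i)) * ‖χ p.2‖ := by gcongr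
      _ = _ := by ring

/-- Duality between creation and annihilation on a fixed number of photons. -/
lemma integral_createFun (φ : coreSpace) (n : ℕ) (χ : Lp ℂ 2 (confMeasure n)) :
    ∫ z, starRingEnd ℂ (φ.1 (n + 1) z) * createFun f χ z ∂confMeasure (n + 1) =
      ∫ x, starRingEnd ℂ ((annihOp hf φ).1 n x) * χ x ∂confMeasure n := by
  have hint := integrable_annih_pairing hf φ n χ
  set I := ∫ p, starRingEnd ℂ (φ.1 (n + 1) (ins 0 p.1 p.2)) * (f p.1 * χ p.2)
    ∂photonMeasure.prod (confMeasure n) with hI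
  -- By symmetry of φ the inserted photon may sit at any position, so all n + 1 terms have the same
  -- integral. This turns the factor 1/√(n+1) of creation into the factor √(n+1) of annihilation.
  have hterm : ∀ i : Fin (n + 1), Integrable (fun z =>
      starRingEnd ℂ (φ.1 (n + 1) z) * (f (z i) * χ fun j => z (i.succAbove j)))
      (confMeasure (n + 1)) ∧ ∫ z,
      starRingEnd ℂ (φ.1 (n + 1) z) * (f (z i) * χ fun j => z (i.succAbove j))
      ∂confMeasure (n + 1) = I := by
    intro i
    have e : ∀ p : Photon × (Fin n → Photon),
        starRingEnd ℂ (φ.1 (n + 1) (ins i p.1 p.2)) *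
          (f (ins i p.1 p.2 i) * χ fun j => ins i p.1 p.2 (i.succAbove j)) =
        starRingEnd ℂ (φ.1 (n + 1) (ins 0 p.1 p.2)) * (f p.1 * χ p.2) := by
      intro p
      rw [core_ins, ins_same]
      simp only [ins_succAbove]
    constructor
    · rw [← (measurePreserving_ins i).integrable_comp_emb (measurableEmbedding_ins i)]
      exact hint.congr (Eventually.of_forall fun p => (e p).symm)
    · rw [← (measurePreserving_ins i).integral_comp (measurableEmbedding_ins i)]
      exact integral_congr_ae (Eventually.of_forall e)
  have hL : ∫ z, starRingEnd ℂ (φ.1 (n + 1) z) * createFun f χ z ∂confMeasure (n + 1) =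
      ((1 / Real.sqrt (n + 1) : ℝ) : ℂ) * ((n + 1) * I) := by
    have : ∀ z, starRingEnd ℂ (φ.1 (n + 1) z) * createFun f χ z =
        ((1 / Real.sqrt (n + 1) : ℝ) : ℂ) * ∑ i : Fin (n + 1),
          starRingEnd ℂ (φ.1 (n + 1) z) * (f (z i) * χ fun j => z (i.succAbove j)) := by
      intro z
      rw [createFun, mul_left_comm, Finset.mul_sum]
    simp only [this]
    rw [integral_const_mul, integral_finsetSum _ fun i _ => (hterm i).1,
      Finset.sum_congr rfl fun i _ => (hterm i).2]
    simp
  have hR : ∫ x, starRingEnd ℂ ((annihOp hf φ).1 n x) * χ x ∂confMeasure n =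
      ((Real.sqrt (n + 1) : ℝ) : ℂ) * I := by
    rw [hI, integral_prod_symm _ hint, ← integral_const_mul]
    refine integral_congr_ae (Eventually.of_forall fun x => ?_)
    simp only [annihOp_apply, map_mul, Complex.conj_ofReal]
    rw [← integral_conj, mul_assoc, ← integral_mul_const]
    congr 1
    refine integral_congr_ae (Eventually.of_forall fun y => ?_)
    simp only [map_mul, Complex.conj_conj]
    ring
  rw [hL, hR, ← mul_assoc]
  congr 1
  have hs : (0 : ℝ) < Real.sqrt (n + 1) := Real.sqrt_pos.2 (by positivity)
  have h2 : 1 / Real.sqrt (n + 1) * (n + 1) = Real.sqrt (n + 1) := by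
    rw [one_div, inv_mul_eq_div, div_eq_iff hs.ne', Real.mul_self_sqrt (by positivity)]
  exact_mod_cast congrArg Complex.ofReal h2

lemma summable_core_pairing (φ : coreSpace) (y : Fock) : Summable fun n => ∫ z,
    starRingEnd ℂ (φ.1 n z) * (y n : Lp ℂ 2 (confMeasure n)) z ∂confMeasure n := by
  obtain ⟨N, hN⟩ := φ.2.2.2.1
  refine summable_of_ne_finset_zero (s := Finset.range N) fun n hn => ?_
  simp [hN n (by simpa using hn)]

/-- `a(f)` on the core is formally adjoint to the maximal creation operator. -/
lemma inner_create {x y : Fock} (h : (x, y) ∈ createGraph f) (φ : coreSpace) :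
    inner ℂ (coreEmb φ) y = inner ℂ (coreEmb (annihOp hf φ)) x := by
  rw [inner_coreEmb_left, inner_coreEmb_left, (summable_core_pairing φ y).tsum_eq_zero_add]
  have h0 : ∫ z, starRingEnd ℂ (φ.1 0 z) * (y 0 : Lp ℂ 2 (confMeasure 0)) z ∂confMeasure 0 = 0 := by
    have h1 : y 0 = 0 := h.1
    rw [h1]
    refine integral_eq_zero_of_ae ?_
    filter_upwards [Lp.coeFn_zero ℂ 2 (confMeasure 0)] with z hz
    change starRingEnd ℂ _ * ((0 : Lp ℂ 2 (confMeasure 0)) : (Fin 0 → Photon) → ℂ) z = 0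
    rw [hz]; simp
  rw [h0, zero_add]
  refine tsum_congr fun n => ?_
  rw [← integral_createFun hf φ n]
  refine integral_congr_ae ?_
  filter_upwards [h.2 n] with z hz
  rw [hz]

lemma inner_createOp (φ ψ : coreSpace) : inner ℂ (coreEmb φ) (coreEmb (createOp hf ψ)) =
    inner ℂ (coreEmb (annihOp hf φ)) (coreEmb ψ) :=
  inner_create hf (coreEmb_mem_createGraph hf ψ) φ

lemma inner_annihOp (φ ψ : coreSpace) : inner ℂ (coreEmb φ) (coreEmb (annihOp hf ψ)) =
    inner ℂ (coreEmb (createOp hf φ)) (coreEmb ψ) := by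
  rw [← inner_conj_symm, ← inner_createOp hf, inner_conj_symm]

include hf in
-- Density of the domain is what gives `LinearPMap.adjoint` its meaning as an adjoint.
lemma dense_create_domain : Dense ((create f).domain : Set Fock) := by
  refine denseRange_coreEmb.mono ?_
  rintro _ ⟨ψ, rfl⟩
  have h := coreEmb_mem_createGraph hf ψ
  rw [← create_graph] at h
  exact LinearPMap.mem_domain_of_mem_graph h

lemma coreEmb_mem_annihilate_graph (φ : coreSpace) :
    (coreEmb φ, coreEmb (annihOp hf φ)) ∈ (annihilate f).graph := by
  have key : ∀ x : (create f).domain, inner ℂ (coreEmb (annihOp hf φ)) (x : Fock) =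
      inner ℂ (coreEmb φ) (create f x) := by
    intro x
    refine (inner_create hf ?_ φ).symm
    rw [← create_graph]
    exact LinearPMap.mem_graph _ x
  rw [LinearPMap.mem_graph_iff]
  exact ⟨⟨_, LinearPMap.mem_adjoint_domain_of_exists _ ⟨_, key⟩⟩, rfl,
    LinearPMap.adjoint_apply_eq (dense_create_domain hf) _ key⟩

lemma inner_annihilate {x y : Fock} (h : (x, y) ∈ (annihilate f).graph) (φ : coreSpace) :
    inner ℂ (coreEmb φ) y = inner ℂ (coreEmb (createOp hf φ)) x := by
  obtain ⟨x', rfl, rfl⟩ := (LinearPMap.mem_graph_iff _).1 h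
  have hg := coreEmb_mem_createGraph hf φ
  rw [← create_graph] at hg
  obtain ⟨φ', h1, h2⟩ := (LinearPMap.mem_graph_iff _).1 hg
  have := LinearPMap.adjoint_isFormalAdjoint (T := create f) (dense_create_domain hf) x' φ'
  simp only at h1 h2
  rw [h1, h2] at this
  rw [← inner_conj_symm, ← inner_conj_symm (coreEmb (createOp hf φ))]
  exact congrArg _ this

/-- The field operator on the core. -/
def fieldOp : coreSpace →ₗ[ℂ] coreSpace :=
  ((1 / Real.sqrt 2 : ℝ) : ℂ) • (annihOp hf + createOp hf)

lemma fieldOp_apply (ψ : coreSpace) : fieldOp hf ψ =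
    ((1 / Real.sqrt 2 : ℝ) : ℂ) • (annihOp hf ψ + createOp hf ψ) := rfl

lemma inner_fieldOp (φ ψ : coreSpace) : inner ℂ (coreEmb (fieldOp hf φ)) (coreEmb ψ) =
    inner ℂ (coreEmb φ) (coreEmb (fieldOp hf ψ)) := by
  rw [fieldOp_apply, fieldOp_apply, map_smul, map_smul, map_add, map_add, inner_smul_left,
    inner_smul_right, inner_add_left, inner_add_right, inner_createOp, inner_annihOp,
    Complex.conj_ofReal, add_comm]

lemma inner_field_pre {x y : Fock}
    (h : (x, y) ∈ (((1 / Real.sqrt 2 : ℝ) : ℂ) • (annihilate f + create f)).graph)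
    (φ : coreSpace) :
    inner ℂ (coreEmb φ) y = inner ℂ (coreEmb (fieldOp hf φ)) x := by
  obtain ⟨hx, rfl⟩ := exists_of_mem_graph h
  have h1 := inner_annihilate hf (LinearPMap.mem_graph (annihilate f) ⟨x, hx.1⟩) φ
  have h2 : inner ℂ (coreEmb φ) (create f ⟨x, hx.2⟩) = inner ℂ (coreEmb (annihOp hf φ)) x := by
    refine inner_create hf ?_ φ
    rw [← create_graph]
    exact LinearPMap.mem_graph _ (⟨x, hx.2⟩ : (create f).domain)
  have h3 : (((1 / Real.sqrt 2 : ℝ) : ℂ) • (annihilate f + create f)) ⟨x, hx⟩ =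
    ((1 / Real.sqrt 2 : ℝ) : ℂ) • (annihilate f ⟨x, hx.1⟩ + create f ⟨x, hx.2⟩) := rfl
  rw [h3, inner_smul_right, inner_add_right, h1, h2, fieldOp_apply, map_smul, inner_smul_left,
    map_add, inner_add_left, Complex.conj_ofReal, add_comm]

include hf in
-- The operator satisfies a weak relation against the dense core. That relation is closed and
-- single-valued, so it contains the closure of the graph and forces it to be a graph.
-- `LinearPMap.closure` would leave a non-closable operator unchanged.
lemma isClosable_field_pre :
    (((1 / Real.sqrt 2 : ℝ) : ℂ) • (annihilate f + create f)).IsClosable := by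
  set T := ((1 / Real.sqrt 2 : ℝ) : ℂ) • (annihilate f + create f) with hT
  have hclosed : IsClosed {p : Fock × Fock | ∀ φ : coreSpace,
      inner ℂ (coreEmb φ) p.2 = inner ℂ (coreEmb (fieldOp hf φ)) p.1} := by
    simp only [Set.ofPred_forall]
    exact isClosed_iInter fun φ => isClosed_eq (by fun_prop) (by fun_prop)
  have hsub : closure (T.graph : Set (Fock × Fock)) ⊆ {p : Fock × Fock | ∀ φ : coreSpace,
      inner ℂ (coreEmb φ) p.2 = inner ℂ (coreEmb (fieldOp hf φ)) p.1} := by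
    refine closure_minimal ?_ hclosed
    rintro ⟨x, y⟩ h φ
    exact inner_field_pre hf h φ
  refine ⟨T.graph.topologicalClosure.toLinearPMap, ?_⟩
  refine (Submodule.toLinearPMap_graph_eq _ ?_).symm
  rintro ⟨x, y⟩ h hx
  obtain rfl : x = 0 := hx
  have h1 := hsub h
  simp only [Set.mem_ofPred_eq, inner_zero_right] at h1
  change y = 0
  have : inner ℂ y y = 0 := by
    refine denseRange_coreEmb.induction_on (p := fun z => inner ℂ z y = (0 : ℂ)) y
      (isClosed_eq (by fun_prop) (by fun_prop)) h1
  exact inner_self_eq_zero.1 this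

include hf in
lemma isClosed_field_graph : IsClosed ((field f).graph : Set (Fock × Fock)) :=
  (isClosable_field_pre hf).closure_isClosed

lemma coreEmb_mem_field_graph (φ : coreSpace) :
    (coreEmb φ, coreEmb (fieldOp hf φ)) ∈ (field f).graph := by
  have hc := coreEmb_mem_createGraph hf φ
  rw [← create_graph] at hc
  have h := mem_graph_smul ((1 / Real.sqrt 2 : ℝ) : ℂ)
    (mem_graph_add (coreEmb_mem_annihilate_graph hf φ) hc)
  rw [← map_add, ← map_smul, ← fieldOp_apply] at h
  exact LinearPMap.le_graph_of_le (LinearPMap.le_closure _) h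

end

/-! ### Commutators with second quantized multiplication operators -/

section

variable {f : Photon → ℂ} (hf : IsFormFactor f) {w : Photon → ℝ} (hw : IsSymbol w)

include hf hw in
lemma IsFormFactor.symbol_mul : IsFormFactor fun k => (w k : ℂ) * f k where
  measurable := (Complex.measurable_ofReal.comp hw.measurable).mul hf.measurable
  bounded := by
    obtain ⟨R, C, hC, h⟩ := hf.bounded
    obtain ⟨M, hM, hb⟩ := hw.bounded R
    refine ⟨R, M * C, by positivity, fun k => ?_⟩
    rw [norm_mul, Complex.norm_real, Real.norm_eq_abs, mul_assoc]
    by_cases hk : ‖k.2‖ ≤ R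
    · exact mul_le_mul (hb k hk) (h k) (norm_nonneg _) hM
    · have h1 := h k
      rw [envelope_eq_zero hk, mul_zero, norm_le_zero_iff] at h1
      simp [h1, envelope_eq_zero hk]
  zero k hk := by simp [hf.zero k hk]

/-- The commutator is [dΓ(w), a*(f)] = a*(w f): the sum of w over all photons splits into the
created photon and the others. -/
lemma dG_createOp (ψ : coreSpace) : dG hw (createOp hf ψ) =
    createOp hf (dG hw ψ) + createOp (hf.symbol_mul hw) ψ := by
  refine coreSpace_ext fun n x => ?_
  cases n with
  | zero => simp [dG_apply, createOp_zero]
  | succ n =>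
    change _ = (createOp hf (dG hw ψ)).1 (n + 1) x + (createOp (hf.symbol_mul hw) ψ).1 (n + 1) x
    rw [dG_apply, createOp_succ, createOp_succ, createOp_succ]
    simp only [createFun]
    rw [← mul_add, ← Finset.sum_add_distrib, mul_left_comm, Finset.mul_sum]
    congr 1
    refine Finset.sum_congr rfl fun i _ => ?_
    rw [Fin.sum_univ_succAbove _ i, dG_apply]
    push_cast
    ring

lemma annihOp_dG (ψ : coreSpace) : annihOp hf (dG hw ψ) =
    dG hw (annihOp hf ψ) + annihOp (hf.symbol_mul hw) ψ := by
  refine coreSpace_ext fun n x => ?_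
  change _ = (dG hw (annihOp hf ψ)).1 n x + (annihOp (hf.symbol_mul hw) ψ).1 n x
  rw [dG_apply, annihOp_apply, annihOp_apply, annihOp_apply, mul_left_comm, ← mul_add]
  congr 1
  rw [← integral_const_mul, ← integral_add ((integrable_annih hf ψ n x).const_mul _)
      (integrable_annih (hf.symbol_mul hw) ψ n x)]
  refine integral_congr_ae (Eventually.of_forall fun y => ?_)
  simp only [dG_apply, sum_ins, map_mul, Complex.conj_ofReal]
  push_cast
  ring

/-- Creation raises and annihilation lowers dΓ(w), hence the opposite signs. The commutator is again
linear in creation and annihilation operators, so it obeys the same kind of energy bound. -/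
lemma commutator_fieldOp (ψ : coreSpace) : dG hw (fieldOp hf ψ) - fieldOp hf (dG hw ψ) =
    ((1 / Real.sqrt 2 : ℝ) : ℂ) •
      (createOp (hf.symbol_mul hw) ψ - annihOp (hf.symbol_mul hw) ψ) := by
  rw [fieldOp_apply, fieldOp_apply, map_smul, map_add, dG_createOp, annihOp_dG]
  module

end

/-! ### Energy bounds for creation and annihilation operators -/

section

variable {w : Photon → ℝ} (hw : IsSymbol w)

include hw in
lemma isMultiplier_sqrt_energy : IsMultiplier fun _ x => Real.sqrt (1 + ∑ i, w (x i)) where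
  measurable n := (measurable_const.add (hw.isMultiplier.measurable n)).sqrt
  symmetric n π x := by rw [hw.isMultiplier.symmetric n π x]
  bounded R n := by
    obtain ⟨C, hC, h⟩ := hw.isMultiplier.bounded R n
    refine ⟨Real.sqrt (1 + C), Real.sqrt_nonneg _, fun x hx => ?_⟩
    rw [abs_of_nonneg (Real.sqrt_nonneg _)]
    exact Real.sqrt_le_sqrt (by linarith [(le_abs_self _).trans (h x hx)])

/-- The energy `⟨ψ, (1 + dΓ(w)) ψ⟩` as an integral. -/
lemma ofReal_energy (hw0 : ∀ k, 0 ≤ w k) (ψ : coreSpace) :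
    ENNReal.ofReal (‖coreEmb ψ‖ ^ 2 + reInner coreEmb ψ (dG hw ψ)) =
      ∑' n, ∫⁻ x, ENNReal.ofReal (1 + ∑ i, w (x i)) * ‖ψ.1 n x‖ₑ ^ 2 ∂confMeasure n := by
  set E := multOp _ (isMultiplier_sqrt_energy hw) with hE
  have h1 : E (E ψ) = ψ + dG hw ψ := by
    refine coreSpace_ext fun n x => ?_
    have h0 : 0 ≤ 1 + ∑ i, w (x i) := add_nonneg zero_le_one (Finset.sum_nonneg fun i _ => hw0 _)
    change ((Real.sqrt (1 + ∑ i, w (x i)) : ℝ) : ℂ) *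
      (((Real.sqrt (1 + ∑ i, w (x i)) : ℝ) : ℂ) * ψ.1 n x) = ψ.1 n x + _ * ψ.1 n x
    rw [← mul_assoc, ← Complex.ofReal_mul, Real.mul_self_sqrt h0]
    push_cast
    ring
  have h2 : ‖coreEmb ψ‖ ^ 2 + reInner coreEmb ψ (dG hw ψ) = ‖coreEmb (E ψ)‖ ^ 2 := by
    rw [← reInner_self, ← reInner_self, ← reInner_add_right, ← h1]
    simp only [reInner]
    rw [inner_coreEmb_multOp]
  rw [h2, ofReal_norm_sq_coreEmb]
  refine tsum_congr fun n => lintegral_congr fun x => ?_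
  have h0 : 0 ≤ 1 + ∑ i, w (x i) := add_nonneg zero_le_one (Finset.sum_nonneg fun i _ => hw0 _)
  change ‖((Real.sqrt (1 + ∑ i, w (x i)) : ℝ) : ℂ) * ψ.1 n x‖ₑ ^ 2 = _
  rw [enorm_mul, mul_pow]
  congr 1
  rw [← ofReal_norm, Complex.norm_real, Real.norm_of_nonneg (Real.sqrt_nonneg _),
    ← ENNReal.ofReal_pow (Real.sqrt_nonneg _), Real.sq_sqrt h0]

/-- The multiplier has a real square root that maps the core into itself, so the form is a squared
norm. -/
lemma energy_nonneg (hw0 : ∀ k, 0 ≤ w k) (ψ : coreSpace) :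
    0 ≤ reInner coreEmb ψ (dG hw ψ) := by
  have hF : IsMultiplier fun _ x => Real.sqrt (∑ i, w (x i)) :=
    { measurable := fun n => (hw.isMultiplier.measurable n).sqrt
      symmetric := fun n π x => by rw [hw.isMultiplier.symmetric n π x]
      bounded := fun R n => by
        obtain ⟨C, hC, h⟩ := hw.isMultiplier.bounded R n
        refine ⟨Real.sqrt C, Real.sqrt_nonneg _, fun x hx => ?_⟩
        rw [abs_of_nonneg (Real.sqrt_nonneg _)]
        exact Real.sqrt_le_sqrt ((le_abs_self _).trans (h x hx)) }
  have h1 : multOp _ hF (multOp _ hF ψ) = dG hw ψ := by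
    refine coreSpace_ext fun n x => ?_
    have h0 : 0 ≤ ∑ i, w (x i) := Finset.sum_nonneg fun i _ => hw0 _
    rw [multOp_apply, multOp_apply, dG_apply, ← mul_assoc, ← Complex.ofReal_mul,
      Real.mul_self_sqrt h0]
  have h2 : reInner coreEmb ψ (dG hw ψ) = ‖coreEmb (multOp _ hF ψ)‖ ^ 2 := by
    rw [← h1, ← reInner_self]
    simp only [reInner]
    rw [inner_coreEmb_multOp]
  rw [h2]; positivity

end

section

variable {f : Photon → ℂ} (hf : IsFormFactor f)

/-- The squared norm of `f` with weight `1 + 1 / |k|`. -/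
def formConst (f : Photon → ℂ) : ℝ := ∫ k, ‖f k‖ ^ 2 * (1 + ‖k.2‖⁻¹) ∂photonMeasure

lemma formConst_nonneg (f : Photon → ℂ) : 0 ≤ formConst f :=
  integral_nonneg fun k => by positivity

include hf in
lemma ofReal_formConst : ENNReal.ofReal (formConst f) =
    ∫⁻ k, ENNReal.ofReal (‖f k‖ ^ 2 * (1 + ‖k.2‖⁻¹)) ∂photonMeasure := by
  have hm := hf.measurable
  refine ofReal_integral_eq_lintegral_ofReal ?_ (Eventually.of_forall fun k => by positivity)
  obtain ⟨R, C, hC, h⟩ := hf.bounded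
  refine ((integrable_envelope_sq_mul R).const_mul (C ^ 2)).mono' ?_ (Eventually.of_forall fun k => ?_)
  · exact Measurable.aestronglyMeasurable (by fun_prop)
  · rw [Real.norm_of_nonneg (by positivity), ← mul_assoc, ← mul_pow]
    gcongr
    exact h k

variable {w : Photon → ℝ} (hw : IsSymbol w) (hwk : ∀ k : Photon, ‖k.2‖ ≤ w k)

include hf hwk in
-- Cauchy–Schwarz with weights w(x_i) produces the factor w(x_i)⁻¹ ∑ w. Splitting off photon i, this
-- is 1 + Ω/w(x_i) ≤ (1 + 1/|k_i|)(1 + Ω), with Ω the energy of the other photons. The photon number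
-- never appears, and only |k| ≤ w is needed.
lemma norm_createFun_sq_le {n : ℕ} (φ : (Fin n → Photon) → ℂ) (x : Fin (n + 1) → Photon) :
    ‖createFun f φ x‖ ^ 2 ≤ (n + 1 : ℝ)⁻¹ * ∑ i, ‖f (x i)‖ ^ 2 * (1 + ‖(x i).2‖⁻¹) *
      ((1 + ∑ j, w (x (i.succAbove j))) * ‖φ fun j => x (i.succAbove j)‖ ^ 2) := by
  have hw0 : ∀ k, 0 ≤ w k := fun k => (norm_nonneg _).trans (hwk k)
  rw [createFun, norm_mul, Complex.norm_real, Real.norm_of_nonneg (by positivity), mul_pow,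
    div_pow, one_pow, Real.sq_sqrt (by positivity), one_div]
  gcongr
  set b : Fin (n + 1) → ℝ := fun i => ‖φ fun j => x (i.succAbove j)‖
  have h1 : ‖∑ i, f (x i) * φ fun j => x (i.succAbove j)‖ ≤ ∑ i, ‖f (x i)‖ * b i :=
    (norm_sum_le _ _).trans (Finset.sum_le_sum fun i _ => (norm_mul _ _).le)
  have h2 : (∑ i, ‖f (x i)‖ * b i) ^ 2 ≤
      (∑ i, ‖f (x i)‖ ^ 2 * b i ^ 2 * (w (x i))⁻¹) * ∑ i, w (x i) := by
    refine Finset.sum_sq_le_sum_mul_sum_of_sq_le_mul _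
      (fun i _ => mul_nonneg (by positivity) (inv_nonneg.2 (hw0 _))) (fun i _ => hw0 _)
      fun i _ => le_of_eq ?_
    by_cases hk : (x i).2 = 0
    · simp [hf.zero _ hk]
    · have : w (x i) ≠ 0 := (lt_of_lt_of_le (norm_pos_iff.2 hk) (hwk _)).ne'
      rw [mul_assoc, inv_mul_cancel₀ this]; ring
  refine (pow_le_pow_left₀ (norm_nonneg _) h1 2).trans (h2.trans ?_)
  rw [Finset.sum_mul]
  refine Finset.sum_le_sum fun i _ => ?_
  by_cases hk : (x i).2 = 0
  · simp [hf.zero _ hk]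
  · have hk0 : 0 < ‖(x i).2‖ := norm_pos_iff.2 hk
    have hw1 : 0 < w (x i) := hk0.trans_le (hwk _)
    rw [Fin.sum_univ_succAbove _ i]
    set Ω := ∑ j, w (x (i.succAbove j))
    have hΩ : 0 ≤ Ω := Finset.sum_nonneg fun j _ => hw0 _
    have h3 : (w (x i))⁻¹ * (w (x i) + Ω) ≤ (1 + ‖(x i).2‖⁻¹) * (1 + Ω) := by
      rw [mul_add, inv_mul_cancel₀ hw1.ne']
      have h4 : (w (x i))⁻¹ ≤ ‖(x i).2‖⁻¹ := inv_anti₀ hk0 (hwk _)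
      have h5 : (w (x i))⁻¹ * Ω ≤ ‖(x i).2‖⁻¹ * Ω := by gcongr
      have h6 : 0 ≤ ‖(x i).2‖⁻¹ := by positivity
      nlinarith
    calc ‖f (x i)‖ ^ 2 * b i ^ 2 * (w (x i))⁻¹ * (w (x i) + Ω)
        = ‖f (x i)‖ ^ 2 * b i ^ 2 * ((w (x i))⁻¹ * (w (x i) + Ω)) := by ring
      _ ≤ ‖f (x i)‖ ^ 2 * b i ^ 2 * ((1 + ‖(x i).2‖⁻¹) * (1 + Ω)) := by gcongr
      _ = _ := by ring

include hf hw hwk in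
-- Each of the n + 1 summands factorizes into an integral over the created photon and one over the
-- rest; their number cancels the prefactor.
lemma lintegral_createFun_le (ψ : coreSpace) (n : ℕ) :
    ∫⁻ x, ‖createFun f (ψ.1 n) x‖ₑ ^ 2 ∂confMeasure (n + 1) ≤ ENNReal.ofReal (formConst f) *
      ∫⁻ x, ENNReal.ofReal (1 + ∑ i, w (x i)) * ‖ψ.1 n x‖ₑ ^ 2 ∂confMeasure n := by
  have hw0 : ∀ k, 0 ≤ w k := fun k => (norm_nonneg _).trans (hwk k)
  have hm := hf.measurable
  let F : Photon → ENNReal := fun k => ENNReal.ofReal (‖f k‖ ^ 2 * (1 + ‖k.2‖⁻¹))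
  let g : (Fin n → Photon) → ENNReal := fun x =>
    ENNReal.ofReal (1 + ∑ i, w (x i)) * ‖ψ.1 n x‖ₑ ^ 2
  have hF : Measurable F := by fun_prop
  have hg : Measurable g :=
    (measurable_const.add (hw.isMultiplier.measurable n)).ennreal_ofReal.mul
      ((measurable_core ψ n).enorm.pow_const 2)
  have hpt : ∀ x : Fin (n + 1) → Photon, ‖createFun f (ψ.1 n) x‖ₑ ^ 2 ≤
      ENNReal.ofReal ((n + 1 : ℝ)⁻¹) * ∑ i, F (x i) * g fun j => x (i.succAbove j) := by
    intro x
    rw [← ofReal_norm, ← ENNReal.ofReal_pow (norm_nonneg _)]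
    refine (ENNReal.ofReal_le_ofReal (norm_createFun_sq_le hf hwk (ψ.1 n) x)).trans (le_of_eq ?_)
    have h0 : ∀ i : Fin (n + 1), 0 ≤ 1 + ∑ j, w (x (i.succAbove j)) := fun i =>
      add_nonneg zero_le_one (Finset.sum_nonneg fun j _ => hw0 _)
    rw [ENNReal.ofReal_mul (by positivity), ENNReal.ofReal_sum_of_nonneg fun i _ =>
      mul_nonneg (by positivity) (mul_nonneg (h0 i) (by positivity))]
    congr 1
    refine Finset.sum_congr rfl fun i _ => ?_
    rw [ENNReal.ofReal_mul (by positivity), ENNReal.ofReal_mul (h0 i),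
      ENNReal.ofReal_pow (norm_nonneg _), ofReal_norm]
  have hterm : ∀ i : Fin (n + 1), ∫⁻ x, F (x i) * g (fun j => x (i.succAbove j))
      ∂confMeasure (n + 1) = (∫⁻ k, F k ∂photonMeasure) * ∫⁻ x, g x ∂confMeasure n := by
    intro i
    rw [← (measurePreserving_ins i).lintegral_comp_emb (measurableEmbedding_ins i)]
    simp only [ins_same, ins_succAbove]
    exact lintegral_prod_mul hF.aemeasurable hg.aemeasurable
  refine (lintegral_mono hpt).trans ?_
  have hmeas : ∀ i : Fin (n + 1), Measurable fun x : Fin (n + 1) → Photon =>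
      F (x i) * g fun j => x (i.succAbove j) := fun i =>
    (hF.comp (measurable_pi_apply i)).mul
      (hg.comp (measurable_pi_lambda _ fun j => measurable_pi_apply _))
  rw [lintegral_const_mul _ (Finset.measurable_sum _ fun i _ => hmeas i),
    lintegral_finsetSum _ fun i _ => hmeas i, Finset.sum_congr rfl fun i _ => hterm i,
    ofReal_formConst hf]
  simp only [Finset.sum_const, Finset.card_univ, Fintype.card_fin, nsmul_eq_mul]
  rw [← mul_assoc]
  have : ENNReal.ofReal ((n + 1 : ℝ)⁻¹) * ((n + 1 : ℕ) : ENNReal) = 1 := by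
    rw [← ENNReal.ofReal_natCast, ← ENNReal.ofReal_mul (by positivity)]
    push_cast
    rw [inv_mul_cancel₀ (by positivity), ENNReal.ofReal_one]
  rw [this, one_mul]

include hwk in
lemma norm_createOp_sq_le (ψ : coreSpace) : ‖coreEmb (createOp hf ψ)‖ ^ 2 ≤
    formConst f * (‖coreEmb ψ‖ ^ 2 + reInner coreEmb ψ (dG hw ψ)) := by
  have hw0 : ∀ k, 0 ≤ w k := fun k => (norm_nonneg _).trans (hwk k)
  have hE : 0 ≤ ‖coreEmb ψ‖ ^ 2 + reInner coreEmb ψ (dG hw ψ) :=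
    add_nonneg (sq_nonneg _) (energy_nonneg hw hw0 ψ)
  rw [← ENNReal.ofReal_le_ofReal_iff (mul_nonneg (formConst_nonneg f) hE),
    ENNReal.ofReal_mul (formConst_nonneg f), ofReal_energy hw hw0, ofReal_norm_sq_coreEmb,
    tsum_eq_zero_add' ENNReal.summable, ← ENNReal.tsum_mul_left]
  have h0 : ∫⁻ z, ‖(createOp hf ψ).1 0 z‖ₑ ^ 2 ∂confMeasure 0 = 0 := by
    simp [createOp_zero]
  rw [h0, zero_add]
  exact ENNReal.tsum_le_tsum fun n => lintegral_createFun_le hf hw hwk ψ n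

lemma lintegral_mul_sq_le {α : Type*} [MeasurableSpace α] {μ : Measure α} {a b : α → ENNReal}
    (ha : AEMeasurable a μ) (hb : AEMeasurable b μ) :
    (∫⁻ x, a x * b x ∂μ) ^ 2 ≤ (∫⁻ x, a x ^ 2 ∂μ) * ∫⁻ x, b x ^ 2 ∂μ := by
  have h := ENNReal.lintegral_mul_le_Lp_mul_Lq μ Real.HolderConjugate.two_two ha hb
  simp only [Pi.mul_apply, ENNReal.rpow_two] at h
  refine (pow_le_pow_left₀ (zero_le) h 2).trans (le_of_eq ?_)
  rw [mul_pow, ← ENNReal.rpow_natCast, ← ENNReal.rpow_natCast, ← ENNReal.rpow_mul,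
    ← ENNReal.rpow_mul]
  simp

include hwk in
-- Cauchy–Schwarz in the annihilated photon, after inserting 1 = w^(-1/2) w^(1/2). The inverse
-- weight goes to f, where |k| ≤ w bounds it by 1/|k|.
lemma enorm_annihOp_sq_le (hw : IsSymbol w) (ψ : coreSpace) (n : ℕ) (x : Fin n → Photon) :
    ‖(annihOp hf ψ).1 n x‖ₑ ^ 2 ≤ (n + 1 : ℕ) * (ENNReal.ofReal (formConst f) *
      ∫⁻ y, ENNReal.ofReal (w y) * ‖ψ.1 (n + 1) (ins 0 y x)‖ₑ ^ 2 ∂photonMeasure) := by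
  have hw0 : ∀ k, 0 ≤ w k := fun k => (norm_nonneg _).trans (hwk k)
  have hm := hf.measurable
  have hwm := hw.measurable
  rw [annihOp_apply, enorm_mul, mul_pow]
  have h1 : ‖((Real.sqrt (n + 1) : ℝ) : ℂ)‖ₑ ^ 2 = ((n + 1 : ℕ) : ENNReal) := by
    rw [← ofReal_norm, Complex.norm_real, Real.norm_of_nonneg (Real.sqrt_nonneg _),
      ← ENNReal.ofReal_pow (Real.sqrt_nonneg _), Real.sq_sqrt (by positivity)]
    exact_mod_cast ENNReal.ofReal_natCast (n + 1)
  rw [h1]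
  gcongr
  have hψm : Measurable fun y => ψ.1 (n + 1) (ins 0 y x) :=
    (measurable_core ψ (n + 1)).comp ((measurable_ins 0).comp measurable_prodMk_right)
  let a : Photon → ENNReal := fun y => ‖f y‖ₑ * ENNReal.ofReal (Real.sqrt (w y)⁻¹)
  let b : Photon → ENNReal := fun y => ENNReal.ofReal (Real.sqrt (w y)) *
    ‖ψ.1 (n + 1) (ins 0 y x)‖ₑ
  have ha : Measurable a := by fun_prop
  have hb : Measurable b := (hwm.sqrt.ennreal_ofReal).mul hψm.enorm
  have h2 : ‖∫ y, starRingEnd ℂ (f y) * ψ.1 (n + 1) (ins 0 y x) ∂photonMeasure‖ₑ ≤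
      ∫⁻ y, a y * b y ∂photonMeasure := by
    refine (enorm_integral_le_lintegral_enorm _).trans (lintegral_mono fun y => ?_)
    rw [enorm_mul, RCLike.enorm_conj]
    by_cases hk : y.2 = 0
    · simp [hf.zero _ hk]
    · have hw1 : 0 < w y := (norm_pos_iff.2 hk).trans_le (hwk _)
      refine le_of_eq ?_
      calc _ = ‖f y‖ₑ * 1 * ‖ψ.1 (n + 1) (ins 0 y x)‖ₑ := by rw [mul_one]
        _ = ‖f y‖ₑ * (ENNReal.ofReal (Real.sqrt (w y)⁻¹) * ENNReal.ofReal (Real.sqrt (w y))) *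
            ‖ψ.1 (n + 1) (ins 0 y x)‖ₑ := by
          rw [← ENNReal.ofReal_mul (Real.sqrt_nonneg _), ← Real.sqrt_mul (inv_nonneg.2 hw1.le),
            inv_mul_cancel₀ hw1.ne', Real.sqrt_one, ENNReal.ofReal_one]
        _ = a y * b y := by simp only [a, b]; ring
  refine (pow_le_pow_left₀ zero_le h2 2).trans
    ((lintegral_mul_sq_le ha.aemeasurable hb.aemeasurable).trans ?_)
  rw [ofReal_formConst hf]
  gcongr with y y
  · simp only [a]
    rw [mul_pow, ← ENNReal.ofReal_pow (Real.sqrt_nonneg _), Real.sq_sqrt (inv_nonneg.2 (hw0 y)),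
      ENNReal.ofReal_mul (by positivity), ENNReal.ofReal_pow (norm_nonneg _), ofReal_norm]
    by_cases hk : y.2 = 0
    · simp [hf.zero _ hk]
    · gcongr
      have := inv_anti₀ (norm_pos_iff.2 hk) (hwk y)
      linarith
  · simp only [b]
    rw [mul_pow, ← ENNReal.ofReal_pow (Real.sqrt_nonneg _), Real.sq_sqrt (hw0 y)]

include hw hwk in
-- By symmetry of ψ, the factor n + 1 times the weight of one photon becomes the sum of the weights
-- of all photons, which is the energy.
lemma lintegral_annihOp_le (ψ : coreSpace) (n : ℕ) :
    ∫⁻ x, ‖(annihOp hf ψ).1 n x‖ₑ ^ 2 ∂confMeasure n ≤ ENNReal.ofReal (formConst f) *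
      ∫⁻ x, ENNReal.ofReal (1 + ∑ i, w (x i)) * ‖ψ.1 (n + 1) x‖ₑ ^ 2 ∂confMeasure (n + 1) := by
  have hw0 : ∀ k, 0 ≤ w k := fun k => (norm_nonneg _).trans (hwk k)
  have hwm := hw.measurable
  let h : Photon × (Fin n → Photon) → ENNReal := fun p =>
    ENNReal.ofReal (w p.1) * ‖ψ.1 (n + 1) (ins 0 p.1 p.2)‖ₑ ^ 2
  have hψm : Measurable fun p : Photon × (Fin n → Photon) => ψ.1 (n + 1) (ins 0 p.1 p.2) :=
    (measurable_core ψ (n + 1)).comp (measurable_ins 0)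
  have hh : Measurable h :=
    ((hwm.comp measurable_fst).ennreal_ofReal).mul (hψm.enorm.pow_const 2)
  have hterm : ∀ i : Fin (n + 1), ∫⁻ x, ENNReal.ofReal (w (x i)) * ‖ψ.1 (n + 1) x‖ₑ ^ 2
      ∂confMeasure (n + 1) = ∫⁻ p, h p ∂photonMeasure.prod (confMeasure n) := by
    intro i
    rw [← (measurePreserving_ins i).lintegral_comp_emb (measurableEmbedding_ins i)]
    simp only [ins_same, core_ins ψ i]
    rfl
  have hψm' := measurable_core ψ (n + 1)
  have hsum : ((n + 1 : ℕ) : ENNReal) * ∫⁻ p, h p ∂photonMeasure.prod (confMeasure n) ≤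
      ∫⁻ x, ENNReal.ofReal (1 + ∑ i, w (x i)) * ‖ψ.1 (n + 1) x‖ₑ ^ 2 ∂confMeasure (n + 1) := by
    calc _ = ∑ i : Fin (n + 1), ∫⁻ x, ENNReal.ofReal (w (x i)) * ‖ψ.1 (n + 1) x‖ₑ ^ 2
          ∂confMeasure (n + 1) := by
          rw [Finset.sum_congr rfl fun i _ => hterm i]; simp
      _ = ∫⁻ x, ∑ i : Fin (n + 1), ENNReal.ofReal (w (x i)) * ‖ψ.1 (n + 1) x‖ₑ ^ 2
          ∂confMeasure (n + 1) := by
          rw [lintegral_finsetSum _ fun i _ => by fun_prop]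
      _ ≤ _ := by
          refine lintegral_mono fun x => ?_
          rw [← Finset.sum_mul, ← ENNReal.ofReal_sum_of_nonneg fun i _ => hw0 _]
          gcongr
          linarith
  refine (lintegral_mono fun x => enorm_annihOp_sq_le hf hwk hw ψ n x).trans ?_
  have hm2 : Measurable fun x => ∫⁻ y, h (y, x) ∂photonMeasure :=
    Measurable.lintegral_prod_left' hh
  rw [lintegral_const_mul _ (hm2.const_mul _), lintegral_const_mul _ hm2, mul_left_comm]
  gcongr
  rwa [lintegral_prod_symm _ hh.aemeasurable] at hsum

include hwk in
lemma norm_annihOp_sq_le (ψ : coreSpace) : ‖coreEmb (annihOp hf ψ)‖ ^ 2 ≤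
    formConst f * (‖coreEmb ψ‖ ^ 2 + reInner coreEmb ψ (dG hw ψ)) := by
  have hw0 : ∀ k, 0 ≤ w k := fun k => (norm_nonneg _).trans (hwk k)
  have hE : 0 ≤ ‖coreEmb ψ‖ ^ 2 + reInner coreEmb ψ (dG hw ψ) :=
    add_nonneg (sq_nonneg _) (energy_nonneg hw hw0 ψ)
  rw [← ENNReal.ofReal_le_ofReal_iff (mul_nonneg (formConst_nonneg f) hE),
    ENNReal.ofReal_mul (formConst_nonneg f), ofReal_energy hw hw0, ofReal_norm_sq_coreEmb,
    ← ENNReal.tsum_mul_left]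
  refine (ENNReal.tsum_le_tsum fun n => lintegral_annihOp_le hf hw hwk ψ n).trans ?_
  -- Annihilation takes sector n + 1 to sector n, so the bounds run over the shifted sectors; the
  -- vacuum term is added for free.
  exact ENNReal.tsum_comp_le_tsum_of_injective (Nat.succ_injective) fun n =>
    ENNReal.ofReal (formConst f) *
      ∫⁻ x, ENNReal.ofReal (1 + ∑ i, w (x i)) * ‖ψ.1 n x‖ₑ ^ 2 ∂confMeasure n

lemma norm_sq_half_add_le {𝓗 : Type*} [NormedAddCommGroup 𝓗] [NormedSpace ℂ 𝓗] {a b : 𝓗} {M : ℝ}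
    (ha : ‖a‖ ^ 2 ≤ M) (hb : ‖b‖ ^ 2 ≤ M) :
    ‖((1 / Real.sqrt 2 : ℝ) : ℂ) • (a + b)‖ ^ 2 ≤ 2 * M := by
  rw [norm_smul, Complex.norm_real, Real.norm_of_nonneg (by positivity), mul_pow, div_pow, one_pow,
    Real.sq_sqrt (by norm_num)]
  have := norm_add_le a b
  nlinarith [sq_nonneg (‖a‖ - ‖b‖), norm_nonneg (a + b), norm_nonneg a, norm_nonneg b]

include hwk in
lemma norm_fieldOp_sq_le (ψ : coreSpace) : ‖coreEmb (fieldOp hf ψ)‖ ^ 2 ≤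
    2 * formConst f * (‖coreEmb ψ‖ ^ 2 + reInner coreEmb ψ (dG hw ψ)) := by
  rw [fieldOp_apply, map_smul, map_add, mul_assoc]
  exact norm_sq_half_add_le (norm_annihOp_sq_le hf hw hwk ψ) (norm_createOp_sq_le hf hw hwk ψ)

include hwk in
lemma norm_commutator_fieldOp_sq_le {u : Photon → ℝ} (hu : IsSymbol u) (ψ : coreSpace) :
    ‖coreEmb (dG hu (fieldOp hf ψ) - fieldOp hf (dG hu ψ))‖ ^ 2 ≤
      2 * formConst (fun k => (u k : ℂ) * f k) *
        (‖coreEmb ψ‖ ^ 2 + reInner coreEmb ψ (dG hw ψ)) := by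
  rw [commutator_fieldOp, map_smul, map_sub, sub_eq_add_neg, mul_assoc]
  refine norm_sq_half_add_le (norm_createOp_sq_le _ hw hwk ψ) ?_
  rw [norm_neg]
  exact norm_annihOp_sq_le _ hw hwk ψ

end

/-! ### The core of the reduced Hilbert space -/

section ReducedCore

variable {d : ℕ}

/-- The embedding of `d`-tuples of core vectors into `ℂᵈ ⊗ ℱ`. -/
def redEmb (d : ℕ) : (Fin d → coreSpace) →ₗ[ℂ] PiLp 2 fun _ : Fin d => Fock where
  toFun ψ := WithLp.toLp 2 fun i => coreEmb (ψ i)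
  map_add' ψ φ := by ext1 i; simp
  map_smul' c ψ := by ext1 i; simp

@[simp] lemma redEmb_apply (ψ : Fin d → coreSpace) (i : Fin d) : redEmb d ψ i = coreEmb (ψ i) := rfl

lemma denseRange_redEmb : DenseRange (redEmb d) := by
  have h1 : DenseRange (fun ψ : Fin d → coreSpace => fun i => coreEmb (ψ i)) :=
    DenseRange.piMap fun _ => denseRange_coreEmb
  exact (WithLp.toLp_surjective 2).denseRange.comp h1 (PiLp.continuous_toLp 2 _)

lemma inner_redEmb (ψ φ : Fin d → coreSpace) :
    inner ℂ (redEmb d ψ) (redEmb d φ) = ∑ i, inner ℂ (coreEmb (ψ i)) (coreEmb (φ i)) :=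
  PiLp.inner_apply _ _

lemma norm_sq_redEmb (ψ : Fin d → coreSpace) :
    ‖redEmb d ψ‖ ^ 2 = ∑ i, ‖coreEmb (ψ i)‖ ^ 2 :=
  PiLp.norm_sq_eq_of_L2 _ _

lemma reInner_redEmb (ψ φ : Fin d → coreSpace) :
    reInner (redEmb d) ψ φ = ∑ i, reInner coreEmb (ψ i) (φ i) := by
  simp [reInner, inner_redEmb]

/-- The operator `M ⊗ T` on the core. -/
def matOp (M : Matrix (Fin d) (Fin d) ℂ) (T : coreSpace →ₗ[ℂ] coreSpace) :
    (Fin d → coreSpace) →ₗ[ℂ] (Fin d → coreSpace) :=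
  LinearMap.pi fun i => ∑ k, M i k • T ∘ₗ LinearMap.proj k

lemma matOp_apply (M : Matrix (Fin d) (Fin d) ℂ) (T : coreSpace →ₗ[ℂ] coreSpace)
    (ψ : Fin d → coreSpace) (i : Fin d) : matOp M T ψ i = ∑ k, M i k • T (ψ k) := by
  simp [matOp]

lemma inner_matOp {M : Matrix (Fin d) (Fin d) ℂ} (hM : M.IsHermitian)
    {T : coreSpace →ₗ[ℂ] coreSpace}
    (hT : ∀ ψ φ, inner ℂ (coreEmb (T ψ)) (coreEmb φ) = inner ℂ (coreEmb ψ) (coreEmb (T φ)))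
    (ψ φ : Fin d → coreSpace) :
    inner ℂ (redEmb d (matOp M T ψ)) (redEmb d φ) =
      inner ℂ (redEmb d ψ) (redEmb d (matOp M T φ)) := by
  simp only [inner_redEmb, matOp_apply, map_sum, map_smul, sum_inner, inner_sum, inner_smul_left,
    inner_smul_right, hT]
  rw [Finset.sum_comm]
  refine Finset.sum_congr rfl fun i _ => Finset.sum_congr rfl fun k _ => ?_
  have : starRingEnd ℂ (M k i) = M i k := hM.apply i k
  rw [this]

/-- The sum of the squared absolute values of the entries. -/
def matConst (M : Matrix (Fin d) (Fin d) ℂ) : ℝ := ∑ i, ∑ k, ‖M i k‖ ^ 2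

lemma matConst_nonneg (M : Matrix (Fin d) (Fin d) ℂ) : 0 ≤ matConst M := by
  unfold matConst; positivity

lemma norm_matOp_sq_le (M : Matrix (Fin d) (Fin d) ℂ) (T : coreSpace →ₗ[ℂ] coreSpace)
    (ψ : Fin d → coreSpace) :
    ‖redEmb d (matOp M T ψ)‖ ^ 2 ≤ matConst M * ‖redEmb d (T.compLeft (Fin d) ψ)‖ ^ 2 := by
  rw [norm_sq_redEmb, norm_sq_redEmb, matConst, Finset.sum_mul]
  refine Finset.sum_le_sum fun i _ => ?_
  rw [matOp_apply, map_sum]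
  have h1 : ‖∑ k, coreEmb (M i k • T (ψ k))‖ ≤ ∑ k, ‖M i k‖ * ‖coreEmb (T (ψ k))‖ :=
    (norm_sum_le _ _).trans (Finset.sum_le_sum fun k _ => by rw [map_smul, norm_smul])
  exact (pow_le_pow_left₀ (norm_nonneg _) h1 2).trans (Finset.sum_mul_sq_le_sq_mul_sq _ _ _)

lemma norm_compLeft_sq_le {T O : coreSpace →ₗ[ℂ] coreSpace} {a : ℝ}
    (h : ∀ ψ, ‖coreEmb (T ψ)‖ ^ 2 ≤ a * (‖coreEmb ψ‖ ^ 2 + reInner coreEmb ψ (O ψ)))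
    (ψ : Fin d → coreSpace) :
    ‖redEmb d (T.compLeft (Fin d) ψ)‖ ^ 2 ≤
      a * (‖redEmb d ψ‖ ^ 2 + reInner (redEmb d) ψ (O.compLeft (Fin d) ψ)) := by
  rw [norm_sq_redEmb, norm_sq_redEmb, reInner_redEmb, ← Finset.sum_add_distrib, Finset.mul_sum]
  exact Finset.sum_le_sum fun i _ => h (ψ i)

lemma inner_compLeft {T : coreSpace →ₗ[ℂ] coreSpace}
    (hT : ∀ ψ φ, inner ℂ (coreEmb (T ψ)) (coreEmb φ) = inner ℂ (coreEmb ψ) (coreEmb (T φ)))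
    (ψ φ : Fin d → coreSpace) :
    inner ℂ (redEmb d (T.compLeft (Fin d) ψ)) (redEmb d φ) =
      inner ℂ (redEmb d ψ) (redEmb d (T.compLeft (Fin d) φ)) := by
  simp only [inner_redEmb]
  exact Finset.sum_congr rfl fun i _ => hT _ _

end ReducedCore

/-! ### The interacting system on the core -/

lemma norm_le_omega (m : ℝ) (k : Photon) : ‖k.2‖ ≤ omega m k :=
  Real.le_sqrt_of_sq_le (by nlinarith [sq_nonneg m])

lemma isSymbol_omega (m : ℝ) : IsSymbol (omega m) where
  measurable := by unfold omega; fun_prop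
  bounded R := by
    refine ⟨Real.sqrt (m ^ 2 + R ^ 2), Real.sqrt_nonneg _, fun k hk => ?_⟩
    rw [omega, abs_of_nonneg (Real.sqrt_nonneg _)]
    gcongr

lemma abs_coord_le (x : E3) (j : Fin 3) : |x j| ≤ ‖x‖ := PiLp.norm_apply_le x j

lemma isSymbol_coord (j : Fin 3) : IsSymbol fun k => k.2 j where
  measurable := by fun_prop
  bounded R := by
    refine ⟨|R|, abs_nonneg _, fun k hk => (abs_coord_le _ _).trans (hk.trans (le_abs_self R))⟩

section System

variable {d : ℕ} {M : Fin 3 → Matrix (Fin d) (Fin d) ℂ} (hM : ∀ j, (M j).IsHermitian)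
  {f g : Fin 3 → Photon → ℂ} (hf : ∀ j, IsFormFactor (f j)) (hg : ∀ j, IsFormFactor (g j))

/-- The component `ξ_j - (P_f)_j` on the core. -/
def momentumOp (ξ : E3) (j : Fin 3) : coreSpace →ₗ[ℂ] coreSpace :=
  (ξ j : ℂ) • LinearMap.id - dG (isSymbol_coord j)

lemma inner_dG {w : Photon → ℝ} (hw : IsSymbol w) (ψ φ : coreSpace) :
    inner ℂ (coreEmb (dG hw ψ)) (coreEmb φ) = inner ℂ (coreEmb ψ) (coreEmb (dG hw φ)) :=
  inner_coreEmb_multOp _ _ _ _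

lemma dG_comm {w w' : Photon → ℝ} (hw : IsSymbol w) (hw' : IsSymbol w') (ψ : coreSpace) :
    dG hw (dG hw' ψ) = dG hw' (dG hw ψ) :=
  coreSpace_ext fun n x => by simp only [dG_apply]; ring

lemma inner_momentumOp (ξ : E3) (j : Fin 3) (ψ φ : coreSpace) :
    inner ℂ (coreEmb (momentumOp ξ j ψ)) (coreEmb φ) =
      inner ℂ (coreEmb ψ) (coreEmb (momentumOp ξ j φ)) := by
  simp [-Complex.coe_smul, momentumOp, inner_sub_left, inner_sub_right, inner_smul_left, inner_smul_right, inner_dG, mul_comm]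

lemma momentumOp_comm (ξ : E3) (i j : Fin 3) (ψ : coreSpace) :
    momentumOp ξ i (momentumOp ξ j ψ) = momentumOp ξ j (momentumOp ξ i ψ) := by
  simp only [momentumOp, LinearMap.sub_apply, LinearMap.smul_apply, LinearMap.id_apply, map_sub,
    map_smul, dG_comm (isSymbol_coord i)]
  module

/-- The spin coupling `∑ⱼ Mⱼ ⊗ φ(gⱼ)` on the core. -/
def spinOp (M : Fin 3 → Matrix (Fin d) (Fin d) ℂ) (hg : ∀ j, IsFormFactor (g j)) :
    (Fin d → coreSpace) →ₗ[ℂ] (Fin d → coreSpace) :=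
  ∑ j, matOp (M j) (fieldOp (hg j))

include hM in
lemma inner_spinOp (ψ φ : Fin d → coreSpace) :
    inner ℂ (redEmb d (spinOp M hg ψ)) (redEmb d φ) =
      inner ℂ (redEmb d ψ) (redEmb d (spinOp M hg φ)) := by
  simp only [spinOp, LinearMap.sum_apply, map_sum, sum_inner, inner_sum]
  exact Finset.sum_congr rfl fun j _ => inner_matOp (hM j) (inner_fieldOp (hg j)) ψ φ

lemma norm_spinOp_sq_le (m : ℝ) (ψ : Fin d → coreSpace) :
    ‖redEmb d (spinOp M hg ψ)‖ ^ 2 ≤ (3 * ∑ j, matConst (M j) * (2 * formConst (g j))) *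
      (‖redEmb d ψ‖ ^ 2 + reInner (redEmb d) ψ ((dG (isSymbol_omega m)).compLeft (Fin d) ψ)) := by
  simp only [spinOp, LinearMap.sum_apply, map_sum]
  have h1 : ‖∑ j, redEmb d (matOp (M j) (fieldOp (hg j)) ψ)‖ ^ 2 ≤
      3 * ∑ j, ‖redEmb d (matOp (M j) (fieldOp (hg j)) ψ)‖ ^ 2 := by
    -- The factor 3 is the number of components in the Cauchy–Schwarz inequality for the sum.
    refine (pow_le_pow_left₀ (norm_nonneg _) (norm_sum_le _ _) 2).trans ?_
    simpa using sq_sum_le_card_mul_sum_sq (s := (Finset.univ : Finset (Fin 3)))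
      (f := fun j => ‖redEmb d (matOp (M j) (fieldOp (hg j)) ψ)‖)
  refine h1.trans ?_
  rw [mul_assoc, Finset.sum_mul]
  gcongr with j
  rw [mul_assoc]
  refine (norm_matOp_sq_le _ _ _).trans ?_
  refine mul_le_mul_of_nonneg_left ?_ (matConst_nonneg _)
  exact norm_compLeft_sq_le (norm_fieldOp_sq_le (hg j) (isSymbol_omega m) (norm_le_omega m)) ψ

/-- A constant dominating all relative bounds of the interaction. -/
def systemConst (M : Fin 3 → Matrix (Fin d) (Fin d) ℂ) (f g : Fin 3 → Photon → ℂ) (e m : ℝ) : ℝ :=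
  1 + e ^ 2 * (∑ j, (2 * formConst (f j) + 2 * formConst (fun k => (omega m k : ℂ) * f j k) +
      2 * formConst (fun k => (k.2 j : ℂ) * f j k)) +
    3 * ∑ j, matConst (M j) * (2 * formConst (g j)))

lemma systemConst_bounds (M : Fin 3 → Matrix (Fin d) (Fin d) ℂ) (f g : Fin 3 → Photon → ℂ)
    (e m : ℝ) : 1 ≤ systemConst M f g e m ∧
      (∀ j, e ^ 2 * (2 * formConst (f j)) ≤ systemConst M f g e m) ∧
      (∀ j, e ^ 2 * (2 * formConst (fun k => (omega m k : ℂ) * f j k)) ≤ systemConst M f g e m) ∧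
      (∀ j, e ^ 2 * (2 * formConst (fun k => (k.2 j : ℂ) * f j k)) ≤ systemConst M f g e m) ∧
      e ^ 2 * (3 * ∑ j, matConst (M j) * (2 * formConst (g j))) ≤ systemConst M f g e m := by
  have h1 : 0 ≤ ∑ j, matConst (M j) * (2 * formConst (g j)) :=
    Finset.sum_nonneg fun j _ => mul_nonneg (matConst_nonneg _) (by linarith [formConst_nonneg (g j)])
  let a : Fin 3 → ℝ := fun j => 2 * formConst (f j) +
    2 * formConst (fun k => (omega m k : ℂ) * f j k) + 2 * formConst (fun k => (k.2 j : ℂ) * f j k)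
  have h2 : ∀ j, 0 ≤ formConst (f j) ∧ 0 ≤ formConst (fun k => (omega m k : ℂ) * f j k) ∧
      0 ≤ formConst (fun k => (k.2 j : ℂ) * f j k) := fun j =>
    ⟨formConst_nonneg _, formConst_nonneg _, formConst_nonneg _⟩
  have ha0 : ∀ j, 0 ≤ a j := fun j => by
    obtain ⟨x, y, z⟩ := h2 j; simp only [a]; linarith
  have ha : ∀ j, a j ≤ ∑ i, a i := fun j =>
    Finset.single_le_sum (fun i _ => ha0 i) (Finset.mem_univ j)
  have he := sq_nonneg e
  have hs : systemConst M f g e m = 1 + e ^ 2 * (∑ i, a i +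
    3 * ∑ j, matConst (M j) * (2 * formConst (g j))) := rfl
  have hsum : 0 ≤ ∑ i, a i := Finset.sum_nonneg fun i _ => ha0 i
  have key : ∀ t, t ≤ ∑ i, a i + 3 * ∑ j, matConst (M j) * (2 * formConst (g j)) →
      e ^ 2 * t ≤ systemConst M f g e m := fun t ht => by
    rw [hs]; nlinarith [mul_le_mul_of_nonneg_left ht he]
  refine ⟨?_, fun j => key _ ?_, fun j => key _ ?_, fun j => key _ ?_, key _ ?_⟩
  · rw [hs]
    have : 0 ≤ e ^ 2 * (∑ i, a i + 3 * ∑ j, matConst (M j) * (2 * formConst (g j))) := by positivity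
    linarith
  all_goals try (have := ha j; obtain ⟨x, y, z⟩ := h2 j; simp only [a] at this ⊢; linarith)
  linarith

lemma momentumOp_dG (ξ : E3) (j : Fin 3) {w : Photon → ℝ} (hw : IsSymbol w) (ψ : coreSpace) :
    momentumOp ξ j (dG hw ψ) = dG hw (momentumOp ξ j ψ) := by
  simp only [momentumOp, LinearMap.sub_apply, LinearMap.smul_apply, LinearMap.id_apply, map_sub,
    map_smul, dG_comm (isSymbol_coord j)]

lemma norm_smul_sq_le {e a b C : ℝ} {ψ : coreSpace} (h : ‖coreEmb ψ‖ ^ 2 ≤ a * b)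
    (hb : 0 ≤ b) (hC : e ^ 2 * a ≤ C) : ‖coreEmb ((e : ℂ) • ψ)‖ ^ 2 ≤ C * b := by
  rw [map_smul, norm_smul, Complex.norm_real, mul_pow, Real.norm_eq_abs, sq_abs]
  calc _ ≤ e ^ 2 * (a * b) := by gcongr
    _ = e ^ 2 * a * b := by ring
    _ ≤ C * b := by gcongr

/-- The interacting system with momentum `ξ - P_f`, interaction `e φ(f)`, spin coupling
`e ∑ⱼ Mⱼ ⊗ φ(gⱼ)` and field energy `dΓ(ω_m)`. -/
def pauliSystem (e m : ℝ) (ξ : E3) : FieldSystem (redEmb d) :=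
  have hE : ∀ ψ, 0 ≤ ‖coreEmb ψ‖ ^ 2 + reInner coreEmb ψ (dG (isSymbol_omega m) ψ) := fun ψ =>
    add_nonneg (sq_nonneg _)
      (energy_nonneg (isSymbol_omega m) (fun k => Real.sqrt_nonneg _) ψ)
  have hC := systemConst_bounds M f g e m
  { Om := (dG (isSymbol_omega m)).compLeft (Fin d)
    p := fun j => (momentumOp ξ j).compLeft (Fin d)
    A := fun j => ((e : ℂ) • fieldOp (hf j)).compLeft (Fin d)
    W := (e : ℂ) • spinOp M hg
    C := systemConst M f g e m
    one_le := hC.1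
    symm_Om := inner_compLeft (inner_dG _)
    symm_p := fun j => inner_compLeft (inner_momentumOp ξ j)
    symm_A := fun j => inner_compLeft fun ψ φ => by
      simp [-Complex.coe_smul, inner_smul_left, inner_smul_right, inner_fieldOp, mul_comm]
    symm_W := fun ψ φ => by
      simp [-Complex.coe_smul, inner_smul_left, inner_smul_right, inner_spinOp hM, mul_comm]
    Om_nonneg := fun ψ => by
      rw [reInner_redEmb]
      exact Finset.sum_nonneg fun i _ =>
        energy_nonneg (isSymbol_omega m) (fun k => Real.sqrt_nonneg _) (ψ i)
    p_p := fun i j ψ => funext fun k => momentumOp_comm ξ i j (ψ k)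
    p_Om := fun j ψ => funext fun k => momentumOp_dG ξ j (isSymbol_omega m) (ψ k)
    A_le := fun j => norm_compLeft_sq_le fun ψ => norm_smul_sq_le
      (norm_fieldOp_sq_le (hf j) (isSymbol_omega m) (norm_le_omega m) ψ) (hE ψ) (hC.2.1 j)
    W_le := fun ψ => by
      have h := norm_spinOp_sq_le (M := M) hg m ψ
      have hb : 0 ≤ ‖redEmb d ψ‖ ^ 2 +
          reInner (redEmb d) ψ ((dG (isSymbol_omega m)).compLeft (Fin d) ψ) := by
        rw [reInner_redEmb, norm_sq_redEmb, ← Finset.sum_add_distrib]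
        exact Finset.sum_nonneg fun i _ => hE (ψ i)
      rw [LinearMap.smul_apply, map_smul, norm_smul, Complex.norm_real, mul_pow, Real.norm_eq_abs,
        sq_abs]
      refine (mul_le_mul_of_nonneg_left h (sq_nonneg e)).trans ?_
      rw [← mul_assoc]
      exact mul_le_mul_of_nonneg_right hC.2.2.2.2 hb
    Om_A_le := fun j => norm_compLeft_sq_le (T := dG (isSymbol_omega m) ∘ₗ ((e : ℂ) • fieldOp (hf j))
        - ((e : ℂ) • fieldOp (hf j)) ∘ₗ dG (isSymbol_omega m)) fun ψ => by
      have h := norm_smul_sq_le (e := e) (norm_commutator_fieldOp_sq_le (hf j) (isSymbol_omega m)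
        (norm_le_omega m) (isSymbol_omega m) ψ) (hE ψ) (hC.2.2.1 j)
      simpa [-Complex.coe_smul, smul_sub] using h
    p_A_le := fun j => norm_compLeft_sq_le (T := momentumOp ξ j ∘ₗ ((e : ℂ) • fieldOp (hf j))
        - ((e : ℂ) • fieldOp (hf j)) ∘ₗ momentumOp ξ j) fun ψ => by
      have h := norm_smul_sq_le (e := e) (norm_commutator_fieldOp_sq_le (hf j) (isSymbol_omega m)
        (norm_le_omega m) (isSymbol_coord j) ψ) (hE ψ) (hC.2.2.2.1 j)
      -- The scalar ξ_j commutes with the field, so only the commutator with dΓ(k_j) survives, with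
      -- a sign that the norm ignores.
      have h2 : (momentumOp ξ j ∘ₗ ((e : ℂ) • fieldOp (hf j)) -
          ((e : ℂ) • fieldOp (hf j)) ∘ₗ momentumOp ξ j) ψ = -((e : ℂ) •
          (dG (isSymbol_coord j) (fieldOp (hf j) ψ) -
            fieldOp (hf j) (dG (isSymbol_coord j) ψ))) := by
        simp only [momentumOp, LinearMap.sub_apply, LinearMap.comp_apply, LinearMap.smul_apply,
          LinearMap.id_apply, map_sub, map_smul]
        module
      rw [h2, map_neg, norm_neg]
      exact h }

end System

/-! ### The resolvent of the free operator -/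

/-- The symbol of the free operator `(ξ - P_f)² / 2 + H_f + c`. -/
def freeSymbol (m c : ℝ) (ξ : E3) (n : ℕ) (x : Fin n → Photon) : ℝ :=
  (1 / 2) * ∑ j, (ξ j - ∑ i, (x i).2 j) ^ 2 + ∑ i, omega m (x i) + c

lemma le_freeSymbol (m c : ℝ) (ξ : E3) (n : ℕ) (x : Fin n → Photon) : c ≤ freeSymbol m c ξ n x := by
  have h1 : 0 ≤ ∑ i, omega m (x i) := Finset.sum_nonneg fun i _ => Real.sqrt_nonneg _
  have h2 : 0 ≤ ∑ j, (ξ j - ∑ i, (x i).2 j) ^ 2 := Finset.sum_nonneg fun j _ => sq_nonneg _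
  unfold freeSymbol
  linarith

lemma isMultiplier_freeSymbol_inv (m : ℝ) {c : ℝ} (hc : 1 ≤ c) (ξ : E3) :
    IsMultiplier fun n x => (freeSymbol m c ξ n x)⁻¹ where
  measurable n := by
    unfold freeSymbol
    refine (Measurable.add_const (Measurable.add (Measurable.const_mul
      (Finset.measurable_sum _ fun j _ => ?_) _) ?_) _).inv
    · refine (measurable_const.sub (Finset.measurable_sum _ fun i _ => ?_)).pow_const 2
      exact (isSymbol_coord j).measurable.comp (measurable_pi_apply i)
    · exact ((isSymbol_omega m).isMultiplier).measurable n
  symmetric n π x := by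
    have h1 : ∀ j, ∑ i, (x (π i)).2 j = ∑ i, (x i).2 j := fun j =>
      Equiv.sum_comp π fun i => (x i).2 j
    have h2 : ∑ i, omega m (x (π i)) = ∑ i, omega m (x i) := Equiv.sum_comp π fun i => omega m (x i)
    simp only [freeSymbol, h1, h2]
  bounded R n := by
    refine ⟨1, zero_le_one, fun x _ => ?_⟩
    have h := hc.trans (le_freeSymbol m c ξ n x)
    rw [abs_of_nonneg (by positivity)]
    exact inv_le_one_of_one_le₀ h

section

variable {d : ℕ} {M : Fin 3 → Matrix (Fin d) (Fin d) ℂ} (hM : ∀ j, (M j).IsHermitian)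
  {f g : Fin 3 → Photon → ℂ} (hf : ∀ j, IsFormFactor (f j)) (hg : ∀ j, IsFormFactor (g j))
  (e m : ℝ) {c : ℝ} (hc : 1 ≤ c) (ξ : E3)

/-- The inverse of the free operator on the core. -/
def freeInv (d : ℕ) : (Fin d → coreSpace) →ₗ[ℂ] (Fin d → coreSpace) :=
  (multOp _ (isMultiplier_freeSymbol_inv m hc ξ)).compLeft (Fin d)

lemma freeInv_apply (ψ : Fin d → coreSpace) (i : Fin d) (n : ℕ) (x) :
    (freeInv m hc ξ d ψ i).1 n x = ((freeSymbol m c ξ n x : ℝ) : ℂ)⁻¹ * (ψ i).1 n x := by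
  change (((freeSymbol m c ξ n x)⁻¹ : ℝ) : ℂ) * _ = _
  rw [Complex.ofReal_inv]

lemma momentumOp_apply (j : Fin 3) (ψ : coreSpace) (n : ℕ) (x) : (momentumOp ξ j ψ).1 n x =
    ((ξ j - ∑ i, (x i).2 j : ℝ) : ℂ) * ψ.1 n x := by
  change (ξ j : ℂ) * ψ.1 n x - (dG (isSymbol_coord j) ψ).1 n x = _
  rw [dG_apply]; push_cast; ring

lemma pauliSystem_G_apply' (c : ℝ) (ψ : Fin d → coreSpace) (i : Fin d) :
    (pauliSystem hM hf hg e m ξ).G c ψ i =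
      ((1 / 2 : ℝ) : ℂ) • ∑ j, momentumOp ξ j (momentumOp ξ j (ψ i)) + dG (isSymbol_omega m) (ψ i) +
        (c : ℂ) • ψ i := by
  rw [FieldSystem.G_apply, FieldSystem.psq_apply]
  simp only [Pi.add_apply, Pi.smul_apply, Finset.sum_apply]
  rfl

/-- The free operator is a multiplication operator in momentum space, with symbol at least c, so its
inverse is explicit and preserves the core. -/
lemma pauliSystem_G_apply (ψ : Fin d → coreSpace) (i : Fin d) (n : ℕ) (x) :
    ((pauliSystem hM hf hg e m ξ).G c ψ i).1 n x =
      ((freeSymbol m c ξ n x : ℝ) : ℂ) * (ψ i).1 n x := by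
  rw [pauliSystem_G_apply', Fin.sum_univ_three]
  change ((1 / 2 : ℝ) : ℂ) * ((momentumOp ξ 0 (momentumOp ξ 0 (ψ i))).1 n x +
    (momentumOp ξ 1 (momentumOp ξ 1 (ψ i))).1 n x + (momentumOp ξ 2 (momentumOp ξ 2 (ψ i))).1 n x) +
    (dG (isSymbol_omega m) (ψ i)).1 n x + (c : ℂ) * (ψ i).1 n x = _
  simp only [momentumOp_apply, dG_apply, freeSymbol, Fin.sum_univ_three]
  push_cast
  ring

lemma G_freeInv (ψ : Fin d → coreSpace) :
    (pauliSystem hM hf hg e m ξ).G c (freeInv m hc ξ d ψ) = ψ := by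
  refine funext fun i => coreSpace_ext fun n x => ?_
  have h := hc.trans (le_freeSymbol m c ξ n x)
  rw [pauliSystem_G_apply, freeInv_apply, mul_inv_cancel_left₀]
  exact_mod_cast (by positivity : freeSymbol m c ξ n x ≠ 0)

lemma freeInv_G (ψ : Fin d → coreSpace) :
    freeInv m hc ξ d ((pauliSystem hM hf hg e m ξ).G c ψ) = ψ := by
  refine funext fun i => coreSpace_ext fun n x => ?_
  have h := hc.trans (le_freeSymbol m c ξ n x)
  rw [freeInv_apply, pauliSystem_G_apply, inv_mul_cancel_left₀]
  exact_mod_cast (by positivity : freeSymbol m c ξ n x ≠ 0)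

lemma inner_freeInv (ψ φ : Fin d → coreSpace) :
    inner ℂ (redEmb d (freeInv m hc ξ d ψ)) (redEmb d φ) =
      inner ℂ (redEmb d ψ) (redEmb d (freeInv m hc ξ d φ)) :=
  inner_compLeft (inner_coreEmb_multOp _ _) ψ φ

/-! ### Graph membership of the extended words -/

/-- The extension of `X (free operator)⁻¹`, for an operator `X` on the core. -/
def ext (X : (Fin d → coreSpace) →ₗ[ℂ] (Fin d → coreSpace)) :
    (PiLp 2 fun _ : Fin d => Fock) →L[ℂ] PiLp 2 fun _ : Fin d => Fock :=
  relExt (redEmb d) (freeInv m hc ξ d) X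

/-- The operators on the core that are bounded relative to the free operator. -/
def RelBounded (X : (Fin d → coreSpace) →ₗ[ℂ] (Fin d → coreSpace)) : Prop :=
  ∀ ψ, ext m hc ξ X (redEmb d ψ) = redEmb d (X (freeInv m hc ξ d ψ))

include hM hf hg e in
lemma relBounded_of_le {X : (Fin d → coreSpace) →ₗ[ℂ] (Fin d → coreSpace)} {N : ℝ}
    (h : ∀ ψ, ‖redEmb d (X ψ)‖ ≤ N * ‖redEmb d ((pauliSystem hM hf hg e m ξ).G c ψ)‖) :
    RelBounded m hc ξ X :=
  (pauliSystem hM hf hg e m ξ).relExt_apply_of_le_G denseRange_redEmb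
    (G_freeInv hM hf hg e m hc ξ) ⟨N, h⟩

variable {m hc ξ}

/-- Both extensions are continuous and agree with core operators on a dense set, so a closed
relation valid on the core holds everywhere. All graph statements about the actual operators come
from here. -/
lemma RelBounded.mem {X Y : (Fin d → coreSpace) →ₗ[ℂ] (Fin d → coreSpace)}
    (hX : RelBounded m hc ξ X) (hY : RelBounded m hc ξ Y) {i : Fin d} {Z : Set (Fock × Fock)}
    (hZ : IsClosed Z) (h : ∀ ψ, (coreEmb (X ψ i), coreEmb (Y ψ i)) ∈ Z)
    (y : PiLp 2 fun _ : Fin d => Fock) : (ext m hc ξ X y i, ext m hc ξ Y y i) ∈ Z := by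
  refine denseRange_redEmb.induction_on
    (p := fun y => (ext m hc ξ X y i, ext m hc ξ Y y i) ∈ Z) y (hZ.preimage ?_) fun ψ => ?_
  · exact ((PiLp.continuous_apply 2 _ i).comp (ContinuousLinearMap.continuous _)).prodMk
      ((PiLp.continuous_apply 2 _ i).comp (ContinuousLinearMap.continuous _))
  · rw [hX, hY]
    exact h _

attribute [irreducible] ext

/-- The component `j` of the momentum on the core of the reduced space. -/
abbrev pOp (d : ℕ) (ξ : E3) (j : Fin 3) : (Fin d → coreSpace) →ₗ[ℂ] (Fin d → coreSpace) :=
  (momentumOp ξ j).compLeft (Fin d)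

/-- The field operator on the core of the reduced space. -/
abbrev aOp (d : ℕ) {f : Photon → ℂ} (hf : IsFormFactor f) :
    (Fin d → coreSpace) →ₗ[ℂ] (Fin d → coreSpace) :=
  (fieldOp hf).compLeft (Fin d)

lemma coreEmb_momentumOp (ξ : E3) (j : Fin 3) (φ : coreSpace) :
    (ξ j : ℂ) • coreEmb φ - coreEmb (momentumOp ξ j φ) = coreEmb (dG (isSymbol_coord j) φ) := by
  rw [← map_smul, ← map_sub]
  congr 1
  exact sub_sub_cancel _ _

/-- The core operators represent ξ_j - P_j, while `fieldMomentum` is P_j; the shift translates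
between the two without losing closedness. -/
lemma isClosed_fieldMomentum_shift (a : ℂ) (j : Fin 3) :
    IsClosed {p : Fock × Fock | (p.1, a • p.1 - p.2) ∈ (fieldMomentum j).graph} := by
  rw [fieldMomentum, dGamma_graph]
  exact (isClosed_dGammaGraph (isSymbol_coord j)).preimage
    (continuous_fst.prodMk ((continuous_fst.const_smul a).sub continuous_snd))

lemma coreEmb_momentumOp_mem (ξ : E3) (j : Fin 3) (φ : coreSpace) :
    (coreEmb φ, coreEmb (momentumOp ξ j φ)) ∈
      {p : Fock × Fock | (p.1, (ξ j : ℂ) • p.1 - p.2) ∈ (fieldMomentum j).graph} := by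
  have h := coreEmb_mem_dGammaGraph (isSymbol_coord j) φ
  rw [Set.mem_ofPred_eq, coreEmb_momentumOp, fieldMomentum, dGamma_graph]
  exact h

lemma RelBounded.mem_fieldMomentum {X : (Fin d → coreSpace) →ₗ[ℂ] (Fin d → coreSpace)}
    (hX : RelBounded m hc ξ X) {j : Fin 3} (hY : RelBounded m hc ξ (pOp d ξ j ∘ₗ X)) (i : Fin d)
    (y : PiLp 2 fun _ : Fin d => Fock) :
    (ext m hc ξ X y i, (ξ j : ℂ) • ext m hc ξ X y i - ext m hc ξ (pOp d ξ j ∘ₗ X) y i) ∈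
      (fieldMomentum j).graph :=
  hX.mem hY (isClosed_fieldMomentum_shift (ξ j : ℂ) j)
    (fun ψ => coreEmb_momentumOp_mem ξ j (X ψ i)) y

lemma RelBounded.mem_field {X : (Fin d → coreSpace) →ₗ[ℂ] (Fin d → coreSpace)}
    (hX : RelBounded m hc ξ X) {f : Photon → ℂ} (hf : IsFormFactor f)
    (hY : RelBounded m hc ξ (aOp d hf ∘ₗ X)) (i : Fin d) (y : PiLp 2 fun _ : Fin d => Fock) :
    (ext m hc ξ X y i, ext m hc ξ (aOp d hf ∘ₗ X) y i) ∈ (field f).graph :=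
  hX.mem hY (isClosed_field_graph hf) (fun ψ => coreEmb_mem_field_graph hf (X ψ i)) y

lemma RelBounded.mem_velocity {X : (Fin d → coreSpace) →ₗ[ℂ] (Fin d → coreSpace)}
    (hX : RelBounded m hc ξ X) {f : Photon → ℂ} (hf : IsFormFactor f) {j : Fin 3}
    (hY : RelBounded m hc ξ (aOp d hf ∘ₗ X)) (hY' : RelBounded m hc ξ (pOp d ξ j ∘ₗ X))
    (i : Fin d) (y : PiLp 2 fun _ : Fin d => Fock) :
    (ext m hc ξ X y i, ext m hc ξ (pOp d ξ j ∘ₗ X) y i + (e : ℂ) • ext m hc ξ (aOp d hf ∘ₗ X) y i) ∈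
      (scalar (ξ j : ℂ) - fieldMomentum j + (e : ℂ) • field f).graph := by
  have h := mem_graph_add (mem_graph_sub (mem_graph_scalar (ξ j : ℂ) (ext m hc ξ X y i))
    (hX.mem_fieldMomentum hY' i y)) (mem_graph_smul (e : ℂ) (hX.mem_field hf hY i y))
  rwa [sub_sub_cancel] at h

end

/-! ### Products of momenta and fields, and the extended interacting operator -/

section

variable {d : ℕ} {M : Fin 3 → Matrix (Fin d) (Fin d) ℂ} (hM : ∀ j, (M j).IsHermitian)
  {f g : Fin 3 → Photon → ℂ} (hf : ∀ j, IsFormFactor (f j)) (hg : ∀ j, IsFormFactor (g j))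
  (e m : ℝ) {c : ℝ} (hc : 1 ≤ c) (ξ : E3)

/-- The system with a single form factor, unit coupling and without spin term. -/
def wordSystem (d : ℕ) {f : Photon → ℂ} (hf : IsFormFactor f) : FieldSystem (redEmb d) :=
  pauliSystem (M := 0) (fun _ => Matrix.isHermitian_zero) (fun _ => hf) (fun _ => hf) 1 m ξ

/-- Unit coupling yields bounds on the field operator itself, which e times the field would not give
when e = 0. -/
lemma wordSystem_A {f : Photon → ℂ} (hf : IsFormFactor f) (j : Fin 3) (ψ : Fin d → coreSpace) :
    (wordSystem m ξ d hf).A j ψ = aOp d hf ψ := by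
  funext i
  change ((1 : ℝ) : ℂ) • fieldOp hf (ψ i) = fieldOp hf (ψ i)
  simp

/-- The free operator contains no interaction, so a system with any coupling may be used to prove
boundedness relative to it. -/
lemma relBounded_of_le_word {f : Photon → ℂ} (hf : IsFormFactor f)
    {X : (Fin d → coreSpace) →ₗ[ℂ] (Fin d → coreSpace)} {N : ℝ}
    (h : ∀ ψ, ‖redEmb d (X ψ)‖ ≤ N * ‖redEmb d ((wordSystem m ξ d hf).G c ψ)‖) :
    RelBounded m hc ξ X :=
  relBounded_of_le _ _ _ _ m hc ξ h

lemma relBounded_a {f : Photon → ℂ} (hf : IsFormFactor f) : RelBounded m hc ξ (aOp d hf) :=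
  relBounded_of_le_word m hc ξ hf fun ψ => by
    simpa only [wordSystem_A] using (wordSystem m ξ d hf).norm_A_le_G hc ψ 0

lemma relBounded_a_p {f : Photon → ℂ} (hf : IsFormFactor f) (j : Fin 3) :
    RelBounded m hc ξ (aOp d hf ∘ₗ pOp d ξ j) :=
  relBounded_of_le_word m hc ξ hf fun ψ => by
    have h := (wordSystem m ξ d hf).norm_A_p_le_G hc ψ j
    rwa [wordSystem_A] at h

lemma relBounded_p_a {f : Photon → ℂ} (hf : IsFormFactor f) (j : Fin 3) :
    RelBounded m hc ξ (pOp d ξ j ∘ₗ aOp d hf) :=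
  relBounded_of_le_word m hc ξ hf fun ψ => by
    have h := (wordSystem m ξ d hf).norm_p_A_le_G hc ψ j
    rwa [wordSystem_A] at h

lemma relBounded_a_a {f : Photon → ℂ} (hf : IsFormFactor f) :
    RelBounded m hc ξ (aOp d hf ∘ₗ aOp d hf) :=
  relBounded_of_le_word m hc ξ hf fun ψ => by
    have h := (wordSystem m ξ d hf).norm_A_A_le_G hc ψ 0
    rwa [wordSystem_A, wordSystem_A] at h

include hf in
-- The form factor is immaterial here: some field is needed to build a `FieldSystem`, but the bound
-- concerns only its free part.
lemma relBounded_id : RelBounded m hc ξ (LinearMap.id : (Fin d → coreSpace) →ₗ[ℂ] _) :=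
  relBounded_of_le_word m hc ξ (hf 0) (N := 1) fun ψ => by
    simpa using (wordSystem m ξ d (hf 0)).norm_le_G hc ψ

include hf in
lemma relBounded_p (j : Fin 3) : RelBounded m hc ξ (pOp d ξ j) :=
  relBounded_of_le_word m hc ξ (hf 0) fun ψ => (wordSystem m ξ d (hf 0)).norm_p_le_G hc ψ j

include hf in
lemma relBounded_p_p (j : Fin 3) : RelBounded m hc ξ (pOp d ξ j ∘ₗ pOp d ξ j) :=
  relBounded_of_le_word m hc ξ (hf 0) fun ψ => (wordSystem m ξ d (hf 0)).norm_pp_le_G hc ψ j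

include hf in
lemma relBounded_Om : RelBounded m hc ξ ((dG (isSymbol_omega m)).compLeft (Fin d)) :=
  relBounded_of_le_word m hc ξ (hf 0) (N := 1) fun ψ => by
    rw [one_mul]; exact (wordSystem m ξ d (hf 0)).norm_Om_le_G hc ψ

lemma relBounded_matOp (M : Matrix (Fin d) (Fin d) ℂ) {f : Photon → ℂ} (hf : IsFormFactor f) :
    RelBounded m hc ξ (matOp M (fieldOp hf)) :=
  relBounded_of_le_word m hc ξ hf
    (N := Real.sqrt (matConst M) * (2 * (wordSystem m ξ d hf).C)) fun ψ => by
    have h := (wordSystem m ξ d hf).norm_A_le_G hc ψ 0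
    rw [wordSystem_A] at h
    have h2 := norm_matOp_sq_le M (fieldOp hf) ψ
    rw [mul_assoc]
    refine le_trans ?_ (mul_le_mul_of_nonneg_left h (Real.sqrt_nonneg _))
    refine le_of_sq_le ?_ (by positivity)
    rw [mul_pow, Real.sq_sqrt (matConst_nonneg M)]
    exact h2

lemma eq_of_eq_on_core {A B : (PiLp 2 fun _ : Fin d => Fock) →L[ℂ] PiLp 2 fun _ : Fin d => Fock}
    (h : ∀ ψ, A (redEmb d ψ) = B (redEmb d ψ)) : A = B :=
  DFunLike.coe_injective (denseRange_redEmb.equalizer A.continuous B.continuous (funext h))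

lemma ext_matOp (M : Matrix (Fin d) (Fin d) ℂ) {f : Photon → ℂ} (hf : IsFormFactor f)
    (y : PiLp 2 fun _ : Fin d => Fock) (i : Fin d) :
    ext m hc ξ (matOp M (fieldOp hf)) y i = ∑ k, M i k • ext m hc ξ (aOp d hf) y k := by
  have hcont : ∀ (X : (Fin d → coreSpace) →ₗ[ℂ] (Fin d → coreSpace)) (k : Fin d),
      Continuous fun y => ext m hc ξ X y k := fun X k =>
    (PiLp.continuous_apply 2 _ k).comp (ContinuousLinearMap.continuous _)
  refine denseRange_redEmb.induction_on
    (p := fun y => ext m hc ξ (matOp M (fieldOp hf)) y i = ∑ k, M i k • ext m hc ξ (aOp d hf) y k) y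
    (isClosed_eq (hcont _ i) (continuous_finsetSum _ fun k _ =>
      Continuous.const_smul (g := fun y => ext m hc ξ (aOp d hf) y k) (hcont _ k) (M i k))) fun ψ => ?_
  rw [relBounded_matOp m hc ξ M hf, relBounded_a m hc ξ hf]
  simp only [redEmb_apply, matOp_apply, map_sum, map_smul]
  rfl

/-- The extension of `(p + e φ(f))²`. -/
def velocitySq (d : ℕ) {f : Photon → ℂ} (hf : IsFormFactor f) (j : Fin 3) :
    (PiLp 2 fun _ : Fin d => Fock) →L[ℂ] PiLp 2 fun _ : Fin d => Fock :=
  ext m hc ξ (pOp d ξ j ∘ₗ pOp d ξ j) + (e : ℂ) • ext m hc ξ (aOp d hf ∘ₗ pOp d ξ j) +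
    (e : ℂ) • (ext m hc ξ (pOp d ξ j ∘ₗ aOp d hf) + (e : ℂ) • ext m hc ξ (aOp d hf ∘ₗ aOp d hf))

/-- The velocity acts on the extended identity, giving p + e φ(f) term by term; each of these two
vectors is again in the domain of the velocity because all words of length two are relatively
bounded. Linearity of the graph combines them. -/
lemma velocitySq_mem {f : Photon → ℂ} (hf : IsFormFactor f) (j : Fin 3)
    (y : PiLp 2 fun _ : Fin d => Fock) (i : Fin d) :
    (ext m hc ξ LinearMap.id y i, velocitySq e m hc ξ d hf j y i) ∈
      (comp (scalar (ξ j : ℂ) - fieldMomentum j + (e : ℂ) • field f)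
        (scalar (ξ j : ℂ) - fieldMomentum j + (e : ℂ) • field f)).graph := by
  have hp : RelBounded m hc ξ (pOp d ξ j) := relBounded_p (fun _ => hf) m hc ξ j
  have h1 := (relBounded_id (d := d) (fun _ => hf) m hc ξ).mem_velocity e hf
    (by rw [LinearMap.comp_id]; exact relBounded_a m hc ξ hf)
    (by rw [LinearMap.comp_id]; exact hp) i y
  rw [LinearMap.comp_id, LinearMap.comp_id] at h1
  have h2 := hp.mem_velocity e hf (relBounded_a_p m hc ξ hf j)
    (relBounded_p_p (fun _ => hf) m hc ξ j) i y
  have h3 := (relBounded_a (d := d) m hc ξ hf).mem_velocity e hf (relBounded_a_a m hc ξ hf)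
    (relBounded_p_a m hc ξ hf j) i y
  have h4 := Submodule.add_mem _ h2 (Submodule.smul_mem _ (e : ℂ) h3)
  rw [Prod.smul_mk, Prod.mk_add_mk] at h4
  have h5 : velocitySq e m hc ξ d hf j y i = ext m hc ξ (pOp d ξ j ∘ₗ pOp d ξ j) y i +
      (e : ℂ) • ext m hc ξ (aOp d hf ∘ₗ pOp d ξ j) y i +
      (e : ℂ) • (ext m hc ξ (pOp d ξ j ∘ₗ aOp d hf) y i +
        (e : ℂ) • ext m hc ξ (aOp d hf ∘ₗ aOp d hf) y i) := by
    simp only [velocitySq, add_apply, smul_apply,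
      PiLp.add_apply, PiLp.smul_apply]
  rw [h5]
  exact mem_graph_comp h1 h4

lemma pauliSystem_H_apply (ψ : Fin d → coreSpace) : (pauliSystem hM hf hg e m ξ).H ψ =
    ((1 / 2 : ℝ) : ℂ) • ∑ j, (pOp d ξ j (pOp d ξ j ψ) + (e : ℂ) • aOp d (hf j) (pOp d ξ j ψ) +
      (e : ℂ) • (pOp d ξ j (aOp d (hf j) ψ) + (e : ℂ) • aOp d (hf j) (aOp d (hf j) ψ))) +
    (e : ℂ) • ∑ j, matOp (M j) (fieldOp (hg j)) ψ + (dG (isSymbol_omega m)).compLeft (Fin d) ψ := by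
  have hv : ∀ j χ, (pauliSystem hM hf hg e m ξ).v j χ = pOp d ξ j χ + (e : ℂ) • aOp d (hf j) χ :=
    fun j χ => rfl
  have hW : (pauliSystem hM hf hg e m ξ).W ψ =
      (e : ℂ) • ∑ j, matOp (M j) (fieldOp (hg j)) ψ := by
    change (e : ℂ) • spinOp M hg ψ = _
    simp only [spinOp, LinearMap.sum_apply]
  have hO : (pauliSystem hM hf hg e m ξ).Om ψ = (dG (isSymbol_omega m)).compLeft (Fin d) ψ := rfl
  rw [FieldSystem.H_apply, FieldSystem.vsq_apply, hW, hO]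
  congr 3
  refine Finset.sum_congr rfl fun j _ => ?_
  rw [hv, hv, map_add, map_add, map_smul, map_smul]
  simp only [smul_add]
  abel

lemma redEmb_velocitySq {f : Photon → ℂ} (hf : IsFormFactor f) (j : Fin 3)
    (ψ : Fin d → coreSpace) : velocitySq e m hc ξ d hf j (redEmb d ψ) =
      redEmb d (pOp d ξ j (pOp d ξ j (freeInv m hc ξ d ψ)) +
        (e : ℂ) • aOp d hf (pOp d ξ j (freeInv m hc ξ d ψ)) +
        (e : ℂ) • (pOp d ξ j (aOp d hf (freeInv m hc ξ d ψ)) +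
          (e : ℂ) • aOp d hf (aOp d hf (freeInv m hc ξ d ψ)))) := by
  rw [map_add, map_add, map_smul, map_smul, map_add, map_smul]
  simp only [velocitySq, add_apply, smul_apply]
  rw [relBounded_p_p (fun _ => hf) m hc ξ j, relBounded_a_p m hc ξ hf j, relBounded_p_a m hc ξ hf j,
    relBounded_a_a m hc ξ hf]
  rfl

lemma map_smul_add_smul_add {V W : Type*} [AddCommGroup V] [Module ℂ V] [AddCommGroup W]
    [Module ℂ W] (J : V →ₗ[ℂ] W) (a b : ℂ) (x y z : V) :
    J (a • x + b • y + z) = a • J x + b • J y + J z := by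
  simp

lemma smul_sum_add_smul_sum_add_apply {W : Type*} [NormedAddCommGroup W] [NormedSpace ℂ W]
    {ι : Type*} [Fintype ι] (a b : ℂ) (A B : ι → W →L[ℂ] W) (C : W →L[ℂ] W) (y : W) :
    (a • ∑ j, A j + b • ∑ j, B j + C) y = a • ∑ j, A j y + b • ∑ j, B j y + C y := by
  simp

/-- Both sides are bounded and agree on the core. The decomposition is needed because the graph of
the Hamiltonian is assembled from the graphs of its summands. -/
lemma ext_H (y : PiLp 2 fun _ : Fin d => Fock) :
    ext m hc ξ (pauliSystem hM hf hg e m ξ).H y =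
      ((1 / 2 : ℝ) : ℂ) • ∑ j, velocitySq e m hc ξ d (hf j) j y +
        (e : ℂ) • ∑ j, ext m hc ξ (matOp (M j) (fieldOp (hg j))) y +
        ext m hc ξ ((dG (isSymbol_omega m)).compLeft (Fin d)) y := by
  have hH : RelBounded m hc ξ (pauliSystem hM hf hg e m ξ).H :=
    relBounded_of_le hM hf hg e m hc ξ fun ψ => (pauliSystem hM hf hg e m ξ).norm_H_le hc ψ
  have key : ext m hc ξ (pauliSystem hM hf hg e m ξ).H =
      ((1 / 2 : ℝ) : ℂ) • ∑ j, velocitySq e m hc ξ d (hf j) j +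
        (e : ℂ) • ∑ j, ext m hc ξ (matOp (M j) (fieldOp (hg j))) +
        ext m hc ξ ((dG (isSymbol_omega m)).compLeft (Fin d)) := by
    refine eq_of_eq_on_core fun ψ => ?_
    rw [hH, pauliSystem_H_apply]
    refine (map_smul_add_smul_add _ _ _ _ _ _).trans ?_
    refine Eq.trans ?_ (smul_sum_add_smul_sum_add_apply _ _ _ _ _ _).symm
    refine congrArg₂ (· + ·) (congrArg₂ (· + ·) (congrArg _ ?_) (congrArg _ ?_)) ?_
    · rw [map_sum]
      exact Finset.sum_congr rfl fun j _ => (redEmb_velocitySq e m hc ξ (hf j) j ψ).symm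
    · rw [map_sum]
      refine Finset.sum_congr rfl fun j _ => ?_
      exact (relBounded_matOp m hc ξ (M j) (hg j) ψ).symm
    · exact (relBounded_Om hf m hc ξ ψ).symm
  rw [key]
  exact smul_sum_add_smul_sum_add_apply _ _ _ _ _ _

end

/-! ### The extended free inverse maps into the domain of the Hamiltonian -/

section

variable {s : Spin} {ε : Fin 2 → E3 → E3} {Λ : ℝ} {f g : Fin 3 → Photon → ℂ}
  (hf : ∀ j, IsFormFactor (f j)) (hg : ∀ j, IsFormFactor (g j))
  (hfA : ∀ j, field (fA ε Λ j) = field (f j)) (hfB : ∀ j, field (fB ε Λ j) = field (g j))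
  (e m : ℝ) {c : ℝ} (hc : 1 ≤ c) (ξ : E3)

lemma isHermitian_spin (s : Spin) (j : Fin 3) : (s.matrices j).IsHermitian := by
  cases s with
  | zero => exact Matrix.isHermitian_zero
  | half =>
    refine Matrix.IsHermitian.ext fun a b => ?_
    change Fin 2 at a b
    fin_cases j <;> fin_cases a <;> fin_cases b <;> simp [Spin.matrices]

include hf in
lemma ext_id_mem_freeOperator (y : Reduced s) :
    ext m hc ξ LinearMap.id y ∈ (freeOperator s m).domain := by
  have hid := relBounded_id (d := s.dim) hf m hc ξ
  have hP : ∀ i j, ∃ b, (ext m hc ξ LinearMap.id y i, b) ∈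
      (comp (fieldMomentum j) (fieldMomentum j)).graph := by
    intro i j
    have hp : RelBounded m hc ξ (pOp s.dim ξ j) := relBounded_p hf m hc ξ j
    have h1 := hid.mem_fieldMomentum (j := j) (by rw [LinearMap.comp_id]; exact hp) i y
    rw [LinearMap.comp_id] at h1
    have h2 := hp.mem_fieldMomentum (relBounded_p_p hf m hc ξ j) i y
    have h3 := Submodule.sub_mem _ (Submodule.smul_mem _ (ξ j : ℂ) h1) h2
    rw [Prod.smul_mk, Prod.mk_sub_mk] at h3
    exact ⟨_, mem_graph_comp h1 h3⟩
  have hO : ∀ i, (ext m hc ξ LinearMap.id y i,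
      ext m hc ξ ((dG (isSymbol_omega m)).compLeft (Fin s.dim)) y i) ∈ (fieldEnergy m).graph := by
    intro i
    rw [fieldEnergy, dGamma_graph]
    exact hid.mem (relBounded_Om hf m hc ξ) (isClosed_dGammaGraph (isSymbol_omega m))
      (fun ψ => coreEmb_mem_dGammaGraph (isSymbol_omega m) (ψ i)) y
  choose b hb using hP
  exact fun i => LinearPMap.mem_domain_of_mem_graph
    (mem_graph_add (mem_graph_sum Finset.univ (hb i)) (hO i))

include hfA hfB in
-- One half of the identification of the Hamiltonian: on the range of the extended free inverse, the
-- operator with its natural domain takes the value prescribed by the core.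
lemma ext_H_mem_graph (y : Reduced s) :
    (ext m hc ξ LinearMap.id y, ext m hc ξ (pauliSystem (isHermitian_spin s) hf hg e m ξ).H y) ∈
      (hamiltonian s ε Λ e m ξ).graph := by
  refine mem_graph_domRestrict (ext_id_mem_freeOperator hf m hc ξ y) ?_
  have hid := relBounded_id (d := s.dim) hf m hc ξ
  rw [ext_H]
  refine mem_graph_add (mem_graph_add ?_ ?_) ?_
  · refine mem_graph_tensor_one fun i => ?_
    simp only [PiLp.smul_apply, WithLp.ofLp_sum, Finset.sum_apply]
    refine mem_graph_smul _ (mem_graph_sum _ fun j => ?_)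
    have h := velocitySq_mem e m hc ξ (hf j) j y i
    rw [← hfA j] at h
    exact h
  · refine mem_graph_smul _ (mem_graph_sum _ fun j => ?_)
    have h : ext m hc ξ (matOp (s.matrices j) (fieldOp (hg j))) y =
        WithLp.toLp 2 fun i => ∑ k, s.matrices j i k • ext m hc ξ (aOp s.dim (hg j)) y k := by
      ext1 i
      exact ext_matOp m hc ξ _ (hg j) y i
    rw [h]
    refine mem_graph_tensor _ fun i => ?_
    have h2 := hid.mem_field (hg j) (by rw [LinearMap.comp_id]; exact relBounded_a m hc ξ (hg j)) i y
    rw [LinearMap.comp_id, ← hfB j] at h2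
    exact h2
  · refine mem_graph_tensor_one fun i => ?_
    rw [fieldEnergy, dGamma_graph]
    exact hid.mem (relBounded_Om hf m hc ξ) (isClosed_dGammaGraph (isSymbol_omega m))
      (fun ψ => coreEmb_mem_dGammaGraph (isSymbol_omega m) (ψ i)) y

end

/-! ### The free domain is the whole range of the extended inverse -/

section

variable {s : Spin} {ε : Fin 2 → E3 → E3} {Λ : ℝ} {f g : Fin 3 → Photon → ℂ}
  (hf : ∀ j, IsFormFactor (f j)) (hg : ∀ j, IsFormFactor (g j))
  (e m : ℝ) {c : ℝ} (hc : 1 ≤ c) (ξ : E3)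

lemma inner_of_mem_fieldMomentum {j : Fin 3} {x a : Fock} (h : (x, a) ∈ (fieldMomentum j).graph)
    (η : coreSpace) : inner ℂ (coreEmb η) ((ξ j : ℂ) • x - a) =
      inner ℂ (coreEmb (momentumOp ξ j η)) x := by
  rw [fieldMomentum, dGamma_graph, mem_dGammaGraph_iff (isSymbol_coord j)] at h
  rw [momentumOp, LinearMap.sub_apply, LinearMap.smul_apply, LinearMap.id_apply, map_sub, map_smul,
    inner_sub_left, inner_sub_right, inner_smul_left, inner_smul_right, h, Complex.conj_ofReal]

include hf in
-- The free inverse is symmetric on the core; by density one of the two arguments may be arbitrary.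
lemma inner_ext_id (φ : Fin s.dim → coreSpace) (y : Reduced s) :
    inner ℂ (redEmb s.dim φ) (ext m hc ξ LinearMap.id y) =
      inner ℂ (redEmb s.dim (freeInv m hc ξ s.dim φ)) y := by
  refine denseRange_redEmb.induction_on (p := fun y => inner ℂ (redEmb s.dim φ)
    (ext m hc ξ LinearMap.id y) = inner ℂ (redEmb s.dim (freeInv m hc ξ s.dim φ)) y) y
    (isClosed_eq (continuous_const.inner (ContinuousLinearMap.continuous _))
      (continuous_const.inner continuous_id)) fun ψ => ?_
  rw [relBounded_id hf m hc ξ ψ, inner_freeInv]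
  rfl

lemma exists_of_mem_freeOperator_domain {x : Reduced s} (hx : x ∈ (freeOperator s m).domain)
    (i : Fin s.dim) : (∀ j, ∃ a b, (x i, a) ∈ (fieldMomentum j).graph ∧
      (a, b) ∈ (fieldMomentum j).graph) ∧ ∃ h, (x i, h) ∈ (fieldEnergy m).graph := by
  have h1 : x i ∈ (∑ j, comp (fieldMomentum j) (fieldMomentum j) + fieldEnergy m).domain := hx i
  rw [Fin.sum_univ_three, LinearPMap.add_domain, LinearPMap.add_domain,
    LinearPMap.add_domain] at h1
  obtain ⟨⟨⟨h0, h1⟩, h2⟩, h3⟩ := h1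
  refine ⟨fun j => ?_, _, LinearPMap.mem_graph _ ⟨x i, h3⟩⟩
  fin_cases j
  exacts [exists_of_mem_domain_comp h0, exists_of_mem_domain_comp h1, exists_of_mem_domain_comp h2]

lemma inner_free_combination {V 𝓗 ι : Type*} [AddCommGroup V] [Module ℂ V] [NormedAddCommGroup 𝓗]
    [InnerProductSpace ℂ 𝓗] [Fintype ι] (J : V →ₗ[ℂ] 𝓗) (η : V) (x : 𝓗) {a b : ℝ} {u : ι → 𝓗}
    {u' : ι → V} {v w : 𝓗} {v' : V} (hu : ∀ j, inner ℂ (J η) (u j) = inner ℂ (J (u' j)) x)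
    (hv : inner ℂ (J η) v = inner ℂ (J v') x) (hw : inner ℂ (J η) w = inner ℂ (J η) x) :
    inner ℂ (J η) ((a : ℂ) • ∑ j, u j + v + (b : ℂ) • w) =
      inner ℂ (J ((a : ℂ) • ∑ j, u' j + v' + (b : ℂ) • η)) x := by
  simp only [map_add, map_smul, map_sum, inner_add_left, inner_add_right, inner_smul_left,
    inner_smul_right, inner_sum, sum_inner, hu, hv, hw, Complex.conj_ofReal]

include hf in
-- Let y be the shifted free operator applied to x. Tested against a core vector φ, the extended
-- inverse of y gives ⟨G⁻¹φ, y⟩ = ⟨G G⁻¹φ, x⟩ = ⟨φ, x⟩, since the inverse preserves the core. So the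
-- natural domain contains nothing beyond what the core generates.
lemma exists_ext_id_eq {x : Reduced s} (hx : x ∈ (freeOperator s m).domain) :
    ∃ y, ext m hc ξ LinearMap.id y = x := by
  have hP := fun i => (exists_of_mem_freeOperator_domain m hx i).1
  have hO := fun i => (exists_of_mem_freeOperator_domain m hx i).2
  choose a b hab using hP
  choose h hh using hO
  let y : Reduced s := WithLp.toLp 2 fun i => ((1 / 2 : ℝ) : ℂ) •
    ∑ j, ((ξ j : ℂ) • ((ξ j : ℂ) • x i - a i j) - ((ξ j : ℂ) • a i j - b i j)) + h i + (c : ℂ) • x i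
  have hy : ∀ i (η : coreSpace), inner ℂ (coreEmb η) (y i) =
      inner ℂ (coreEmb (((1 / 2 : ℝ) : ℂ) • ∑ j, momentumOp ξ j (momentumOp ξ j η) +
        dG (isSymbol_omega m) η + (c : ℂ) • η)) (x i) := by
    intro i η
    have h1 : ∀ j, inner ℂ (coreEmb η)
        ((ξ j : ℂ) • ((ξ j : ℂ) • x i - a i j) - ((ξ j : ℂ) • a i j - b i j)) =
        inner ℂ (coreEmb (momentumOp ξ j (momentumOp ξ j η))) (x i) := by
      intro j
      have h2 := Submodule.sub_mem _ (Submodule.smul_mem _ (ξ j : ℂ) (hab i j).1) (hab i j).2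
      rw [Prod.smul_mk, Prod.mk_sub_mk] at h2
      rw [inner_of_mem_fieldMomentum ξ h2, inner_of_mem_fieldMomentum ξ (hab i j).1]
    have h3 : inner ℂ (coreEmb η) (h i) = inner ℂ (coreEmb (dG (isSymbol_omega m) η)) (x i) := by
      have := hh i
      rw [fieldEnergy, dGamma_graph, mem_dGammaGraph_iff (isSymbol_omega m)] at this
      exact this η
    change inner ℂ (coreEmb η) (((1 / 2 : ℝ) : ℂ) • ∑ j, ((ξ j : ℂ) • ((ξ j : ℂ) • x i - a i j) -
      ((ξ j : ℂ) • a i j - b i j)) + h i + (c : ℂ) • x i) = _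
    exact inner_free_combination coreEmb η (x i) (h1 ·) h3 rfl
  -- Equality in the Hilbert space is checked weakly, against the dense core.
  refine ⟨y, denseRange_redEmb.eq_of_inner_right ℂ fun φ => ?_⟩
  rw [inner_ext_id hf]
  have h4 := G_freeInv (d := s.dim) (isHermitian_spin s) hf hf 1 m hc ξ φ
  set χ := freeInv m hc ξ s.dim φ
  rw [← h4, PiLp.inner_apply, PiLp.inner_apply]
  refine Finset.sum_congr rfl fun i _ => ?_
  rw [redEmb_apply, redEmb_apply, pauliSystem_G_apply', hy]

end

/-! ### Reduction of the coupling functions to form factors -/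

/-- Coupling functions matter only up to null sets, since each coordinate projection pulls null sets
back to null sets. -/
lemma createGraph_congr {f f' : Photon → ℂ} (h : f =ᵐ[photonMeasure] f') :
    createGraph f = createGraph f' := by
  have key : ∀ (n : ℕ) (φ : (Fin n → Photon) → ℂ),
      createFun f φ =ᵐ[confMeasure (n + 1)] createFun f' φ := by
    intro n φ
    have h1 : ∀ i : Fin (n + 1), ∀ᵐ x ∂confMeasure (n + 1), f (x i) = f' (x i) := fun i =>
      (Measure.quasiMeasurePreserving_eval (fun _ : Fin (n + 1) => photonMeasure) i).ae_eq_comp h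
    filter_upwards [ae_all_iff.2 h1] with x hx
    simp only [createFun, hx]
  ext p
  exact and_congr_right fun _ => forall_congr' fun n =>
    ⟨fun h => h.trans (key n _), fun h => h.trans (key n _).symm⟩

lemma field_congr {f f' : Photon → ℂ} (h : f =ᵐ[photonMeasure] f') : field f = field f' := by
  rw [field, field, annihilate, annihilate, create, create, createGraph_congr h]

/-- Polarization vectors are normalized only almost everywhere, so the envelope bound may fail on a
null set; setting f to zero there does not change the field operator. -/
lemma exists_isFormFactor {f : Photon → ℂ} (hf : Measurable f) (h0 : ∀ k, k.2 = 0 → f k = 0)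
    {R C : ℝ} (hC : 0 ≤ C) (hb : ∀ᵐ k ∂photonMeasure, ‖f k‖ ≤ C * envelope R k) :
    ∃ f', IsFormFactor f' ∧ field f = field f' := by
  let U : Set Photon := {k | ‖f k‖ ≤ C * envelope R k}
  have hU : MeasurableSet U := measurableSet_le hf.norm ((measurable_envelope R).const_mul C)
  refine ⟨U.indicator f, ⟨hf.indicator hU, ⟨R, C, hC, fun k => ?_⟩, fun k hk => ?_⟩,
    field_congr ?_⟩
  · by_cases hk : k ∈ U
    · rw [Set.indicator_of_mem hk]; exact hk
    · rw [Set.indicator_of_notMem hk, norm_zero]; exact mul_nonneg hC (envelope_nonneg R k)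
  · exact Set.indicator_apply_eq_zero.2 fun _ => h0 k hk
  · filter_upwards [hb] with k hk
    exact (Set.indicator_of_mem (s := U) hk f).symm

section Coupling

variable {ε : Fin 2 → E3 → E3} (hε : IsPolarization ε) (Λ : ℝ)

lemma measurable_rho : Measurable (rho Λ) := by
  unfold rho
  exact measurable_const.mul
    ((measurable_const.indicator measurableSet_Icc).comp measurable_norm)

include hε in
lemma measurable_fAVec (j : Fin 3) : Measurable fun x => fAVec ε Λ x j := by
  have h1 : Measurable fun x : Photon => ε x.1 x.2 :=
    measurable_from_prod_countable_right fun l => hε.measurable l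
  have h2 : Measurable fun x : Photon => ε x.1 x.2 j :=
    (measurable_pi_apply j).comp ((WithLp.measurable_ofLp 2 _).comp h1)
  exact (((measurable_rho Λ).comp measurable_snd).div (measurable_norm.comp measurable_snd).sqrt).mul
    h2

lemma abs_fAVec_le {x : Photon} (hx : ‖ε x.1 x.2‖ = 1) (j : Fin 3) :
    |fAVec ε Λ x j| ≤ envelope Λ x := by
  have h1 : |ε x.1 x.2 j| ≤ 1 := hx ▸ abs_coord_le _ _
  have h2 : (2 * Real.pi) ^ (-(3 / 2) : ℝ) ≤ 1 :=
    Real.rpow_le_one_of_one_le_of_nonpos (by linarith [Real.pi_gt_three]) (by norm_num)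
  have h3 : 0 ≤ (2 * Real.pi) ^ (-(3 / 2) : ℝ) := by positivity
  have e1 : fAVec ε Λ x j = rho Λ x.2 / Real.sqrt ‖x.2‖ * ε x.1 x.2 j := rfl
  by_cases hk : ‖x.2‖ ≤ Λ
  · have h4 : rho Λ x.2 = (2 * Real.pi) ^ (-(3 / 2) : ℝ) := by
      rw [rho, Set.indicator_of_mem (show ‖x.2‖ ∈ Set.Icc 0 Λ from ⟨norm_nonneg _, hk⟩), mul_one]
    have h5 : envelope Λ x = 1 + (Real.sqrt ‖x.2‖)⁻¹ :=
      Set.indicator_of_mem (by simpa using hk) _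
    rw [e1, h4, h5, abs_mul, abs_div, abs_of_nonneg h3, abs_of_nonneg (Real.sqrt_nonneg _),
      div_eq_mul_inv]
    have h6 : 0 ≤ (Real.sqrt ‖x.2‖)⁻¹ := by positivity
    calc _ ≤ 1 * (Real.sqrt ‖x.2‖)⁻¹ * 1 := by gcongr
      _ ≤ _ := by linarith
  · have h4 : rho Λ x.2 = 0 := by
      rw [rho, Set.indicator_of_notMem (fun h => hk h.2), mul_zero]
    rw [e1, h4]; simp [envelope_nonneg]

include hε in
lemma ae_norm_polarization : ∀ᵐ x ∂photonMeasure, ‖ε x.1 x.2‖ = 1 := by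
  have h1 : ∀ᵐ x ∂photonMeasure, Orthonormal ℝ ![‖x.2‖⁻¹ • x.2, ε 0 x.2, ε 1 x.2] := by
    have : Measure.QuasiMeasurePreserving (Prod.snd : Photon → E3) photonMeasure volume :=
      Measure.quasiMeasurePreserving_snd
    exact this.ae hε.orthonormal
  filter_upwards [h1] with x hx
  obtain ⟨l, k⟩ := x
  fin_cases l
  · exact hx.1 1
  · exact hx.1 2

lemma fAVec_eq_zero {x : Photon} (hx : x.2 = 0) : fAVec ε Λ x = 0 := by
  funext j
  -- At k = 0 the factor 1/√|k| is a division by zero with default value 0.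
  simp [fAVec, hx]

include hε in
lemma exists_isFormFactor_fA (j : Fin 3) :
    ∃ f, IsFormFactor f ∧ field (fA ε Λ j) = field f := by
  refine exists_isFormFactor (R := Λ) (C := 1)
    (Complex.measurable_ofReal.comp (measurable_fAVec hε Λ j)) (fun k hk => ?_) zero_le_one ?_
  · simp [fA, fAVec_eq_zero Λ hk]
  · filter_upwards [ae_norm_polarization hε] with x hx
    rw [fA, Complex.norm_real, one_mul]
    exact abs_fAVec_le Λ hx j

lemma abs_crossProduct_le {u v : Fin 3 → ℝ} {a b : ℝ} (hu : ∀ j, |u j| ≤ a) (hv : ∀ j, |v j| ≤ b)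
    (j : Fin 3) : |crossProduct u v j| ≤ 2 * (a * b) := by
  have h : ∀ i k, |u i * v k| ≤ a * b := fun i k => by
    rw [abs_mul]
    exact mul_le_mul (hu i) (hv k) (abs_nonneg _) ((abs_nonneg _).trans (hu i))
  rw [cross_apply]
  fin_cases j
  · exact (abs_sub _ _).trans (by linarith [h 1 2, h 2 1])
  · exact (abs_sub _ _).trans (by linarith [h 2 0, h 0 2])
  · exact (abs_sub _ _).trans (by linarith [h 0 1, h 1 0])

include hε in
lemma exists_isFormFactor_fB (j : Fin 3) :
    ∃ f, IsFormFactor f ∧ field (fB ε Λ j) = field f := by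
  have hm : Measurable (fB ε Λ j) := by
    refine measurable_const.mul (Complex.measurable_ofReal.comp ?_)
    have h := measurable_fAVec hε Λ
    have hk : ∀ i, Measurable fun x : Photon => x.2 i := fun i => by fun_prop
    simp only [cross_apply]
    fin_cases j
    · exact ((hk 1).mul (h 2)).sub ((hk 2).mul (h 1))
    · exact ((hk 2).mul (h 0)).sub ((hk 0).mul (h 2))
    · exact ((hk 0).mul (h 1)).sub ((hk 1).mul (h 0))
  refine exists_isFormFactor (R := Λ) (C := 2 * |Λ|) hm (fun k hk => ?_) (by positivity) ?_
  · simp [fB, fAVec_eq_zero Λ hk]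
  · filter_upwards [ae_norm_polarization hε] with x hx
    rw [fB, norm_mul, norm_neg, Complex.norm_I, one_mul, Complex.norm_real, Real.norm_eq_abs]
    refine (abs_crossProduct_le (fun i => abs_coord_le x.2 i) (fun i => abs_fAVec_le Λ hx i) j).trans ?_
    by_cases hk : ‖x.2‖ ≤ Λ
    · rw [mul_assoc]
      have := envelope_nonneg Λ x
      have h2 := hk.trans (le_abs_self Λ)
      gcongr
    · simp [envelope_eq_zero hk]

end Coupling

/-! ### The ground state energy as an infimum of quadratic forms -/

lemma exists_coreEmb_ne_zero : ∃ ψ : coreSpace, coreEmb ψ ≠ 0 := by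
  -- The vacuum vector.
  let ψ : coreSpace := singleCore 0 (fun _ => 1) measurable_const (fun _ _ => rfl)
    ⟨0, 1, zero_le_one, fun x => by simp⟩
  refine ⟨ψ, fun h => ?_⟩
  have h1 := norm_coreEmb_apply ψ 0
  have h2 : ψ.1 0 = fun _ => 1 := Pi.single_eq_same (M := fun n => (Fin n → Photon) → ℂ) 0 _
  rw [h, h2] at h1
  simp [confMeasure, Measure.pi_of_empty] at h1

instance (s : Spin) : Nontrivial (Reduced s) := by
  obtain ⟨ψ, hψ⟩ := exists_coreEmb_ne_zero
  have : 0 < s.dim := by cases s <;> simp [Spin.dim]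
  refine ⟨redEmb s.dim fun _ => ψ, 0, fun h => hψ ?_⟩
  exact congrArg (fun y : Reduced s => y ⟨0, this⟩) h

section

variable {s : Spin} {ε : Fin 2 → E3 → E3} {Λ : ℝ} {f g : Fin 3 → Photon → ℂ}
  (hf : ∀ j, IsFormFactor (f j)) (hg : ∀ j, IsFormFactor (g j))
  (hfA : ∀ j, field (fA ε Λ j) = field (f j)) (hfB : ∀ j, field (fB ε Λ j) = field (g j))
  (e m : ℝ) (ξ : E3)

include hfA hfB in
-- `ext_H_mem_graph` and `exists_ext_id_eq` say that the Hamiltonian on its natural domain is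
-- determined by the core. Invertibility at one large shift and symmetry on the core then identify
-- the bottom of the spectrum with the infimum of the form.
theorem groundEnergy_eq_sInf_formRange : groundEnergy s ε Λ e m ξ =
    sInf (formRange (redEmb s.dim) (pauliSystem (isHermitian_spin s) hf hg e m ξ).H) := by
  set S := pauliSystem (isHermitian_spin s) hf hg e m ξ with hS
  have hc : 1 ≤ 8 * S.C := by linarith [S.one_le]
  have h1 := fun y : Reduced s => ext_H_mem_graph hf hg hfA hfB e m hc ξ y
  have h2 : ∀ x ∈ (hamiltonian s ε Λ e m ξ).domain, ∃ y, ext m hc ξ LinearMap.id y = x :=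
    fun x hx => exists_ext_id_eq hf m hc ξ hx.1
  simp only [ext] at h1 h2
  exact S.sInf_spectrum_eq denseRange_redEmb (G_freeInv (isHermitian_spin s) hf hg e m hc ξ) le_rfl
    (freeInv_G (isHermitian_spin s) hf hg e m hc ξ) h1 h2

/-- The operator `-P_f + e φ(f)` on the core. -/
def driftOp (d : ℕ) (j : Fin 3) : (Fin d → coreSpace) →ₗ[ℂ] (Fin d → coreSpace) :=
  pOp d 0 j + (e : ℂ) • aOp d (hf j)

/-- The part of the quadratic form that does not depend on the total momentum. -/
def restForm (M : Fin 3 → Matrix (Fin s.dim) (Fin s.dim) ℂ) (ψ : Fin s.dim → coreSpace) : ℝ :=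
  (1 / 2) * ∑ j, ‖redEmb s.dim (driftOp hf e s.dim j ψ)‖ ^ 2 +
    e * reInner (redEmb s.dim) ψ (spinOp M hg ψ) +
    reInner (redEmb s.dim) ψ ((dG (isSymbol_omega m)).compLeft (Fin s.dim) ψ)

/-- The velocity depends on ξ only through the scalar ξ_j, so expanding the square at a unit vector
gives ‖ξ‖²/2, a linear term in ξ, and a term independent of ξ. Concavity of the energy after
subtraction of ‖ξ‖²/2 rests on this. -/
lemma form_pauliSystem {M : Fin 3 → Matrix (Fin s.dim) (Fin s.dim) ℂ} (hM : ∀ j, (M j).IsHermitian)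
    {ψ : Fin s.dim → coreSpace}
    (hψ : ‖redEmb s.dim ψ‖ = 1) :
    reInner (redEmb s.dim) ψ ((pauliSystem hM hf hg e m ξ).H ψ) =
      ‖ξ‖ ^ 2 / 2 + (∑ j, ξ j * reInner (redEmb s.dim) ψ (driftOp hf e s.dim j ψ) +
        restForm hf hg e m M ψ) := by
  set S := pauliSystem hM hf hg e m ξ with hS
  have hv : ∀ j, S.v j ψ = (ξ j : ℂ) • ψ + driftOp hf e s.dim j ψ := by
    intro j
    funext i
    change momentumOp ξ j (ψ i) + (e : ℂ) • fieldOp (hf j) (ψ i) =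
      (ξ j : ℂ) • ψ i + (momentumOp 0 j (ψ i) + (e : ℂ) • fieldOp (hf j) (ψ i))
    simp only [momentumOp, LinearMap.sub_apply, LinearMap.smul_apply, LinearMap.id_apply,
      PiLp.zero_apply, Complex.ofReal_zero, zero_smul, LinearMap.zero_apply]
    abel
  have hv2 : ∀ j, reInner (redEmb s.dim) ψ (S.v j (S.v j ψ)) = ξ j ^ 2 +
      2 * (ξ j * reInner (redEmb s.dim) ψ (driftOp hf e s.dim j ψ)) +
      ‖redEmb s.dim (driftOp hf e s.dim j ψ)‖ ^ 2 := by
    intro j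
    rw [← S.re_symm_v, hv, reInner_add_left, reInner_add_right, reInner_add_right,
      reInner_smul_left, reInner_smul_left, reInner_smul_right, reInner_smul_right, reInner_self,
      reInner_self, hψ, reInner_comm _ (driftOp hf e s.dim j ψ) ψ]
    ring
  have hW : S.W ψ = (e : ℂ) • spinOp M hg ψ := rfl
  have hO : S.Om ψ = (dG (isSymbol_omega m)).compLeft (Fin s.dim) ψ := rfl
  rw [FieldSystem.H_apply, FieldSystem.vsq_apply, reInner_add_right, reInner_add_right,
    reInner_smul_right, reInner_sum_right, hW, reInner_smul_right, hO, restForm,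
    EuclideanSpace.real_norm_sq_eq]
  simp only [hv2, Finset.sum_add_distrib, ← Finset.mul_sum]
  ring

end

/-! ### Dependence of the field energy on the photon mass -/

lemma dG_sub {w w' : Photon → ℝ} (hw : IsSymbol w) (hw' : IsSymbol w')
    (h : IsSymbol fun k => w k - w' k) (ψ : coreSpace) : dG h ψ = dG hw ψ - dG hw' ψ := by
  refine coreSpace_ext fun n x => ?_
  change (dG h ψ).1 n x = (dG hw ψ).1 n x - (dG hw' ψ).1 n x
  simp only [dG_apply, Finset.sum_sub_distrib]
  push_cast; ring

lemma IsSymbol.sub {w w' : Photon → ℝ} (hw : IsSymbol w) (hw' : IsSymbol w') :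
    IsSymbol fun k => w k - w' k where
  measurable := hw.measurable.sub hw'.measurable
  bounded R := by
    obtain ⟨C, hC, h⟩ := hw.bounded R
    obtain ⟨C', hC', h'⟩ := hw'.bounded R
    exact ⟨C + C', add_nonneg hC hC', fun k hk =>
      (abs_sub _ _).trans (add_le_add (h k hk) (h' k hk))⟩

lemma isSymbol_const (a : ℝ) : IsSymbol fun _ => a :=
  ⟨measurable_const, fun _ => ⟨|a|, abs_nonneg a, fun _ _ => le_rfl⟩⟩

lemma reInner_dG_mono {w w' : Photon → ℝ} (hw : IsSymbol w) (hw' : IsSymbol w') (h : ∀ k, w k ≤ w' k)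
    (ψ : coreSpace) : reInner coreEmb ψ (dG hw ψ) ≤ reInner coreEmb ψ (dG hw' ψ) := by
  have h1 := energy_nonneg (hw'.sub hw) (fun k => sub_nonneg.2 (h k)) ψ
  rw [dG_sub hw' hw, reInner_sub_right] at h1
  linarith

lemma omega_zero_le (m : ℝ) (k : Photon) : omega 0 k ≤ omega m k :=
  Real.sqrt_le_sqrt (by nlinarith [sq_nonneg m])

/-- Hence the massive field energy exceeds the massless one by at most |m| times the number
operator. -/
lemma omega_sub_le (m : ℝ) (k : Photon) : omega m k - omega 0 k ≤ |m| := by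
  have h1 : omega 0 k = ‖k.2‖ := by simp [omega]
  have h2 : omega m k ≤ |m| + ‖k.2‖ := by
    refine (Real.sqrt_le_left (by positivity)).2 ?_
    nlinarith [sq_abs m, abs_nonneg m, norm_nonneg k.2, mul_nonneg (abs_nonneg m) (norm_nonneg k.2)]
  linarith

lemma reInner_dG_const (a : ℝ) (ψ : coreSpace) : reInner coreEmb ψ (dG (isSymbol_const a) ψ) =
    a * reInner coreEmb ψ (dG (isSymbol_const 1) ψ) := by
  rw [← reInner_smul_right]
  congr 1
  refine coreSpace_ext fun n x => ?_
  change (dG (isSymbol_const a) ψ).1 n x = (a : ℂ) * (dG (isSymbol_const 1) ψ).1 n x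
  simp only [dG_apply, Finset.sum_const]
  push_cast [nsmul_eq_mul]
  ring

/-- Squeeze between the massless form and the massless form plus |m| times the photon number. No
uniformity over the core is required. -/
lemma tendsto_reInner_dG_omega (ψ : coreSpace) :
    Tendsto (fun m => reInner coreEmb ψ (dG (isSymbol_omega m) ψ)) (𝓝 0)
      (𝓝 (reInner coreEmb ψ (dG (isSymbol_omega 0) ψ))) := by
  set a := reInner coreEmb ψ (dG (isSymbol_omega 0) ψ)
  set b := reInner coreEmb ψ (dG (isSymbol_const 1) ψ)
  have hup : Tendsto (fun m : ℝ => a + |m| * b) (𝓝 0) (𝓝 a) := by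
    have : Continuous fun m : ℝ => a + |m| * b := by fun_prop
    simpa using this.tendsto 0
  refine tendsto_of_tendsto_of_tendsto_of_le_of_le tendsto_const_nhds hup
    (fun m => reInner_dG_mono _ _ (omega_zero_le m) ψ) fun m => ?_
  have h1 := reInner_dG_mono ((isSymbol_omega m).sub (isSymbol_omega 0)) (isSymbol_const |m|)
    (omega_sub_le m) ψ
  rw [dG_sub (isSymbol_omega m) (isSymbol_omega 0), reInner_sub_right, reInner_dG_const] at h1
  change reInner coreEmb ψ (dG (isSymbol_omega m) ψ) ≤ a + |m| * b
  linarith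

/-- Up to `ξ² / 2`, the ground state energy is an infimum of affine functions of `ξ`, whose
constant terms converge from above as the photon mass goes to zero. -/
theorem exists_groundEnergy_eq_iInf (s : Spin) {ε : Fin 2 → E3 → E3} (hε : IsPolarization ε)
    (Λ e : ℝ) : ∃ (X : Type) (b : X → E3) (a : ℝ → X → ℝ), Nonempty X ∧
      (∀ x, Tendsto (fun m => a m x) (𝓝 0) (𝓝 (a 0 x))) ∧ (∀ m x, a 0 x ≤ a m x) ∧
      (∀ m ξ, BddBelow (Set.range fun x => inner ℝ ξ (b x) + a m x)) ∧
      ∀ m ξ, groundEnergy s ε Λ e m ξ = ‖ξ‖ ^ 2 / 2 + ⨅ x, (inner ℝ ξ (b x) + a m x) := by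
  choose f hf hfA using exists_isFormFactor_fA hε Λ
  choose g hg hgB using exists_isFormFactor_fB hε Λ
  let X : Type := {ψ : Fin s.dim → coreSpace // ‖redEmb s.dim ψ‖ = 1}
  -- The slope of the affine function is the expectation of -P_f + e A.
  let b : X → E3 := fun ψ => WithLp.toLp 2 fun j =>
    reInner (redEmb s.dim) ψ.1 (driftOp hf e s.dim j ψ.1)
  let a : ℝ → X → ℝ := fun m ψ => restForm hf hg e m s.matrices ψ.1
  have hb : ∀ (ξ : E3) (ψ : X), inner ℝ ξ (b ψ) =
      ∑ j, ξ j * reInner (redEmb s.dim) ψ.1 (driftOp hf e s.dim j ψ.1) := fun ξ ψ => by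
    rw [PiLp.inner_apply]
    exact Finset.sum_congr rfl fun j _ => mul_comm _ _
  have hform : ∀ m ξ (ψ : X), reInner (redEmb s.dim) ψ.1
      ((pauliSystem (isHermitian_spin s) hf hg e m ξ).H ψ.1) =
        ‖ξ‖ ^ 2 / 2 + (inner ℝ ξ (b ψ) + a m ψ) := fun m ξ ψ => by
    rw [form_pauliSystem hf hg e m ξ (isHermitian_spin s) ψ.2, hb]
  have hne : Nonempty X := by
    obtain ⟨_, ψ, hψ, -⟩ := formRange_nonempty (denseRange_redEmb (d := s.dim)) LinearMap.id
    exact ⟨ψ, hψ⟩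
  have hbdd : ∀ m ξ, BddBelow (Set.range fun x => inner ℝ ξ (b x) + a m x) := by
    intro m ξ
    refine ⟨-(pauliSystem (isHermitian_spin s) hf hg e m ξ).C - ‖ξ‖ ^ 2 / 2, ?_⟩
    rintro _ ⟨ψ, rfl⟩
    have h1 := (pauliSystem (isHermitian_spin s) hf hg e m ξ).form_H_ge le_rfl ψ.1
    rw [hform, ψ.2] at h1
    simp only at h1 ⊢
    linarith
  refine ⟨X, b, a, hne, fun ψ => ?_, fun m ψ => ?_, hbdd, fun m ξ => ?_⟩
  · refine Tendsto.add tendsto_const_nhds ?_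
    simp only [reInner_redEmb]
    exact tendsto_finsetSum _ fun i _ => tendsto_reInner_dG_omega _
  · refine add_le_add le_rfl ?_
    simp only [reInner_redEmb]
    exact Finset.sum_le_sum fun i _ => reInner_dG_mono (isSymbol_omega 0) (isSymbol_omega m) (omega_zero_le m) _
  · rw [groundEnergy_eq_sInf_formRange hf hg hfA hgB]
    have h1 : formRange (redEmb s.dim) (pauliSystem (isHermitian_spin s) hf hg e m ξ).H =
        Set.range fun ψ : X => ‖ξ‖ ^ 2 / 2 + (inner ℝ ξ (b ψ) + a m ψ) := by
      ext r
      constructor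
      · rintro ⟨ψ, hψ, rfl⟩
        exact ⟨⟨ψ, hψ⟩, (hform m ξ ⟨ψ, hψ⟩).symm⟩
      · rintro ⟨ψ, rfl⟩
        exact ⟨ψ.1, ψ.2, (hform m ξ ψ).symm⟩
    rw [h1]
    exact (add_ciInf (hbdd m ξ) _).symm

/-! ### Convex functions -/

/-- A real convex function on a finite-dimensional space is differentiable almost everywhere. -/
lemma ae_differentiableAt_of_convexOn {E : Type*} [NormedAddCommGroup E] [NormedSpace ℝ E]
    [FiniteDimensional ℝ E] [MeasurableSpace E] [BorelSpace E] (μ : Measure E)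
    [μ.IsAddHaarMeasure] {f : E → ℝ} (hf : ConvexOn ℝ Set.univ f) :
    ∀ᵐ x ∂μ, DifferentiableAt ℝ f x := by
  have hl : ∀ x, ∃ U ∈ 𝓝 x, ∃ K, LipschitzOnWith K f U := fun x => by
    obtain ⟨K, U, hU, h⟩ := hf.locallyLipschitzOn isOpen_univ (Set.mem_univ x)
    rw [nhdsWithin_univ] at hU
    exact ⟨U, hU, K, h⟩
  choose U hU K hK using hl
  -- Convex functions are locally Lipschitz; countably many such neighborhoods cover the space, and
  -- Rademacher's theorem applies on each.
  obtain ⟨t, ht, htU⟩ := TopologicalSpace.countable_cover_nhds fun x => interior_mem_nhds.2 (hU x)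
  have h1 : ∀ᵐ x ∂μ, ∀ y ∈ t, x ∈ interior (U y) → DifferentiableAt ℝ f x := by
    rw [ae_ball_iff ht]
    intro y _
    filter_upwards [((hK y).mono interior_subset).ae_differentiableWithinAt_of_mem (μ := μ)]
      with x hx hxU
    exact (hx hxU).differentiableAt (isOpen_interior.mem_nhds hxU)
  filter_upwards [h1] with x hx
  have hxt : x ∈ ⋃ y ∈ t, interior (U y) := htU ▸ Set.mem_univ x
  obtain ⟨y, hy, hxy⟩ := Set.mem_iUnion₂.1 hxt
  exact hx y hy hxy

/-- Derivatives of pointwise convergent convex functions converge. -/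
lemma tendsto_of_convexOn_of_hasDerivAt {φ : ℕ → ℝ → ℝ} {φ₀ : ℝ → ℝ} {d : ℕ → ℝ} {d₀ : ℝ}
    (hφ : ∀ j, ConvexOn ℝ Set.univ (φ j)) (hlim : ∀ t, Tendsto (fun j => φ j t) atTop (𝓝 (φ₀ t)))
    (hd : ∀ j, HasDerivAt (φ j) (d j) 0) (hd₀ : HasDerivAt φ₀ d₀ 0) :
    Tendsto d atTop (𝓝 d₀) := by
  have hslope := (hasDerivAt_iff_tendsto_slope.1 hd₀)
  have hjs : ∀ t, Tendsto (fun j => slope (φ j) 0 t) atTop (𝓝 (slope φ₀ 0 t)) := fun t => by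
    simp only [slope_def_field]
    exact ((hlim t).sub (hlim 0)).div_const _
  refine tendsto_order.2 ⟨fun a ha => ?_, fun a ha => ?_⟩
  · have h1 : ∀ᶠ t in 𝓝[<] (0 : ℝ), a < slope φ₀ 0 t :=
      (hslope.mono_left (nhdsWithin_mono _ fun t ht => ne_of_lt ht)).eventually_const_lt ha
    obtain ⟨t, ht, ht0⟩ := (h1.and self_mem_nhdsWithin).exists
    filter_upwards [(hjs t).eventually_const_lt ht] with j hj
    refine hj.trans_le ?_
    rw [slope_comm]
    exact (hφ j).slope_le_of_hasDerivAt (Set.mem_univ _) (Set.mem_univ _) ht0 (hd j)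
  · have h1 : ∀ᶠ t in 𝓝[>] (0 : ℝ), slope φ₀ 0 t < a :=
      (hslope.mono_left (nhdsWithin_mono _ fun t ht => ne_of_gt ht)).eventually_lt_const ha
    obtain ⟨t, ht, ht0⟩ := (h1.and self_mem_nhdsWithin).exists
    filter_upwards [(hjs t).eventually_lt_const ht] with j hj
    exact ((hφ j).le_slope_of_hasDerivAt (Set.mem_univ _) (Set.mem_univ _) ht0 (hd j)).trans_lt hj

/-! ### Derivatives of monotone functions -/

/-- The right derivative. -/
def rightD (φ : ℝ → ℝ) (t : ℝ) : ℝ := derivWithin φ (Set.Ioi t) t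

lemma monotone_rightD {φ : ℝ → ℝ} (hφ : ConvexOn ℝ Set.univ φ) : Monotone (rightD φ) := fun x y h =>
  hφ.monotoneOn_rightDeriv (by simp) (by simp) h

lemma rightD_eq_deriv {φ : ℝ → ℝ} {t : ℝ} (h : DifferentiableAt ℝ φ t) : rightD φ t = deriv φ t :=
  h.derivWithin (uniqueDiffWithinAt_Ioi t)

lemma hasDerivWithinAt_rightD {φ : ℝ → ℝ} (hφ : ConvexOn ℝ Set.univ φ) (t : ℝ) :
    HasDerivWithinAt φ (rightD φ t) (Set.Ioi t) t :=
  hφ.hasDerivWithinAt_rightDeriv_of_mem_interior (by simp)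

/-- Together with `le_rightD`, this bounds increments of the right derivative by values of the
function, so pointwise convergence makes the increments on a bounded interval eventually bounded. -/
lemma rightD_le {φ : ℝ → ℝ} (hφ : ConvexOn ℝ Set.univ φ) (t : ℝ) :
    rightD φ t ≤ φ (t + 1) - φ t := by
  have h := hφ.rightDeriv_le_slope_of_mem_interior (x := t) (y := t + 1) (by simp) (by simp) (by simp)
  rw [rightD]
  simpa [slope_def_field] using h

lemma le_rightD {φ : ℝ → ℝ} (hφ : ConvexOn ℝ Set.univ φ) (t : ℝ) :
    φ t - φ (t - 1) ≤ rightD φ t := by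
  have h := hφ.slope_le_leftDeriv_of_mem_interior (x := t - 1) (y := t) (by simp) (by simp) (by simp)
  have h2 := hφ.leftDeriv_le_rightDeriv_of_mem_interior (x := t) (by simp)
  refine le_trans ?_ (h.trans h2)
  simp [slope_def_field]

/-- For a monotone function only an inequality can hold, since jumps and singular parts do not
contribute; it follows from Fatou's lemma along an approximating sequence. -/
lemma lintegral_deriv_le {r : ℝ → ℝ} (hr : Monotone r) {a b : ℝ} (hab : a ≤ b) :
    ∫⁻ x in Set.Icc a b, ENNReal.ofReal (deriv r x) ≤ ENNReal.ofReal (r b - r a) := by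
  obtain ⟨G, hG, hm, hle⟩ :=
    (hr.monotoneOn (Set.Icc a b)).exists_tendsto_deriv_liminf_lintegral_enorm_le hab
  refine le_trans (lintegral_mono fun x => ?_)
    ((lintegral_enorm_le_liminf_of_tendsto hG fun n => (hm n).aemeasurable.enorm).trans hle)
  rw [← ofReal_norm]
  exact ENNReal.ofReal_le_ofReal (Real.le_norm_self _)

/-- For convex functions that are pointwise bounded, the lower limit of the second derivatives is
finite almost everywhere. -/
lemma ae_liminf_deriv_rightD_lt_top {φ : ℕ → ℝ → ℝ} {φ₀ : ℝ → ℝ}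
    (hφ : ∀ j, ConvexOn ℝ Set.univ (φ j))
    (hlim : ∀ t, Tendsto (fun j => φ j t) atTop (𝓝 (φ₀ t))) :
    ∀ᵐ t : ℝ, liminf (fun j => ENNReal.ofReal (deriv (rightD (φ j)) t)) atTop < ⊤ := by
  have key : ∀ N : ℕ, ∀ᵐ t ∂volume.restrict (Set.Icc (-N : ℝ) N),
      liminf (fun j => ENNReal.ofReal (deriv (rightD (φ j)) t)) atTop < ⊤ := by
    intro N
    have hN : (-N : ℝ) ≤ N := by linarith [(Nat.cast_nonneg N : (0 : ℝ) ≤ N)]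
    have hb : Tendsto (fun j => (φ j (N + 1) - φ j N) - (φ j (-N) - φ j (-N - 1))) atTop
        (𝓝 ((φ₀ (N + 1) - φ₀ N) - (φ₀ (-N) - φ₀ (-N - 1)))) :=
      ((hlim _).sub (hlim _)).sub ((hlim _).sub (hlim _))
    have hm : ∀ j, Measurable fun t => ENNReal.ofReal (deriv (rightD (φ j)) t) := fun j =>
      (measurable_deriv _).ennreal_ofReal
    refine ae_lt_top (.liminf hm) (ne_of_lt ?_)
    -- Fatou's lemma: the lower limit has finite integral on [-N, N], hence is finite almost
    -- everywhere there.
    refine (lintegral_liminf_le hm).trans_lt ?_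
    have h1 : ∀ j, ∫⁻ t in Set.Icc (-N : ℝ) N, ENNReal.ofReal (deriv (rightD (φ j)) t) ≤
        ENNReal.ofReal ((φ j (N + 1) - φ j N) - (φ j (-N) - φ j (-N - 1))) := fun j =>
      (lintegral_deriv_le (monotone_rightD (hφ j)) hN).trans (ENNReal.ofReal_le_ofReal (by
        linarith [rightD_le (hφ j) N, le_rightD (hφ j) (-N)]))
    refine (liminf_le_liminf (Eventually.of_forall h1)).trans_lt ?_
    rw [(ENNReal.tendsto_ofReal hb).liminf_eq]
    exact ENNReal.ofReal_lt_top
  have key2 : ∀ᵐ t : ℝ, ∀ N : ℕ, t ∈ Set.Icc (-N : ℝ) N →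
      liminf (fun j => ENNReal.ofReal (deriv (rightD (φ j)) t)) atTop < ⊤ :=
    ae_all_iff.2 fun N => (ae_restrict_iff' measurableSet_Icc).1 (key N)
  filter_upwards [key2] with t ht
  obtain ⟨N, hN⟩ := exists_nat_ge |t|
  exact ht N (abs_le.1 hN)

/-- For a monotone function, convergence of the difference quotients along `1 / n` implies
convergence from the right. -/
lemma hasDerivWithinAt_of_tendsto_nat {r : ℝ → ℝ} (hr : Monotone r) {q : ℝ}
    (h : Tendsto (fun n : ℕ => (n : ℝ) * (r (n : ℝ)⁻¹ - r 0)) atTop (𝓝 q)) :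
    HasDerivWithinAt r q (Set.Ioi 0) 0 := by
  rw [hasDerivWithinAt_iff_tendsto_slope' (by simp)]
  set s : ℕ → ℝ := fun n => (n : ℝ) * (r (n : ℝ)⁻¹ - r 0) with hs
  have hN : Tendsto (fun t : ℝ => ⌊t⁻¹⌋₊) (𝓝[>] 0) atTop :=
    tendsto_nat_floor_atTop.comp tendsto_inv_nhdsGT_zero
  have h1 : Tendsto (fun n : ℕ => ((n : ℝ) + 1) / n) atTop (𝓝 1) := by
    have : Tendsto (fun n : ℕ => 1 + ((n : ℝ))⁻¹) atTop (𝓝 (1 + 0)) :=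
      tendsto_const_nhds.add tendsto_inv_atTop_nhds_zero_nat
    rw [add_zero] at this
    refine this.congr' ?_
    filter_upwards [eventually_gt_atTop 0] with n hn
    have : (n : ℝ) ≠ 0 := by exact_mod_cast hn.ne'
    field_simp
    try ring
  have h2 : Tendsto (fun n : ℕ => (n : ℝ) / (n + 1)) atTop (𝓝 1) := by
    simpa using h1.inv₀ one_ne_zero
  have hup : Tendsto (fun t : ℝ => s ⌊t⁻¹⌋₊ * ((⌊t⁻¹⌋₊ + 1 : ℝ) / ⌊t⁻¹⌋₊)) (𝓝[>] 0) (𝓝 q) := by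
    have := (h.mul h1).comp hN
    rwa [mul_one] at this
  have hlow : Tendsto (fun t : ℝ => s (⌊t⁻¹⌋₊ + 1) * ((⌊t⁻¹⌋₊ : ℝ) / (⌊t⁻¹⌋₊ + 1))) (𝓝[>] 0)
      (𝓝 q) := by
    have := ((h.comp (tendsto_add_atTop_nat 1)).mul h2).comp hN
    rwa [mul_one] at this
  have hev : ∀ᶠ t : ℝ in 𝓝[>] 0, 0 < t ∧ 0 < ⌊t⁻¹⌋₊ :=
    Filter.Eventually.and self_mem_nhdsWithin (hN.eventually_gt_atTop 0)
  -- For n = ⌊1/t⌋ one has 1/(n+1) ≤ t ≤ 1/n. Monotonicity compares the quotient at t with those at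
  -- the two end points, up to the factors n/(n+1) and (n+1)/n, which tend to 1.
  refine tendsto_of_tendsto_of_tendsto_of_le_of_le' hlow hup ?_ ?_
  · filter_upwards [hev] with t ⟨ht, hn⟩
    set n := ⌊t⁻¹⌋₊
    have hn0 : (0 : ℝ) < n := by exact_mod_cast hn
    have hlt : t⁻¹ < n + 1 := Nat.lt_floor_add_one _
    have hle : (n : ℝ) ≤ t⁻¹ := Nat.floor_le (by positivity)
    have ht1 : ((n : ℝ) + 1)⁻¹ ≤ t := by
      rw [inv_le_comm₀ (by positivity) ht]; exact hlt.le
    have hmono : r ((n : ℝ) + 1)⁻¹ - r 0 ≤ r t - r 0 := sub_le_sub_right (hr ht1) _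
    have h0 : 0 ≤ r t - r 0 := sub_nonneg.2 (hr ht.le)
    have e1 : s (n + 1) * ((n : ℝ) / (n + 1)) = n * (r ((n : ℝ) + 1)⁻¹ - r 0) := by
      simp only [hs]; push_cast; field_simp
    rw [e1, slope_def_field, sub_zero, div_eq_inv_mul]
    calc _ ≤ n * (r t - r 0) := by gcongr
      _ ≤ _ := by gcongr
  · filter_upwards [hev] with t ⟨ht, hn⟩
    set n := ⌊t⁻¹⌋₊
    have hn0 : (0 : ℝ) < n := by exact_mod_cast hn
    have hlt : t⁻¹ < n + 1 := Nat.lt_floor_add_one _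
    have hle : (n : ℝ) ≤ t⁻¹ := Nat.floor_le (by positivity)
    have ht1 : t ≤ (n : ℝ)⁻¹ := by rw [le_inv_comm₀ ht hn0]; exact hle
    have hmono : r t - r 0 ≤ r (n : ℝ)⁻¹ - r 0 := sub_le_sub_right (hr ht1) _
    have h0 : 0 ≤ r t - r 0 := sub_nonneg.2 (hr ht.le)
    have e1 : s n * (((n : ℝ) + 1) / n) = (n + 1) * (r (n : ℝ)⁻¹ - r 0) := by
      simp only [hs]; field_simp
    rw [e1, slope_def_field, sub_zero, div_eq_inv_mul]
    calc _ ≤ ((n : ℝ) + 1) * (r t - r 0) := by gcongr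
      _ ≤ _ := by gcongr

/-- The left side is reduced to the right side by t ↦ -r(-t), which is again monotone.
Differentiability is thus expressed by two sequences, which makes its set of points measurable. -/
lemma hasDerivAt_of_tendsto_nat {r : ℝ → ℝ} (hr : Monotone r) {q : ℝ}
    (h : Tendsto (fun n : ℕ => (n : ℝ) * (r (n : ℝ)⁻¹ - r 0)) atTop (𝓝 q))
    (h' : Tendsto (fun n : ℕ => (n : ℝ) * (r 0 - r (-(n : ℝ)⁻¹))) atTop (𝓝 q)) :
    HasDerivAt r q 0 := by
  have h1 := hasDerivWithinAt_of_tendsto_nat hr h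
  have h2 : HasDerivWithinAt (fun t => -r (-t)) q (Set.Ioi 0) 0 := by
    refine hasDerivWithinAt_of_tendsto_nat (fun x y hxy => neg_le_neg (hr (neg_le_neg hxy))) ?_
    refine h'.congr fun n => ?_
    rw [neg_zero]; ring
  have h3 : HasDerivWithinAt r q (Set.Iio 0) 0 := by
    have h4 : HasDerivWithinAt (fun t : ℝ => -t) (-1) (Set.Iio 0) 0 := (hasDerivAt_neg 0).hasDerivWithinAt
    have h5 : HasDerivWithinAt (fun t => -r (-t)) q (Set.Ioi 0) (-0) := by rwa [neg_zero]
    have h6 := (h5.comp (0 : ℝ) h4 fun x (hx : x < 0) => (by simpa using hx : 0 < -x)).neg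
    simpa [Function.comp_def, Pi.neg_def] using h6
  have := h3.Iic_of_Iio.union h1.Ici_of_Ioi
  rwa [Set.Iic_union_Ici, hasDerivWithinAt_univ] at this

lemma tendsto_nat_of_hasDerivAt {r : ℝ → ℝ} {q t : ℝ} (h : HasDerivAt r q t) :
    Tendsto (fun n : ℕ => (n : ℝ) * (r (t + (n : ℝ)⁻¹) - r t)) atTop (𝓝 q) ∧
      Tendsto (fun n : ℕ => (n : ℝ) * (r t - r (t - (n : ℝ)⁻¹))) atTop (𝓝 q) := by
  have h1 := hasDerivAt_iff_tendsto_slope_zero.1 h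
  have hn : Tendsto (fun n : ℕ => ((n : ℝ))⁻¹) atTop (𝓝[≠] 0) := by
    refine tendsto_nhdsWithin_iff.2 ⟨tendsto_inv_atTop_nhds_zero_nat, ?_⟩
    filter_upwards [eventually_gt_atTop 0] with n hn
    have : (n : ℝ) ≠ 0 := by exact_mod_cast hn.ne'
    simpa using this
  have hn' : Tendsto (fun n : ℕ => -((n : ℝ))⁻¹) atTop (𝓝[≠] 0) := by
    refine tendsto_nhdsWithin_iff.2 ⟨by simpa using tendsto_inv_atTop_nhds_zero_nat (𝕜 := ℝ) |>.neg, ?_⟩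
    filter_upwards [eventually_gt_atTop 0] with n hn
    have : (n : ℝ) ≠ 0 := by exact_mod_cast hn.ne'
    simpa using this
  refine ⟨(h1.comp hn).congr fun n => ?_, (h1.comp hn').congr fun n => ?_⟩
  · simp
  · simp [inv_neg, ← sub_eq_add_neg]
    ring

/-! ### Convex functions along lines -/

section Lines

variable {E : Type*} [NormedAddCommGroup E] [NormedSpace ℝ E]

/-- The restriction of `g` to the line through `x` in direction `u`. -/
def line (g : E → ℝ) (u x : E) (t : ℝ) : ℝ := g (x + t • u)

lemma convexOn_line {g : E → ℝ} (hg : ConvexOn ℝ Set.univ g) (u x : E) :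
    ConvexOn ℝ Set.univ (line g u x) := by
  refine ⟨convex_univ, fun s _ t _ a b ha hb hab => ?_⟩
  have h := hg.2 (Set.mem_univ (x + s • u)) (Set.mem_univ (x + t • u)) ha hb hab
  have e : a • (x + s • u) + b • (x + t • u) = x + (a • s + b • t) • u := by
    have : a • x + b • x = x := by rw [← add_smul, hab, one_smul]
    rw [smul_add, smul_add, add_add_add_comm, this, add_smul, smul_assoc, smul_assoc]
  rw [e] at h
  exact h

lemma line_add (g : E → ℝ) (u x : E) (t s : ℝ) : line g u (x + t • u) s = line g u x (t + s) := by
  rw [line, line, add_assoc, add_smul]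

/-- The right partial derivative in direction `u`. -/
def rightPartial (g : E → ℝ) (u x : E) : ℝ := rightD (line g u x) 0

/-- On each line the right partial derivative becomes the monotone right derivative of a single
function of one variable. -/
lemma rightPartial_add {g : E → ℝ} (hg : ConvexOn ℝ Set.univ g) (u x : E) (t : ℝ) :
    rightPartial g u (x + t • u) = rightD (line g u x) t := by
  have h1 := hasDerivWithinAt_rightD (convexOn_line hg u x) (t + 0)
  have h2 : HasDerivWithinAt (fun s : ℝ => t + s) 1 (Set.Ioi 0) 0 :=
    ((hasDerivAt_id 0).const_add t).hasDerivWithinAt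
  have h3 := h1.comp (0 : ℝ) h2 fun s (hs : 0 < s) => (by simpa using hs : t + 0 < t + s)
  have h4 : line g u x ∘ (fun s => t + s) = line g u (x + t • u) :=
    funext fun s => (line_add g u x t s).symm
  rw [h4, mul_one, add_zero] at h3
  exact h3.derivWithin (uniqueDiffWithinAt_Ioi 0)

lemma tendsto_rightPartial {g : E → ℝ} (hg : ConvexOn ℝ Set.univ g) (u x : E) :
    Tendsto (fun n : ℕ => (n : ℝ) * (g (x + (n : ℝ)⁻¹ • u) - g x)) atTop
      (𝓝 (rightPartial g u x)) := by
  have h1 := (hasDerivWithinAt_iff_tendsto_slope' (by simp)).1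
    (hasDerivWithinAt_rightD (convexOn_line hg u x) 0)
  have hn : Tendsto (fun n : ℕ => ((n : ℝ))⁻¹) atTop (𝓝[>] 0) := by
    refine tendsto_nhdsWithin_iff.2 ⟨tendsto_inv_atTop_nhds_zero_nat, ?_⟩
    filter_upwards [eventually_gt_atTop 0] with n hn
    have : (0 : ℝ) < n := by exact_mod_cast hn
    simpa using this
  refine (h1.comp hn).congr fun n => ?_
  simp [slope_def_field, line, div_eq_mul_inv, mul_comm]

variable [MeasurableSpace E] [BorelSpace E]

/-- The right derivative always exists for a convex function, so it is a pointwise limit of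
continuous difference quotients. -/
lemma measurable_rightPartial {g : E → ℝ} (hg : ConvexOn ℝ Set.univ g) (hc : Continuous g) (u : E) :
    Measurable (rightPartial g u) := by
  refine measurable_of_tendsto_metrizable (f := fun (n : ℕ) x =>
    (n : ℝ) * (g (x + (n : ℝ)⁻¹ • u) - g x)) (fun n => ?_)
    (tendsto_pi_nhds.2 fun x => tendsto_rightPartial hg u x)
  have : Continuous fun x => (n : ℝ) * (g (x + (n : ℝ)⁻¹ • u) - g x) := by fun_prop
  exact this.measurable

/-- Almost everywhere, the second derivatives of pointwise convergent convex functions in a given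
direction exist, and their lower limit is finite. -/
theorem ae_exists_hasDerivAt_rightD [FiniteDimensional ℝ E] (μ : Measure E)
    [μ.IsAddHaarMeasure] {g : ℕ → E → ℝ} {g₀ : E → ℝ}
    (hg : ∀ j, ConvexOn ℝ Set.univ (g j)) (hlim : ∀ x, Tendsto (fun j => g j x) atTop (𝓝 (g₀ x)))
    (u : E) : ∀ᵐ x ∂μ, ∃ q : ℕ → ℝ, (∀ j, HasDerivAt (rightD (line (g j) u x)) (q j) 0) ∧
      liminf (fun j => ENNReal.ofReal (q j)) atTop < ⊤ := by
  let R : ℕ → E → ℝ := fun j => rightPartial (g j) u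
  have hR : ∀ j, Measurable (R j) := fun j => by
    refine measurable_rightPartial (hg j) ?_ u
    exact continuousOn_univ.1 ((hg j).continuousOn isOpen_univ)
  let a : ℕ → ℕ → E → ℝ := fun j n x => (n : ℝ) * (R j (x + (n : ℝ)⁻¹ • u) - R j x)
  let b : ℕ → ℕ → E → ℝ := fun j n x => (n : ℝ) * (R j x - R j (x + (-(n : ℝ)⁻¹) • u))
  have ha : ∀ j n, Measurable (a j n) := fun j n =>
    (((hR j).comp (measurable_add_const _)).sub (hR j)).const_mul _
  have hb : ∀ j n, Measurable (b j n) := fun j n =>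
    ((hR j).sub ((hR j).comp (measurable_add_const _))).const_mul _
  -- Fubini requires a measurable set. The first condition asks for a limit of the right quotients,
  -- the second makes the left quotients converge to the same limit, and the third bounds the lower
  -- limit of the derivatives.
  let s : Set E := (⋂ j, {x | ∃ q, Tendsto (fun n => a j n x) atTop (𝓝 q)}) ∩
    (⋂ j, {x | Tendsto (fun n => a j n x - b j n x) atTop (𝓝 0)}) ∩
    {x | liminf (fun j => liminf (fun n => ENNReal.ofReal (a j n x)) atTop) atTop < ⊤}
  have hs : MeasurableSet s := by
    refine ((MeasurableSet.iInter fun j => measurableSet_exists_tendsto (ha j)).inter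
      (MeasurableSet.iInter fun j => measurableSet_tendsto _ fun n => (ha j n).sub (hb j n))).inter ?_
    refine measurableSet_lt (.liminf fun j => ?_) measurable_const
    exact .liminf fun n => (ha j n).ennreal_ofReal
  have hmem : ∀ᵐ x ∂μ, x ∈ s := by
    -- Fubini along the direction `u`: a measurable set that meets every line with this direction in
    -- almost all parameters has full measure.
    refine ae_mem_of_ae_add_linearMap_mem (LinearMap.toSpanSingleton ℝ E u) volume μ hs fun x => ?_
    have h1 : ∀ᵐ t : ℝ, ∀ j, DifferentiableAt ℝ (rightD (line (g j) u x)) t :=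
      ae_all_iff.2 fun j => (monotone_rightD (convexOn_line (hg j) u x)).ae_differentiableAt
    have h2 := ae_liminf_deriv_rightD_lt_top (φ := fun j => line (g j) u x) (φ₀ := line g₀ u x)
      (fun j => convexOn_line (hg j) u x) fun t => hlim _
    filter_upwards [h1, h2] with t ht1 ht2
    have hRt : ∀ j (c : ℝ), R j (x + t • u + c • u) = rightD (line (g j) u x) (t + c) :=
      fun j c => by rw [add_assoc, ← add_smul]; exact rightPartial_add (hg j) u x _
    have hR0 : ∀ j, R j (x + t • u) = rightD (line (g j) u x) t :=
      fun j => rightPartial_add (hg j) u x _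
    have hlimits := fun j => tendsto_nat_of_hasDerivAt (ht1 j).hasDerivAt
    have hA : ∀ j, Tendsto (fun n => a j n (x + t • u)) atTop
        (𝓝 (deriv (rightD (line (g j) u x)) t)) := fun j => by
      refine (hlimits j).1.congr fun n => ?_
      simp only [a, hRt, hR0]
    have hB : ∀ j, Tendsto (fun n => b j n (x + t • u)) atTop
        (𝓝 (deriv (rightD (line (g j) u x)) t)) := fun j => by
      refine (hlimits j).2.congr fun n => ?_
      simp only [b, hRt, hR0, sub_eq_add_neg]
    rw [LinearMap.toSpanSingleton_apply]
    refine ⟨⟨Set.mem_iInter.2 fun j => ⟨_, hA j⟩, Set.mem_iInter.2 fun j => ?_⟩, ?_⟩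
    · have := (hA j).sub (hB j)
      rwa [sub_self] at this
    · have h3 : ∀ j, liminf (fun n => ENNReal.ofReal (a j n (x + t • u))) atTop =
          ENNReal.ofReal (deriv (rightD (line (g j) u x)) t) := fun j =>
        (ENNReal.tendsto_ofReal (hA j)).liminf_eq
      simp only [Set.mem_ofPred_eq, h3]
      exact ht2
  filter_upwards [hmem] with x hx
  obtain ⟨⟨h1, h2⟩, h3⟩ := hx
  choose q hq using fun j => Set.mem_iInter.1 h1 j
  have hq' : ∀ j, Tendsto (fun n => b j n x) atTop (𝓝 (q j)) := fun j => by
    have := (hq j).sub (Set.mem_iInter.1 h2 j)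
    rw [sub_zero] at this
    exact this.congr fun n => sub_sub_cancel _ _
  have hRx : ∀ j (c : ℝ), R j (x + c • u) = rightD (line (g j) u x) c :=
    fun j c => rightPartial_add (hg j) u x c
  refine ⟨q, fun j => hasDerivAt_of_tendsto_nat (monotone_rightD (convexOn_line (hg j) u x)) ?_ ?_, ?_⟩
  · refine (hq j).congr fun n => ?_
    simp only [a, hRx]; rfl
  · refine (hq' j).congr fun n => ?_
    simp only [b, hRx]; rfl
  · have h4 : ∀ j, liminf (fun n => ENNReal.ofReal (a j n x)) atTop = ENNReal.ofReal (q j) := fun j =>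
      (ENNReal.tendsto_ofReal (hq j)).liminf_eq
    simpa only [Set.mem_ofPred_eq, h4] using h3

end Lines

/-! ### Differentiability of the ground state energy -/

lemma line_norm_sq (ξ : E3) (l : Fin 3) (t : ℝ) :
    line (fun ξ : E3 => ‖ξ‖ ^ 2 / 2) (EuclideanSpace.single l 1) ξ t =
      ‖ξ‖ ^ 2 / 2 + t * ξ l + t ^ 2 / 2 := by
  have h : inner ℝ ξ (EuclideanSpace.single l (1 : ℝ)) = ξ l := by
    simp [EuclideanSpace.inner_single_right]
  rw [line, norm_add_sq_real, inner_smul_right, norm_smul, h, mul_pow, Real.norm_eq_abs, sq_abs]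
  simp
  ring

section

variable {f g : E3 → ℝ} (hf : ∀ ξ, f ξ = ‖ξ‖ ^ 2 / 2 - g ξ)
include hf

lemma line_eq_sub (ξ : E3) (l : Fin 3) :
    line f (EuclideanSpace.single l 1) ξ = fun t =>
      (‖ξ‖ ^ 2 / 2 + t * ξ l + t ^ 2 / 2) - line g (EuclideanSpace.single l 1) ξ t :=
  funext fun t => by rw [← line_norm_sq]; exact hf _

/-- Along the line, f and g are differentiable at the same points, and there the partial derivative
of f is ξ_l + t minus the right derivative of g. The right derivative is defined everywhere, so its
derivative at 0 gives the one relative to those points. -/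
lemma hasSecondPartialAt_of_convexOn (hg : ConvexOn ℝ Set.univ g) {ξ : E3} {l : Fin 3} {q : ℝ}
    (hd : DifferentiableAt ℝ g ξ)
    (hq : HasDerivAt (rightD (line g (EuclideanSpace.single l 1) ξ)) q 0) :
    HasSecondPartialAt f l ξ (1 - q) := by
  set u : E3 := EuclideanSpace.single l 1 with hu
  set S : Set ℝ := {t | LineDifferentiableAt ℝ f (ξ + t • u) u} with hS
  have hpoly : ∀ t, HasDerivAt (fun t : ℝ => ‖ξ‖ ^ 2 / 2 + t * ξ l + t ^ 2 / 2) (ξ l + t) t := by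
    intro t
    have := (((hasDerivAt_id t).mul_const (ξ l)).const_add (‖ξ‖ ^ 2 / 2)).add
      (((hasDerivAt_id t).pow 2).div_const 2)
    refine this.congr_deriv ?_
    simp
  have hline : ∀ t, (fun s => f (ξ + t • u + s • u)) = fun s => line f u ξ (t + s) := fun t =>
    funext fun s => line_add f u ξ t s
  have hmem : ∀ t, t ∈ S ↔ DifferentiableAt ℝ (line f u ξ) t := fun t => by
    simp only [hS, Set.mem_ofPred_eq, LineDifferentiableAt, hline]
    rw [differentiableAt_comp_add_left, add_zero]
  have hmem2 : ∀ t, DifferentiableAt ℝ (line g u ξ) t → t ∈ S := fun t ht => by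
    rw [hmem, hu, line_eq_sub hf]
    exact (hpoly t).differentiableAt.sub ht
  have hderiv : ∀ t ∈ S, lineDeriv ℝ f (ξ + t • u) u = ξ l + t - rightD (line g u ξ) t := by
    intro t ht
    have h1 : DifferentiableAt ℝ (line g u ξ) t := by
      have h2 : line g u ξ = fun t => (‖ξ‖ ^ 2 / 2 + t * ξ l + t ^ 2 / 2) - line f u ξ t :=
        funext fun t => by rw [hu, line_eq_sub hf]; ring
      rw [h2]
      exact (hpoly t).differentiableAt.sub ((hmem t).1 ht)
    rw [lineDeriv, hline, deriv_comp_const_add, add_zero, rightD_eq_deriv h1, hu, line_eq_sub hf]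
    exact ((hpoly t).sub h1.hasDerivAt).deriv
  have h0 : (0 : ℝ) ∈ S := by
    refine hmem2 0 ?_
    have h1 : DifferentiableAt ℝ (fun t : ℝ => ξ + t • u) 0 := by fun_prop
    have h2 : DifferentiableAt ℝ g (ξ + (0 : ℝ) • u) := by simpa using hd
    exact h2.comp (0 : ℝ) h1
  refine ⟨h0, ?_, ?_⟩
  · have h1 : ∀ᵐ t : ℝ, t ∈ S := by
      filter_upwards [ae_differentiableAt_of_convexOn volume (convexOn_line hg u ξ)] with t ht
      exact hmem2 t ht
    exact h1.filter_mono inf_le_right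
  · have h1 : HasDerivAt (fun t => ξ l + t - rightD (line g u ξ) t) (1 - q) 0 :=
      ((hasDerivAt_id 0).const_add (ξ l)).sub hq
    exact h1.hasDerivWithinAt.congr hderiv (hderiv 0 h0)

end

/-! ### Infima of affine functions, convergence of energies and gradients -/

/-- The infimum of a pointwise bounded below family of affine functions is concave. -/
lemma convexOn_neg_iInf {X : Type*} [Nonempty X] {b : X → E3} {a : X → ℝ}
    (hb : ∀ ξ, BddBelow (Set.range fun x => inner ℝ ξ (b x) + a x)) :
    ConvexOn ℝ Set.univ fun ξ => -⨅ x, (inner ℝ ξ (b x) + a x) := by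
  refine ⟨convex_univ, fun ξ _ η _ s t hs ht hst => ?_⟩
  simp only [smul_eq_mul]
  rw [mul_neg, mul_neg, ← neg_add, neg_le_neg_iff]
  refine le_ciInf fun x => ?_
  have h1 := mul_le_mul_of_nonneg_left (ciInf_le (hb ξ) x) hs
  have h2 := mul_le_mul_of_nonneg_left (ciInf_le (hb η) x) ht
  rw [inner_add_left, real_inner_smul_left, real_inner_smul_left]
  have h3 : a x = s * a x + t * a x := by rw [← add_mul, hst, one_mul]
  linarith

/-- Domination by c₀ bounds the infima from below for all j; from above, a single almost minimizing
point of c₀ suffices. No uniform convergence is required. -/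
lemma tendsto_iInf_of_le {X : Type*} [Nonempty X] {c : ℕ → X → ℝ} {c₀ : X → ℝ}
    (hb : BddBelow (Set.range c₀)) (hle : ∀ j x, c₀ x ≤ c j x)
    (hlim : ∀ x, Tendsto (fun j => c j x) atTop (𝓝 (c₀ x))) :
    Tendsto (fun j => ⨅ x, c j x) atTop (𝓝 (⨅ x, c₀ x)) := by
  have hb' : ∀ j, BddBelow (Set.range (c j)) := fun j => by
    obtain ⟨m, hm⟩ := hb
    refine ⟨m, ?_⟩
    rintro _ ⟨x, rfl⟩
    exact (hm ⟨x, rfl⟩).trans (hle j x)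
  refine tendsto_order.2 ⟨fun r hr => Eventually.of_forall fun j =>
    hr.trans_le (ciInf_mono hb (hle j)), fun r hr => ?_⟩
  obtain ⟨x, hx⟩ := exists_lt_of_ciInf_lt hr
  filter_upwards [(hlim x).eventually_lt_const hx] with j hj
  exact (ciInf_le (hb' j) x).trans_lt hj

lemma differentiableAt_norm_sq_sub {f g : E3 → ℝ} (hf : ∀ ξ, f ξ = ‖ξ‖ ^ 2 / 2 - g ξ) {ξ : E3}
    (hg : DifferentiableAt ℝ g ξ) : DifferentiableAt ℝ f ξ := by
  rw [funext hf]
  have h : DifferentiableAt ℝ (fun ξ : E3 => ‖ξ‖ ^ 2 / 2) ξ := by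
    simp only [div_eq_mul_inv]
    exact ((contDiff_norm_sq ℝ (n := 1)).differentiable one_ne_zero ξ).mul_const _
  exact h.sub hg

lemma gradient_apply_eq_deriv_line {f : E3 → ℝ} {ξ : E3} (hf : DifferentiableAt ℝ f ξ) (l : Fin 3) :
    HasDerivAt (line f (EuclideanSpace.single l 1) ξ) (gradient f ξ l) 0 := by
  have h1 := hf.hasGradientAt.hasFDerivAt.hasLineDerivAt (EuclideanSpace.single l (1 : ℝ))
  have h2 : (InnerProductSpace.toDual ℝ E3) (gradient f ξ) (EuclideanSpace.single l (1 : ℝ)) =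
      gradient f ξ l := by
    rw [InnerProductSpace.toDual_apply_apply, EuclideanSpace.inner_single_right]; simp
  rw [h2] at h1
  exact h1

/-- Gradients of functions of the form `ξ² / 2 - g`, with `g` convex, converge where they exist. -/
lemma tendsto_gradient {f g : ℕ → E3 → ℝ} {f₀ g₀ : E3 → ℝ}
    (hf : ∀ j ξ, f j ξ = ‖ξ‖ ^ 2 / 2 - g j ξ) (hf₀ : ∀ ξ, f₀ ξ = ‖ξ‖ ^ 2 / 2 - g₀ ξ)
    (hg : ∀ j, ConvexOn ℝ Set.univ (g j)) (hlim : ∀ ξ, Tendsto (fun j => g j ξ) atTop (𝓝 (g₀ ξ)))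
    {ξ : E3} (hd : ∀ j, DifferentiableAt ℝ (f j) ξ) (hd₀ : DifferentiableAt ℝ f₀ ξ) :
    Tendsto (fun j => gradient (f j) ξ) atTop (𝓝 (gradient f₀ ξ)) := by
  have key : ∀ l, Tendsto (fun j => gradient (f j) ξ l) atTop (𝓝 (gradient f₀ ξ l)) := by
    intro l
    set u : E3 := EuclideanSpace.single l 1
    have hpoly : HasDerivAt (fun t : ℝ => ‖ξ‖ ^ 2 / 2 + t * ξ l + t ^ 2 / 2) (ξ l) 0 := by
      have := (((hasDerivAt_id (0 : ℝ)).mul_const (ξ l)).const_add (‖ξ‖ ^ 2 / 2)).add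
        (((hasDerivAt_id (0 : ℝ)).pow 2).div_const 2)
      refine this.congr_deriv ?_
      simp
    have hline : ∀ {F G : E3 → ℝ}, (∀ ξ, F ξ = ‖ξ‖ ^ 2 / 2 - G ξ) → DifferentiableAt ℝ F ξ →
        HasDerivAt (line G u ξ) (ξ l - gradient F ξ l) 0 := by
      intro F G hF hd
      have h1 := hpoly.sub (gradient_apply_eq_deriv_line hd l)
      have h2 : line G u ξ = (fun t : ℝ => ‖ξ‖ ^ 2 / 2 + t * ξ l + t ^ 2 / 2) - line F u ξ :=
        funext fun t => by rw [Pi.sub_apply, line_eq_sub hF]; ring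
      rw [h2]
      exact h1
    have h1 := tendsto_of_convexOn_of_hasDerivAt (fun j => convexOn_line (hg j) u ξ)
      (fun t => hlim _) (fun j => hline (hf j) (hd j)) (hline hf₀ hd₀)
    simpa using h1.const_sub (ξ l)
  have h1 : Tendsto (fun j => WithLp.ofLp (gradient (f j) ξ)) atTop
      (𝓝 (WithLp.ofLp (gradient f₀ ξ))) := tendsto_pi_nhds.2 key
  exact ((PiLp.continuous_toLp 2 _).tendsto _).comp h1

/-- `ENNReal.ofReal` truncates negative numbers to 0, which is harmless because only an upper bound
along infinitely many j is wanted. -/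
lemma liminf_coe_lt_top {q : ℕ → ℝ} (h : liminf (fun j => ENNReal.ofReal (q j)) atTop < ⊤) :
    liminf (fun j => ((-(1 - q j) : ℝ) : EReal)) atTop < ⊤ := by
  obtain ⟨r, hr, -⟩ := ENNReal.lt_iff_exists_nnreal_btwn.1 h
  have h1 : ∃ᶠ j in atTop, ENNReal.ofReal (q j) < r := frequently_lt_of_liminf_lt (by isBoundedDefault) hr
  refine lt_of_le_of_lt (b := ((r : ℝ) : EReal)) ?_ (EReal.coe_lt_top _)
  refine liminf_le_of_frequently_le' (h1.mono fun j hj => ?_)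
  rw [← ENNReal.ofReal_coe_nnreal, ENNReal.ofReal_lt_ofReal_iff'] at hj
  exact EReal.coe_le_coe_iff.2 (by linarith [hj.1])

end

end PauliFierz

theorem mainTheorem6 (s : PauliFierz.Spin) (e Λ : ℝ) (hΛ : 0 < Λ)
    (ε : Fin 2 → PauliFierz.E3 → PauliFierz.E3) (hε : PauliFierz.IsPolarization ε)
    (m : ℕ → ℝ) (hm_nonneg : ∀ j, 0 ≤ m j) (hm : Tendsto m atTop (𝓝 0)) :
    ∃ D : Set PauliFierz.E3, volume Dᶜ = 0 ∧ ∀ ξ ∈ D,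
      (∀ j, DifferentiableAt ℝ (PauliFierz.groundEnergy s ε Λ e (m j)) ξ) ∧
      DifferentiableAt ℝ (PauliFierz.groundEnergy s ε Λ e 0) ξ ∧
      Tendsto (fun j => gradient (PauliFierz.groundEnergy s ε Λ e (m j)) ξ) atTop
        (𝓝 (gradient (PauliFierz.groundEnergy s ε Λ e 0) ξ)) ∧
      ∃ c : ℕ → Fin 3 → ℝ,
        (∀ j l, PauliFierz.HasSecondPartialAt
          (PauliFierz.groundEnergy s ε Λ e (m j)) l ξ (c j l)) ∧
        ∀ l, liminf (fun j => ((-c j l : ℝ) : EReal)) atTop < ⊤ := by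
  obtain ⟨X, b, a, hX, ha, hle, hbdd, hE⟩ := PauliFierz.exists_groundEnergy_eq_iInf s hε Λ e
  let g : ℝ → PauliFierz.E3 → ℝ := fun μ ξ => -⨅ x, (inner ℝ ξ (b x) + a μ x)
  have hf : ∀ μ ξ, PauliFierz.groundEnergy s ε Λ e μ ξ = ‖ξ‖ ^ 2 / 2 - g μ ξ := fun μ ξ => by
    rw [hE, sub_neg_eq_add]
  have hg : ∀ μ, ConvexOn ℝ Set.univ (g μ) := fun μ => PauliFierz.convexOn_neg_iInf (hbdd μ)
  have hlim : ∀ ξ, Tendsto (fun j => g (m j) ξ) atTop (𝓝 (g 0 ξ)) := fun ξ =>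
    (PauliFierz.tendsto_iInf_of_le (hbdd 0 ξ) (fun j x => add_le_add le_rfl (hle (m j) x))
      fun x => tendsto_const_nhds.add ((ha x).comp hm)).neg
  have h1 : ∀ᵐ ξ : PauliFierz.E3, ∀ j, DifferentiableAt ℝ (g (m j)) ξ :=
    ae_all_iff.2 fun j => PauliFierz.ae_differentiableAt_of_convexOn volume (hg (m j))
  have h2 : ∀ᵐ ξ : PauliFierz.E3, DifferentiableAt ℝ (g 0) ξ :=
    PauliFierz.ae_differentiableAt_of_convexOn volume (hg 0)
  have h3 := ae_all_iff.2 fun l : Fin 3 => PauliFierz.ae_exists_hasDerivAt_rightD volume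
    (fun j => hg (m j)) hlim (EuclideanSpace.single l 1)
  -- The set D is where all g_{m_j} and g_0 are differentiable and the second derivatives in the
  -- three coordinate directions behave; countably many null sets are removed.
  refine ⟨_, h1.and (h2.and h3), ?_⟩
  rintro ξ ⟨hd, hd₀, hq⟩
  have hd' := fun j => PauliFierz.differentiableAt_norm_sq_sub (hf (m j)) (hd j)
  have hd₀' := PauliFierz.differentiableAt_norm_sq_sub (hf 0) hd₀
  choose q hq hfin using hq
  exact ⟨hd', hd₀', PauliFierz.tendsto_gradient (fun j => hf (m j)) (hf 0) (fun j => hg (m j)) hlim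
    hd' hd₀', fun j l => 1 - q l j,
    fun j l => PauliFierz.hasSecondPartialAt_of_convexOn (hf (m j)) (hg (m j)) (hd j) (hq l j),
    fun l => PauliFierz.liminf_coe_lt_top (hfin l)⟩
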